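/- **Model.** Let $I$ be a finite nonempty set of resources; resource $i$ has $c_i\ge 1$ units, a usage distribution $F_i$, which is an arbitrary probability distribution on $[0,\infty]$ (the value $\infty$ means that the unit never returns; $F_i(x)$ denotes the probability of a duration at most $x$), and a nonnegative reward function $r_i(\cdot)$ with finite mean $r_i=\mathbb E_{d\sim F_i}[r_i(d)]$. Arrivals $t=1,\dots,T$ occur at times $a(1)<\dots<a(T)$; arrival $t$ has a set $S_t\subseteq I$ of adjacent resources. In *online $b$-matching with reusable resources*, on arrival $t$ one must immediately and irrevocably match $t$ to an available unit of some $i\in S_t$, or reject $t$. A match to $i$ earns $r_i(d_{it})$ and keeps the unit in use until time $a(t)+d_{it}$, where the durations $d_{it}\sim F_i$ are independent, and a duration is revealed only when the unit returns. The online algorithm knows $c_i,F_i,r_i$ but no arrival in advance. In the version *with customer choice* there are a nonempty downward closed family $\mathcal F$ of feasible assortments and, for each $t$, a choice model $\phi_t(S,i)\ge 0$ (zero for $i\notin S$, $\sum_{i\in S}\phi_t(S,i)\le 1$, and $\phi_t(S',i)\le\phi_t(S,i)$ for $i\in S\subseteq S'$); on arrival $t$ one offers some $S\in\mathcal F$ consisting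 of available resources of $S_t$, and customer $t$ takes one unit of $i\in S$ with probability $\phi_t(S,i)$ (and nothing with the remaining probability), independently of everything else. A *clairvoyant policy* is any, possibly randomized, policy that knows the whole instance in advance (including all arrivals, their times, adjacency sets and choice models) but sees choices when they are made and durations only when units return. Put $c_{\min}=\min_i c_i$, $g(x)=e^{-x}$ and $\delta_i=\sqrt{100\log c_i/c_i}$. **Algorithms.** GALG is deterministic and fractional. With $y_i(k,\tau)$ the fraction of unit $k\in\{1,\dots,c_i\}$ of $i$ matched to arrival $\tau$, the available fraction of that unit when $t$ arrives is $z_i(k)=1-\sum_{\tau<t}y_i(k,\tau)\,(1-F_i(a(t)-a(\tau)))$. As long as arrival $t$ is matched to a total extent $\eta<1$, let $k^*(i)$ be the highest unit of $i$ with $z_i(k)>0$ (and $0$ if there is none), let $i^*\in S_t$ maximize the reduced price $r_i(1-g(k^*(i)/c_i))$ (ties broken in any way), stop if $k^*(i^*)=0$ (or if $S_t=\emptyset$), and otherwise match fraction $\min\{z_{i^*}(k^*(i^*)),1-\eta\}$ of unit $k^*(i^*)$ of $i^*$ to $t$. Let $x_{it}=\sum_k y_i(k,t)$. ALG draws at arrival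 $t$, independently, resource $i$ with probability $x_{it}/(1+\delta_i)$ (no resource with the remaining probability), and matches $t$ to $i$ if a unit of $i$ is available; otherwise it rejects $t$. With customer choice, GALG instead repeats, as long as the total weight $\eta$ at $t$ is less than $1$ and the set $S=\{i\in S_t: k^*(i)>0\}$ is nonempty: let $A\subseteq S$ be a feasible assortment that maximizes $\sum_{i\in A}\phi_t(A,i)\,r_i(1-g(k^*(i)/c_i))$, as returned by an oracle that never includes a resource with $\phi_t(A,i)=0$; give $A$ the weight $y=\min\{1-\eta,\ \min_{i\in A}z_i(k^*(i))/\phi_t(A,i)\}$, consume the fraction $y\,\phi_t(A,i)$ of unit $k^*(i)$ of each $i\in A$ (these fractions make up the $y_i(k,t)$), and increase $\eta$ by $y$. The assortment algorithm draws at $t$ an assortment $A$ of this collection with probability equal to its weight, lets $S$ be the set of resources of $A$ that are available, applies probability matching to $S$ with targets $p_s=\phi_t(A,s)/(1+\delta_s)$, draws an assortment of the resulting collection with probability equal to its weight, and offers it; if a draw yields nothing, it rejects $t$. Probability matching repeats, until $S$ is empty: let $s^*$ minimize $p_s/\phi_t(S,s)$ over $s\in S$, output the assortment $S$ with weight $y=p_{s^*}/\phi_t(S,s^*)$,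 replace $p_s$ by $p_s-y\,\phi_t(S,s)$, and remove $s^*$ from $S$. **Theorem 1.** There is a function $\delta:\mathbb N\to\mathbb R$ with $\delta(c)=O\!\left(\sqrt{\log c/c}\right)$ as $c\to\infty$, not depending on the instance, such that: 1. for every instance of online $b$-matching with reusable resources, every tie-breaking in the algorithm and every clairvoyant policy $\pi$, the expected total rewards satisfy $\mathrm{ALG}\ \ge\ (1-1/e-\delta(c_{\min}))\cdot\mathrm{value}(\pi)$; 2. for every instance with customer choice, every such oracle, every tie-breaking and every clairvoyant policy $\pi$, the assortment algorithm satisfies the same inequality with the same $\delta$. Thus the guarantee converges to $1-1/e$ as $c_{\min}\to\infty$. This limit is the best achievable: for every $\varepsilon>0$ and every $c_0$ there are resources with inventories $c_i\ge c_0$, usage distributions, reward functions and arrival times such that for every randomized online algorithm for $b$-matching (even one that knows these data, and from which only the future edges are hidden) there is a choice of the edges for which some clairvoyant policy has value $V>0$ and the algorithm has expected reward at most $(1-1/e+\varepsilon)\,V$. -/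

import Mathlib

open MeasureTheory Filter Topology Asymptotics
open scoped ENNReal

noncomputable section

namespace Reusable

/-! ### Sampling, sequential play and tie-breaking -/

/-- Lay the weights of a list one after the other on the line, starting at `0`, and return the
item whose half-open interval `(left, right]` contains `u` (`none` if there is no such item). -/
def pick {α : Type} : List (α × ℝ) → ℝ → Option α
  | [], _ => none
  | (x, w) :: l, u => if 0 < u ∧ u ≤ w then some x else pick l (u - w)

/-- The uniform distribution on `[0, 1]`. -/
def unif : Measure ℝ := (volume : Measure ℝ).restrict (Set.Icc 0 1)

/-- Outcomes of the first `n` arrivals, when the outcome at arrival `t` is computed by `decide t`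
from the outcomes at earlier arrivals (the value `init` stands for "not yet arrived"). -/
def playout {T : ℕ} {α : Type} (init : α) (decide : Fin T → (Fin T → α) → α) :
    ℕ → Fin T → α
  | 0 => fun _ => init
  | n + 1 => fun τ =>
      if τ.val = n then decide τ (playout init decide n) else playout init decide n τ

/-- A way of breaking ties in `argmax`. -/
structure ArgmaxRule (I : Type) where
  select : Finset I → (I → ℝ) → I
  select_mem : ∀ (S : Finset I) (f : I → ℝ), S.Nonempty → select S f ∈ S
  le_select : ∀ (S : Finset I) (f : I → ℝ), ∀ j ∈ S, f j ≤ f (select S f)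

theorem iterate_fixed {σ : Type} (f : σ → σ) (μ : σ → ℕ) (h : ∀ s, f s = s ∨ μ (f s) < μ s)
    (n : ℕ) (s : σ) (hs : μ s ≤ n) : f (f^[n] s) = f^[n] s := by
  induction n generalizing s with
  | zero => rcases h s with h | h
            · simpa using h
            · omega
  | succ n ih =>
    rw [Function.iterate_succ_apply]
    rcases h s with h' | h'
    · have := Function.iterate_fixed h' n
      rw [h', this, h']
    · exact ih _ (by omega)

/-! ### The model: online `b`-matching with reusable resources -/

/-- An instance with resources `I` and arrivals `0, …, T - 1`. Usage durations take values in
`[0, ∞]`, the value `∞` meaning that the unit never returns. -/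
structure Network (I : Type) (T : ℕ) where
  /-- starting inventories -/
  cap : I → ℕ
  cap_pos : ∀ i, 0 < cap i
  /-- arrival times -/
  arr : Fin T → ℝ
  arr_strictMono : StrictMono arr
  /-- edges: the resources adjacent to an arrival -/
  nbr : Fin T → Finset I
  /-- usage distributions -/
  usage : I → Measure ℝ≥0∞
  usage_prob : ∀ i, IsProbabilityMeasure (usage i)
  /-- reward of a use of a resource, as a function of its duration -/
  rew : I → ℝ≥0∞ → ℝ
  rew_nonneg : ∀ i d, 0 ≤ rew i d
  rew_integrable : ∀ i, Integrable (rew i) (usage i)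

attribute [instance] Network.usage_prob

namespace Network

variable {I : Type} {T : ℕ}

/-- The same instance with another set of edges. -/
def withNbr (N : Network I T) (E : Fin T → Finset I) : Network I T := { N with nbr := E }

/-- The smallest starting inventory. -/
def cmin [Fintype I] [Nonempty I] (N : Network I T) : ℕ :=
  Finset.univ.inf' Finset.univ_nonempty N.cap

/-- Expected reward of one use of resource `i`. -/
def meanRew (N : Network I T) (i : I) : ℝ := ∫ d, N.rew i d ∂(N.usage i)

/-- Time elapsed from arrival `τ` to arrival `t`. -/
def elapsed (N : Network I T) (τ t : Fin T) : ℝ≥0∞ := ENNReal.ofReal (N.arr t - N.arr τ)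

/-- The usage distribution function of resource `i`. -/
def cdf (N : Network I T) (i : I) (x : ℝ≥0∞) : ℝ := (N.usage i).real (Set.Iic x)

/-- Number of units of `i` that are in use when arrival `t` occurs, given the allocation `X`
(only arrivals before `t` matter) and the durations `d`. A unit allocated to `τ` has returned
once the elapsed time is at least its duration. -/
def inUse [DecidableEq I] (N : Network I T) (X : Fin T → Option I) (d : Fin T → I → ℝ≥0∞)
    (t : Fin T) (i : I) : ℕ :=
  (Finset.univ.filter
    (fun τ : Fin T => τ < t ∧ X τ = some i ∧ N.elapsed τ t < d τ i)).card

/-- Total reward of an allocation. -/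
def totalReward [Fintype I] [DecidableEq I] (N : Network I T) (X : Fin T → Option I)
    (d : Fin T → I → ℝ≥0∞) : ℝ :=
  ∑ t, ∑ i, if X t = some i then N.rew i (d t i) else 0

/-- Two scenarios look the same up to arrival `t`: same allocations before `t`, and same
durations of all the units that have returned by then in either scenario. -/
def SameHistory (N : Network I T) (t : Fin T) (X X' : Fin T → Option I)
    (d d' : Fin T → I → ℝ≥0∞) : Prop :=
  ∀ τ < t, X τ = X' τ ∧ ∀ i, X τ = some i →
    (d τ i ≤ N.elapsed τ t ∨ d' τ i ≤ N.elapsed τ t) → d τ i = d' τ i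

/-- Joint law of the durations: `d t i` has law `usage i`, all independent. -/
def durationLaw [Fintype I] (N : Network I T) : Measure (Fin T → I → ℝ≥0∞) :=
  Measure.pi fun _ => Measure.pi N.usage

/-- Sample space: a uniform random number for each arrival (internal randomness of an
algorithm) and the usage durations. -/
abbrev Sample (I : Type) (T : ℕ) : Type := (Fin T → ℝ) × (Fin T → I → ℝ≥0∞)

/-- The law on the sample space. -/
def law [Fintype I] (N : Network I T) : Measure (Sample I T) :=
  (Measure.pi fun _ => unif).prod N.durationLaw

/-- A clairvoyant (offline) policy: it may depend in any way on the whole instance `N` and on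
internal randomness, but it sees the duration of a use only when the unit returns. -/
structure Policy [Fintype I] [DecidableEq I] (N : Network I T) where
  assign : Fin T → Sample I T → Option I
  measurable_assign : ∀ t i, MeasurableSet {ω | assign t ω = some i}
  adjacent : ∀ t ω i, assign t ω = some i → i ∈ N.nbr t
  available : ∀ t ω i, assign t ω = some i →
    N.inUse (fun τ => assign τ ω) ω.2 t i < N.cap i
  nonanticipating : ∀ t ω ω', ω.1 = ω'.1 →
    N.SameHistory t (fun τ => assign τ ω) (fun τ => assign τ ω') ω.2 ω'.2 →
    assign t ω = assign t ω'

/-- Expected total reward of a policy. -/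
def Policy.value [Fintype I] [DecidableEq I] {N : Network I T} (π : N.Policy) : ℝ :=
  ∫ ω, N.totalReward (fun t => π.assign t ω) ω.2 ∂N.law

/-! ### The fluid-guided algorithm for matching -/

/-- Reduced price `r_i (1 - g (k / c_i))` with `g x = exp (-x)`. -/
def price (N : Network I T) (i : I) (k : ℕ) : ℝ :=
  N.meanRew i * (1 - Real.exp (-((k : ℝ) / (N.cap i : ℝ))))

/-- The highest unit of `i` with a positive available fraction (`0` if there is none); units are
numbered `1, …, c_i` and `z i k` is the available fraction of unit `k`. -/
def topUnit (N : Network I T) (z : I → ℕ → ℝ) (i : I) : ℕ :=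
  ((Finset.Icc 1 (N.cap i)).filter (fun k => 0 < z i k)).sup id

/-- Fraction of unit `k` of `i` that is available just before arrival `t` is matched, if
fraction `y τ i k` of it was matched to each earlier arrival `τ`: of this fraction, exactly the
part `F_i (d)` has returned by time `d` after `τ`. -/
def fluidAvail (N : Network I T) (y : Fin T → I → ℕ → ℝ) (t : Fin T) (i : I) (k : ℕ) : ℝ :=
  1 - ∑ τ ∈ Finset.univ.filter (fun τ : Fin T => τ < t),
    y τ i k * (1 - N.cdf i (N.elapsed τ t))

/-- State of the matching loop at an arrival: `frac i k` is the fraction of unit `k` of `i`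
matched to this arrival so far and `eta` the matched fraction of the arrival. -/
structure LoopState (I : Type) where
  frac : I → ℕ → ℝ
  eta : ℝ

/-- The units with a positive available fraction. -/
def activeUnits [Fintype I] (N : Network I T) (z : I → ℕ → ℝ) : Finset (Σ _ : I, ℕ) :=
  (Finset.univ.sigma fun i => Finset.Icc 1 (N.cap i)).filter (fun q => 0 < z q.1 q.2)

theorem card_activeUnits_le [Fintype I] (N : Network I T) (z : I → ℕ → ℝ) :
    (N.activeUnits z).card ≤ ∑ i, N.cap i := by
  refine (Finset.card_filter_le _ _).trans ?_
  simp [Finset.card_sigma]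

theorem topUnit_spec (N : Network I T) (z : I → ℕ → ℝ) (i : I) (h : 0 < N.topUnit z i) :
    N.topUnit z i ∈ Finset.Icc 1 (N.cap i) ∧ 0 < z i (N.topUnit z i) := by
  have hne : ((Finset.Icc 1 (N.cap i)).filter (fun k => 0 < z i k)).Nonempty := by
    by_contra hc
    rw [Finset.not_nonempty_iff_eq_empty] at hc
    simp [topUnit, hc] at h
  obtain ⟨k, hk, hk'⟩ := Finset.exists_mem_eq_sup _ hne id
  rw [Finset.mem_filter] at hk
  have : N.topUnit z i = k := hk'
  rw [this]
  exact hk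

section GALG

variable [Fintype I] [DecidableEq I]

/-- Available fractions inside the loop, `z₀` being the available fractions before it. -/
def remaining (z₀ : I → ℕ → ℝ) (frac : I → ℕ → ℝ) (i : I) (k : ℕ) : ℝ := z₀ i k - frac i k

/-- One pass through the body of the while loop (the identity after the loop has been left). -/
def galgStep (N : Network I T) (sel : ArgmaxRule I) (t : Fin T) (z₀ : I → ℕ → ℝ)
    (s : LoopState I) : LoopState I :=
  let z := remaining z₀ s.frac
  let i₀ := sel.select (N.nbr t) (fun i => N.price i (N.topUnit z i))
  let k₀ := N.topUnit z i₀
  let m := min (z i₀ k₀) (1 - s.eta)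
  if s.eta < 1 ∧ (N.nbr t).Nonempty ∧ 0 < k₀ then
    { frac := fun i k => s.frac i k + if i = i₀ ∧ k = k₀ then m else 0
      eta := s.eta + m }
  else s

/-- The while loop at arrival `t`; it is left after at most `∑ i, c_i` passes. -/
def galgLoop (N : Network I T) (sel : ArgmaxRule I) (t : Fin T) (z₀ : I → ℕ → ℝ) :
    LoopState I :=
  (N.galgStep sel t z₀)^[∑ i, N.cap i] { frac := fun _ _ => 0, eta := 0 }

/-- The loop has indeed been left: another pass changes nothing. -/
theorem galgStep_galgLoop (N : Network I T) (sel : ArgmaxRule I) (t : Fin T)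
    (z₀ : I → ℕ → ℝ) :
    N.galgStep sel t z₀ (N.galgLoop sel t z₀) = N.galgLoop sel t z₀ := by
  refine iterate_fixed _
    (fun s => if s.eta < 1 then (N.activeUnits (remaining z₀ s.frac)).card else 0) ?_ _ _ ?_
  · intro s
    by_cases hg : s.eta < 1 ∧ (N.nbr t).Nonempty ∧ 0 < N.topUnit (remaining z₀ s.frac)
        (sel.select (N.nbr t) (fun i => N.price i (N.topUnit (remaining z₀ s.frac) i)))
    · right
      simp only [galgStep, if_pos hg, if_pos hg.1]
      set z := remaining z₀ s.frac with hz
      set i₀ := sel.select (N.nbr t) (fun i => N.price i (N.topUnit z i))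
      obtain ⟨h1, h2⟩ := N.topUnit_spec z i₀ hg.2.2
      set k₀ := N.topUnit z i₀
      have hmem : (⟨i₀, k₀⟩ : Σ _ : I, ℕ) ∈ N.activeUnits z := by
        simp only [activeUnits, Finset.mem_filter, Finset.mem_sigma, Finset.mem_univ, true_and]
        exact ⟨h1, h2⟩
      split_ifs with he
      · apply Finset.card_lt_card
        have hmin : min (z i₀ k₀) (1 - s.eta) = z i₀ k₀ := by
          rcases min_choice (z i₀ k₀) (1 - s.eta) with h | h
          · exact h
          · rw [h] at he
            linarith
        rw [hmin, Finset.ssubset_iff_of_subset]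
        · refine ⟨_, hmem, ?_⟩
          intro hq
          have := (Finset.mem_filter.1 hq).2
          simp [hz, remaining] at this
        · intro q hq
          simp only [activeUnits, Finset.mem_filter] at hq ⊢
          refine ⟨hq.1, ?_⟩
          have := hq.2
          simp only [remaining] at this
          split_ifs at this with hc
          · rw [hc.1, hc.2]
            exact h2
          · simpa [hz, remaining] using this
      · exact Finset.card_pos.2 ⟨_, hmem⟩
    · left
      simp only [galgStep, if_neg hg]
  · simp only [zero_lt_one, if_true]
    exact N.card_activeUnits_le _

/-- Output of the fluid-guided algorithm: the fraction of unit `k` of `i` matched to `t`. -/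
def galg (N : Network I T) (sel : Fin T → ArgmaxRule I) : Fin T → I → ℕ → ℝ :=
  playout (fun _ _ => 0) (fun t y => (N.galgLoop (sel t) t (N.fluidAvail y t)).frac) T

/-- `x_{it}`: the total fraction of arrival `t` matched to `i` by the fluid-guided algorithm. -/
def galgX (N : Network I T) (sel : Fin T → ArgmaxRule I) (t : Fin T) (i : I) : ℝ :=
  ∑ k ∈ Finset.Icc 1 (N.cap i), N.galg sel t i k

end GALG

/-! ### The online algorithm for matching -/

/-- `δ_i = √(100 log c_i / c_i)`. -/
def del (N : Network I T) (i : I) : ℝ :=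
  Real.sqrt (100 * Real.log (N.cap i : ℝ) / (N.cap i : ℝ))

section ALG

variable [Fintype I] [LinearOrder I]

/-- Allocation made by the algorithm: at `t`, draw `i` with probability `x_{it} / (1 + δ_i)`
and match `t` to `i` if a unit of `i` is available; otherwise reject `t`. -/
def alg (N : Network I T) (sel : Fin T → ArgmaxRule I) (ω : Sample I T) : Fin T → Option I :=
  playout none
    (fun t X =>
      (pick (((N.nbr t).sort (· ≤ ·)).map fun i => (i, N.galgX sel t i / (1 + N.del i)))
        (ω.1 t)).bind
      fun i => if N.inUse X ω.2 t i < N.cap i then some i else none) T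

/-- Expected total reward of the algorithm. -/
def algValue (N : Network I T) (sel : Fin T → ArgmaxRule I) : ℝ :=
  ∫ ω, N.totalReward (N.alg sel ω) ω.2 ∂N.law

end ALG

end Network

/-! ### Customer choice -/

/-- An instance with customer choice: a nonempty downward closed family of feasible assortments
and, for every arrival, a substitutable choice model; `choice t S i` is the probability that
customer `t` chooses `i` when offered the assortment `S`. -/
structure ChoiceNetwork (I : Type) [Fintype I] (T : ℕ) extends Network I T where
  feas : Set (Finset I)
  feas_empty : ∅ ∈ feas
  feas_down : ∀ S ∈ feas, ∀ S' ⊆ S, S' ∈ feas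
  choice : Fin T → Finset I → I → ℝ
  choice_nonneg : ∀ t S i, 0 ≤ choice t S i
  choice_off : ∀ t S i, i ∉ S → choice t S i = 0
  choice_sum : ∀ t S, ∑ i ∈ S, choice t S i ≤ 1
  choice_subst : ∀ t S S' i, S ⊆ S' → i ∈ S → choice t S' i ≤ choice t S i

/-- A revenue maximization oracle: given (nonnegative) prices and a set of resources, it returns
a feasible assortment from this set with the largest expected revenue, and never includes
resources that are chosen with probability zero. -/
structure ChoiceNetwork.Oracle {I : Type} [Fintype I] {T : ℕ} (N : ChoiceNetwork I T) where
  best : Fin T → (I → ℝ) → Finset I → Finset I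
  best_subset : ∀ t p S, (∀ i, 0 ≤ p i) → best t p S ⊆ S
  best_feas : ∀ t p S, (∀ i, 0 ≤ p i) → best t p S ∈ N.feas
  best_pos : ∀ t p S, (∀ i, 0 ≤ p i) → ∀ i ∈ best t p S, 0 < N.choice t (best t p S) i
  best_max : ∀ t p S, (∀ i, 0 ≤ p i) → ∀ A ∈ N.feas, A ⊆ S →
    ∑ i ∈ A, N.choice t A i * p i ≤
      ∑ i ∈ best t p S, N.choice t (best t p S) i * p i

namespace ChoiceNetwork

variable {I : Type} [Fintype I] {T : ℕ}

/-- Sample space: two uniform numbers for each arrival (internal randomness of an algorithm),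
one for the choice of the customer, and the usage durations. -/
abbrev Sample (I : Type) (T : ℕ) : Type :=
  (Fin T → ℝ × ℝ) × (Fin T → ℝ) × (Fin T → I → ℝ≥0∞)

/-- The law on the sample space. -/
def law (N : ChoiceNetwork I T) : Measure (Sample I T) :=
  (Measure.pi fun _ => unif.prod unif).prod
    ((Measure.pi fun _ => unif).prod N.toNetwork.durationLaw)

/-- The resource chosen by customer `t` from the assortment `S` (`none`: no purchase), as a
function of the uniform number `w`: it is `i` with probability `choice t S i`. -/
def chosen [LinearOrder I] (N : ChoiceNetwork I T) (t : Fin T) (S : Finset I) (w : ℝ) :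
    Option I :=
  pick ((S.sort (· ≤ ·)).map fun i => (i, N.choice t S i)) w

/-- A clairvoyant (offline) policy: it offers feasible assortments of available adjacent
resources and may depend in any way on the whole instance `N` and on internal randomness, but
it sees only the choices made so far and the durations of the units that have returned. -/
structure Policy [LinearOrder I] (N : ChoiceNetwork I T) where
  offer : Fin T → Sample I T → Finset I
  measurable_offer : ∀ t S, MeasurableSet {ω | offer t ω = S}
  feasible : ∀ t ω, offer t ω ∈ N.feas
  adjacent : ∀ t ω, offer t ω ⊆ N.nbr t
  available : ∀ t ω, ∀ i ∈ offer t ω,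
    N.inUse (fun τ => N.chosen τ (offer τ ω) (ω.2.1 τ)) ω.2.2 t i < N.cap i
  nonanticipating : ∀ t ω ω', ω.1 = ω'.1 →
    N.SameHistory t (fun τ => N.chosen τ (offer τ ω) (ω.2.1 τ))
      (fun τ => N.chosen τ (offer τ ω') (ω'.2.1 τ)) ω.2.2 ω'.2.2 →
    offer t ω = offer t ω'

/-- Expected total reward of a policy. -/
def Policy.value [LinearOrder I] {N : ChoiceNetwork I T} (π : N.Policy) : ℝ :=
  ∫ ω, N.totalReward (fun t => N.chosen t (π.offer t ω) (ω.2.1 t)) ω.2.2 ∂N.law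

/-! ### The fluid-guided algorithm for assortments -/

/-- State of the loop at an arrival: `frac i k` is the fraction of unit `k` of `i` consumed by
this arrival so far, `menu` the collection of assortments with their weights, `eta` the total
weight. -/
structure LoopState (I : Type) where
  frac : I → ℕ → ℝ
  eta : ℝ
  menu : List (Finset I × ℝ)

variable [DecidableEq I]

/-- One pass through the body of the while loop (the identity after the loop has been left). -/
def galgStep (N : ChoiceNetwork I T) (orc : N.Oracle) (t : Fin T) (z₀ : I → ℕ → ℝ)
    (s : LoopState I) : LoopState I :=
  let z := Network.remaining z₀ s.frac
  let S := (N.nbr t).filter (fun i => 0 < N.topUnit z i)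
  let A := orc.best t (fun i => N.price i (N.topUnit z i)) S
  -- the minimum of `1 - eta` and the numbers `z_i (k*(i)) / φ (A, i)` for `i ∈ A`
  let m := A.fold min (1 - s.eta) (fun i => z i (N.topUnit z i) / N.choice t A i)
  if s.eta < 1 ∧ S.Nonempty then
    { frac := fun i k =>
        s.frac i k + if i ∈ A ∧ k = N.topUnit z i then m * N.choice t A i else 0
      eta := s.eta + m
      menu := s.menu ++ [(A, m)] }
  else s

/-- The while loop at arrival `t`; it is left after at most `∑ i, c_i` passes. -/
def galgLoop (N : ChoiceNetwork I T) (orc : N.Oracle) (t : Fin T) (z₀ : I → ℕ → ℝ) :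
    LoopState I :=
  (N.galgStep orc t z₀)^[∑ i, N.cap i] { frac := fun _ _ => 0, eta := 0, menu := [] }

/-- The loop has indeed been left: another pass changes nothing. -/
theorem galgStep_galgLoop (N : ChoiceNetwork I T) (orc : N.Oracle) (t : Fin T)
    (z₀ : I → ℕ → ℝ) :
    N.galgStep orc t z₀ (N.galgLoop orc t z₀) = N.galgLoop orc t z₀ := by
  refine iterate_fixed _ (fun s => if s.eta < 1 then
    (N.activeUnits (Network.remaining z₀ s.frac)).card else 0) ?_ _ _ ?_
  · intro s
    by_cases hg : s.eta < 1 ∧ ((N.nbr t).filter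
        (fun i => 0 < N.topUnit (Network.remaining z₀ s.frac) i)).Nonempty
    · right
      simp only [galgStep, if_pos hg, if_pos hg.1]
      set z := Network.remaining z₀ s.frac with hz
      set S := (N.nbr t).filter (fun i => 0 < N.topUnit z i) with hS
      have hp : ∀ i, 0 ≤ N.price i (N.topUnit z i) := fun i => by
        refine mul_nonneg (integral_nonneg fun d => N.rew_nonneg i d) ?_
        rw [sub_nonneg, Real.exp_le_one_iff]
        exact neg_nonpos.2 (by positivity)
      have hsub := orc.best_subset t (fun i => N.price i (N.topUnit z i)) S hp
      have hpos := orc.best_pos t (fun i => N.price i (N.topUnit z i)) S hp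
      set A := orc.best t (fun i => N.price i (N.topUnit z i)) S
      have hA : ∀ i ∈ A, 0 < N.topUnit z i := fun i hi => (Finset.mem_filter.1 (hsub hi)).2
      set m := A.fold min (1 - s.eta) (fun i => z i (N.topUnit z i) / N.choice t A i) with hm
      have hm0 : 0 < m := by
        rw [hm, Finset.lt_fold_min]
        exact ⟨by linarith [hg.1], fun i hi =>
          div_pos (N.topUnit_spec z i (hA i hi)).2 (hpos i hi)⟩
      have hmem : ∀ i, 0 < N.topUnit z i →
          (⟨i, N.topUnit z i⟩ : Σ _ : I, ℕ) ∈ N.activeUnits z := fun i hi => by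
        simp only [Network.activeUnits, Finset.mem_filter, Finset.mem_sigma, Finset.mem_univ,
          true_and]
        exact N.topUnit_spec z i hi
      split_ifs with he
      · apply Finset.card_lt_card
        have hex : ∃ i ∈ A, z i (N.topUnit z i) / N.choice t A i ≤ m := by
          have h := (Finset.fold_min_le (s := A) (b := 1 - s.eta)
            (f := fun i => z i (N.topUnit z i) / N.choice t A i) m).1 hm.ge
          rcases h with h | h
          · linarith
          · exact h
        obtain ⟨i₁, hi₁, hle⟩ := hex
        rw [div_le_iff₀ (hpos i₁ hi₁)] at hle
        rw [Finset.ssubset_iff_of_subset]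
        · refine ⟨_, hmem i₁ (hA i₁ hi₁), ?_⟩
          intro hq
          have := (Finset.mem_filter.1 hq).2
          simp only [Network.remaining, hi₁, and_self, if_true] at this
          have hzi : z i₁ (N.topUnit z i₁) =
            z₀ i₁ (N.topUnit z i₁) - s.frac i₁ (N.topUnit z i₁) := rfl
          linarith
        · intro q hq
          simp only [Network.activeUnits, Finset.mem_filter] at hq ⊢
          refine ⟨hq.1, ?_⟩
          have := hq.2
          simp only [Network.remaining] at this
          split_ifs at this with hc
          · have hmp := mul_pos hm0 (hpos _ hc.1)
            simp only [hz, Network.remaining]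
            linarith
          · simpa [hz, Network.remaining] using this
      · obtain ⟨i, hi⟩ := hg.2
        exact Finset.card_pos.2 ⟨_, hmem i (Finset.mem_filter.1 hi).2⟩
    · left
      simp only [galgStep, if_neg hg]
  · simp only [zero_lt_one, if_true]
    exact N.card_activeUnits_le _

/-- Output of the fluid-guided algorithm at every arrival. -/
def galg (N : ChoiceNetwork I T) (orc : N.Oracle) : Fin T → LoopState I :=
  playout { frac := fun _ _ => 0, eta := 0, menu := [] }
    (fun t s => N.galgLoop orc t (N.fluidAvail (fun τ => (s τ).frac) t)) T

/-! ### Probability matching and the online algorithm for assortments -/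

/-- `n` rounds of probability matching from the set `S` with target probabilities `p`, for the
choice model `φ`: add the current set with the smallest ratio `p s / φ S s` as its weight, lower
the targets accordingly, and remove a resource with the smallest ratio. -/
def matchRounds (sel : ArgmaxRule I) (φ : Finset I → I → ℝ) :
    ℕ → Finset I → (I → ℝ) → List (Finset I × ℝ)
  | 0, _, _ => []
  | n + 1, S, p =>
      let γ := fun s => p s / φ S s
      let s₀ := sel.select S (fun s => -γ s)
      (S, γ s₀) :: matchRounds sel φ n (S.erase s₀) (fun s => p s - γ s₀ * φ S s)

/-- Probability matching. -/
def probMatch (sel : ArgmaxRule I) (φ : Finset I → I → ℝ) (S : Finset I) (p : I → ℝ) :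
    List (Finset I × ℝ) :=
  matchRounds sel φ S.card S p

end ChoiceNetwork

namespace ChoiceNetwork

variable {I : Type} [Fintype I] [LinearOrder I] {T : ℕ}

/-- Allocation made by the assortment algorithm: draw an assortment `A` of the fluid-guided
algorithm according to the weights, match the probabilities `φ (A, s) / (1 + δ_s)` on the set of
available resources of `A`, draw an assortment `B` of the resulting collection, and offer it. -/
def alg (N : ChoiceNetwork I T) (orc : N.Oracle) (sel : Fin T → ArgmaxRule I)
    (ω : Sample I T) : Fin T → Option I :=
  playout none
    (fun t X =>
      let S := (N.nbr t).filter (fun i => N.inUse X ω.2.2 t i < N.cap i)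
      (pick (N.galg orc t).menu (ω.1 t).1).bind fun A =>
        (pick (probMatch (sel t) (N.choice t) (A ∩ S)
          (fun s => N.choice t A s / (1 + N.del s))) (ω.1 t).2).bind fun B =>
            N.chosen t B (ω.2.1 t)) T

/-- Expected total reward of the assortment algorithm. -/
def algValue (N : ChoiceNetwork I T) (orc : N.Oracle) (sel : Fin T → ArgmaxRule I) : ℝ :=
  ∫ ω, N.totalReward (N.alg orc sel ω) ω.2.2 ∂N.law

end ChoiceNetwork

end Reusable

end

open Reusable

/-! The guarantee compares three objects: the clairvoyant policy, the fractional GALG and the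
randomized ALG.

From policy to fluid. Let `p t i` be the probability that the policy allocates `i` at `t`. A policy
commits before it sees the duration, so that duration is independent of the commitment. Hence the
value is the sum of `meanRew i * p t i`, and the expected number of units in use obeys the linear
capacity constraint of `OnlineRun.fluid_capacity`. Under customer choice, `p` is in addition a
mixture of feasible assortments.

GALG against fluid (`Network.fluid_bound`). Let K be the highest unit of `i` still available after
arrival `t`. Split r p into the reduced price p r (1 - g(K/c)) and the rest p r g(K/c). GALG is
greedy and prices only fall within an arrival, so its reduced revenue at `t` covers that of `p` at
the final prices. For the rest, g(K/c) - 1/e telescopes over the units k > K, all of them fully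
occupied at `t`. Uses of `p` at times when unit k is fully occupied number at most c times the total
fraction started on unit k. This does not follow from occupancies by direct summation, since
durations are arbitrary; it is a duality statement, carried by the renewal weights of
`exists_renewal_weights`. Adding up, GALG earns at least (1 - 1/e) of the fluid value, up to factors
1 + 1/c.

ALG against GALG. While `i` is available, ALG allocates it with conditional probability `x t i / (1
+ δ)`; with customer choice, probability matching makes this exact for every set of available
resources. Availability depends on the past, so uses are not independent, but conditional
probabilities given the past are bounded, which suffices for exponential moments. The mean number in
use is at most c / (1 + δ), and the Chernoff bound makes unavailability at most 1/c.
`Network.competitive` collects the errors.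

Optimality. The resources are ordered by a random permutation, and arrivals of phase k see only
those of rank at least k. An online algorithm cannot tell these apart, so rank j is served in phase
k with probability at most 1/(m - k) per arrival. Every rank is filled by a clairvoyant policy,
whereas the online fill levels are at most min(1, harmonic sum), of average about 1 - 1/e. Some
permutation is no better than average. -/

namespace Reusable

/-! ### Comparison of fluid solutions -/

/-- A decreasing survival kernel admits nonnegative dual weights on any finite set of times:
they cover each time of the set exactly once and every other time at most once. -/
theorem exists_renewal_weights {T : ℕ} (G : Fin T → Fin T → ℝ)
    (hmono : ∀ τ τ' t, τ ≤ τ' → τ' ≤ t → G τ t ≤ G τ' t) (hdiag : ∀ t, G t t = 1)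
    (S : Finset (Fin T)) :
    ∃ w : Fin T → ℝ, (∀ t, 0 ≤ w t) ∧
      (∀ τ, ∑ t ∈ S, (if τ ≤ t then w t * G τ t else 0) ≤ 1) ∧
      (∀ τ ∈ S, ∑ t ∈ S, (if τ ≤ t then w t * G τ t else 0) = 1) := by
  induction S using Finset.induction_on_min with
  | empty => exact ⟨fun _ => 0, by simp, by simp, by simp⟩
  | insert a s ha ih =>
    obtain ⟨w, hw0, hw1, hw2⟩ := ih
    have has : a ∉ s := fun h => lt_irrefl _ (ha a h)
    set b := 1 - ∑ t ∈ s, (if a ≤ t then w t * G a t else 0) with hb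
    have hb0 : 0 ≤ b := sub_nonneg.2 (hw1 a)
    have hsum : ∀ τ, ∑ t ∈ insert a s, (if τ ≤ t then (Function.update w a b) t * G τ t else 0) =
        (if τ ≤ a then b * G τ a else 0) + ∑ t ∈ s, (if τ ≤ t then w t * G τ t else 0) := by
      intro τ
      rw [Finset.sum_insert has, Function.update_self]
      congr 1
      refine Finset.sum_congr rfl fun t ht => ?_
      rw [Function.update_of_ne (ne_of_mem_of_not_mem ht has)]
    have hgt : ∀ τ, a < τ → ∑ t ∈ insert a s,
        (if τ ≤ t then (Function.update w a b) t * G τ t else 0) =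
        ∑ t ∈ s, (if τ ≤ t then w t * G τ t else 0) := by
      intro τ hτ
      rw [hsum, if_neg (not_le.2 hτ), zero_add]
    refine ⟨Function.update w a b, ?_, ?_, ?_⟩
    · intro t
      by_cases h : t = a
      · subst h; simpa using hb0
      · simpa [Function.update_of_ne h] using hw0 t
    · intro τ
      rcases lt_or_ge a τ with h | h
      · rw [hgt τ h]; exact hw1 τ
      · rw [hsum, if_pos h]
        have h1 : b * G τ a ≤ b := by
          have := hmono τ a a h le_rfl
          rw [hdiag] at this
          nlinarith
        have h2 : ∑ t ∈ s, (if τ ≤ t then w t * G τ t else 0) ≤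
            ∑ t ∈ s, (if a ≤ t then w t * G a t else 0) := by
          refine Finset.sum_le_sum fun t ht => ?_
          have hat := (ha t ht).le
          rw [if_pos hat, if_pos (h.trans hat)]
          exact mul_le_mul_of_nonneg_left (hmono _ _ _ h hat) (hw0 t)
        linarith
    · intro τ hτ
      rcases Finset.mem_insert.1 hτ with h | h
      · subst h
        rw [hsum, if_pos le_rfl, hdiag]
        linarith
      · rw [hgt τ (ha τ h)]; exact hw2 τ h

/-- If the occupancy of `p` is at most that of `y` at all times of `S`, then `y` starts at least
as many uses as `p` starts in `S`. -/
theorem sum_le_of_occupancy_le {T : ℕ} (G : Fin T → Fin T → ℝ) (hG0 : ∀ τ t, 0 ≤ G τ t)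
    (hmono : ∀ τ τ' t, τ ≤ τ' → τ' ≤ t → G τ t ≤ G τ' t) (hdiag : ∀ t, G t t = 1)
    (S : Finset (Fin T)) (p y : Fin T → ℝ) (hp : ∀ t, 0 ≤ p t) (hy : ∀ t, 0 ≤ y t)
    (h : ∀ t ∈ S, ∑ τ, (if τ ≤ t then p τ * G τ t else 0) ≤
      ∑ τ, (if τ ≤ t then y τ * G τ t else 0)) :
    ∑ t ∈ S, p t ≤ ∑ t, y t := by
  obtain ⟨w, hw0, hw1, hw2⟩ := exists_renewal_weights G hmono hdiag S
  have swap : ∀ q : Fin T → ℝ, ∑ τ, q τ * ∑ t ∈ S, (if τ ≤ t then w t * G τ t else 0) =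
      ∑ t ∈ S, w t * ∑ τ, (if τ ≤ t then q τ * G τ t else 0) := by
    intro q
    simp only [Finset.mul_sum]
    rw [Finset.sum_comm]
    refine Finset.sum_congr rfl fun t _ => Finset.sum_congr rfl fun τ _ => ?_
    split_ifs <;> ring
  calc ∑ t ∈ S, p t
      = ∑ τ ∈ S, p τ * ∑ t ∈ S, (if τ ≤ t then w t * G τ t else 0) :=
        Finset.sum_congr rfl fun τ hτ => by rw [hw2 τ hτ, mul_one]
    _ ≤ ∑ τ, p τ * ∑ t ∈ S, (if τ ≤ t then w t * G τ t else 0) := by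
        refine Finset.sum_le_sum_of_subset_of_nonneg (Finset.subset_univ _) fun τ _ _ => ?_
        refine mul_nonneg (hp τ) (Finset.sum_nonneg fun t _ => ?_)
        split_ifs
        · exact mul_nonneg (hw0 t) (hG0 _ _)
        · exact le_rfl
    _ = ∑ t ∈ S, w t * ∑ τ, (if τ ≤ t then p τ * G τ t else 0) := swap p
    _ ≤ ∑ t ∈ S, w t * ∑ τ, (if τ ≤ t then y τ * G τ t else 0) :=
        Finset.sum_le_sum fun t ht => mul_le_mul_of_nonneg_left (h t ht) (hw0 t)
    _ = ∑ τ, y τ * ∑ t ∈ S, (if τ ≤ t then w t * G τ t else 0) := (swap y).symm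
    _ ≤ ∑ t, y t :=
        Finset.sum_le_sum fun τ _ => mul_le_of_le_one_right (hy τ) (hw1 τ)

/-! ### Primal-dual bound for fluid allocations -/

namespace Network

variable {I : Type} {T : ℕ}

theorem meanRew_nonneg (N : Network I T) (i : I) : 0 ≤ N.meanRew i :=
  integral_nonneg fun d => N.rew_nonneg i d

theorem cdf_nonneg (N : Network I T) (i : I) (x : ℝ≥0∞) : 0 ≤ N.cdf i x := measureReal_nonneg

theorem cdf_le_one (N : Network I T) (i : I) (x : ℝ≥0∞) : N.cdf i x ≤ 1 := measureReal_le_one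

theorem cdf_mono (N : Network I T) (i : I) : Monotone (N.cdf i) := fun _ _ h =>
  measureReal_mono (Set.Iic_subset_Iic.2 h)

theorem elapsed_anti (N : Network I T) {τ τ' : Fin T} (h : τ ≤ τ') (t : Fin T) :
    N.elapsed τ' t ≤ N.elapsed τ t :=
  ENNReal.ofReal_le_ofReal (sub_le_sub_left (N.arr_strictMono.monotone h) _)

theorem elapsed_mono (N : Network I T) (τ : Fin T) {t t' : Fin T} (h : t ≤ t') :
    N.elapsed τ t ≤ N.elapsed τ t' :=
  ENNReal.ofReal_le_ofReal (sub_le_sub_right (N.arr_strictMono.monotone h) _)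

theorem price_nonneg (N : Network I T) (i : I) (k : ℕ) : 0 ≤ N.price i k := by
  refine mul_nonneg (N.meanRew_nonneg i) ?_
  rw [sub_nonneg, Real.exp_le_one_iff]
  exact neg_nonpos.2 (by positivity)

theorem price_mono (N : Network I T) (i : I) : Monotone (N.price i) := by
  intro k l h
  refine mul_le_mul_of_nonneg_left ?_ (N.meanRew_nonneg i)
  have : (k : ℝ) / N.cap i ≤ l / N.cap i := by gcongr
  have := Real.exp_le_exp.2 (neg_le_neg this)
  linarith

theorem price_zero (N : Network I T) (i : I) : N.price i 0 = 0 := by simp [price]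

theorem le_topUnit (N : Network I T) {z : I → ℕ → ℝ} {i : I} {k : ℕ}
    (hk : k ∈ Finset.Icc 1 (N.cap i)) (h : 0 < z i k) : k ≤ N.topUnit z i :=
  Finset.le_sup (f := id) (Finset.mem_filter.2 ⟨hk, h⟩)

theorem topUnit_mono (N : Network I T) {z z' : I → ℕ → ℝ} (h : ∀ i k, z i k ≤ z' i k) (i : I) :
    N.topUnit z i ≤ N.topUnit z' i :=
  Finset.sup_mono fun k hk => by
    rw [Finset.mem_filter] at hk ⊢
    exact ⟨hk.1, hk.2.trans_le (h i k)⟩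

/-- Probability that a use of `i` started at `τ` is not over at `t`. -/
noncomputable def surv (N : Network I T) (i : I) (τ t : Fin T) : ℝ :=
  -- The diagonal value is 1 rather than 1 - F(0): a use that starts now occupies its unit even if
  -- the usage distribution has an atom at 0.
  if τ < t then 1 - N.cdf i (N.elapsed τ t) else 1

theorem surv_nonneg (N : Network I T) (i : I) (τ t : Fin T) : 0 ≤ N.surv i τ t := by
  unfold surv
  split_ifs
  · exact sub_nonneg.2 (N.cdf_le_one _ _)
  · exact zero_le_one

theorem surv_mono (N : Network I T) (i : I) (τ τ' t : Fin T) (h : τ ≤ τ') (_ : τ' ≤ t) :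
    N.surv i τ t ≤ N.surv i τ' t := by
  unfold surv
  split_ifs with h1 h2 h2
  · linarith [N.cdf_mono i (N.elapsed_anti h t)]
  · linarith [N.cdf_nonneg i (N.elapsed τ t)]
  · exact absurd (h.trans_lt h2) h1
  · exact le_rfl

theorem surv_self (N : Network I T) (i : I) (t : Fin T) : N.surv i t t = 1 := by simp [surv]

theorem sum_surv (N : Network I T) (i : I) (q : Fin T → ℝ) (t : Fin T) :
    ∑ τ, (if τ ≤ t then q τ * N.surv i τ t else 0) =
      q t + ∑ τ ∈ Finset.univ.filter (fun τ : Fin T => τ < t),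
        q τ * (1 - N.cdf i (N.elapsed τ t)) := by
  rw [Finset.sum_filter, ← Finset.add_sum_erase _ _ (Finset.mem_univ t), if_pos le_rfl, surv_self,
    mul_one, ← Finset.add_sum_erase Finset.univ (fun τ : Fin T => if τ < t then _ else _)
      (Finset.mem_univ t), if_neg (lt_irrefl t), zero_add]
  congr 1
  refine Finset.sum_congr rfl fun τ hτ => ?_
  have hne := (Finset.mem_erase.1 hτ).1
  unfold surv
  by_cases h : τ < t
  · rw [if_pos h, if_pos h.le, if_pos h]
  · rw [if_neg fun h' => h (lt_of_le_of_ne h' hne), if_neg h]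

/-- Telescoping of exp(-k/c). It spreads the difference between g at the highest available unit `m`
and g at `c` over the units above `m`, which are those that are exhausted. -/
theorem exp_sub_exp_eq_sum (c : ℕ) {m : ℕ} (hm : m ≤ c) :
    Real.exp (-((m : ℝ) / c)) - Real.exp (-((c : ℝ) / c)) =
      ∑ k ∈ Finset.Icc 1 c, if m < k then
        (Real.exp (1 / c) - 1) * Real.exp (-((k : ℝ) / c)) else 0 := by
  obtain ⟨d, rfl⟩ := Nat.exists_eq_add_of_le hm
  generalize hC : ((m + d : ℕ) : ℝ) = C
  have key : ∀ e : ℕ, ∑ k ∈ Finset.Icc 1 (m + e), (if m < k then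
        (Real.exp (1 / C) - 1) * Real.exp (-((k : ℝ) / C)) else 0) =
        Real.exp (-((m : ℝ) / C)) - Real.exp (-(((m + e : ℕ) : ℝ) / C)) := by
    intro e
    induction e with
    | zero =>
      rw [Finset.sum_eq_zero]
      · simp
      · intro k hk
        rw [if_neg]
        have := (Finset.mem_Icc.1 hk).2
        omega
    | succ e ih =>
      rw [← Nat.add_assoc, Finset.sum_Icc_succ_top (by omega), ih, if_pos (by omega)]
      have : Real.exp (1 / C) * Real.exp (-(((m + e + 1 : ℕ) : ℝ) / C)) =
          Real.exp (-(((m + e : ℕ) : ℝ) / C)) := by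
        rw [← Real.exp_add]
        congr 1
        push_cast
        ring
      rw [sub_mul, this]
      ring
  rw [key d, hC]

/-- The discretization error: the telescoping weight times the `c` copies of a unit would be exactly
1 for infinitesimal units. -/
theorem cap_mul_exp_sub_one_le (N : Network I T) (i : I) :
    (N.cap i : ℝ) * (Real.exp (1 / (N.cap i : ℝ)) - 1) ≤ 1 + 1 / (N.cap i : ℝ) := by
  have hc : (1 : ℝ) ≤ N.cap i := by exact_mod_cast N.cap_pos i
  have hx0 : (0 : ℝ) ≤ 1 / N.cap i := by positivity
  have hx1 : (1 : ℝ) / N.cap i ≤ 1 := by rw [div_le_one (by linarith)]; exact hc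
  have h := Real.abs_exp_sub_one_sub_id_le (x := 1 / (N.cap i : ℝ)) (by rwa [abs_of_nonneg hx0])
  have h' := (abs_le.1 h).2
  calc (N.cap i : ℝ) * (Real.exp (1 / (N.cap i : ℝ)) - 1)
      ≤ N.cap i * (1 / N.cap i + (1 / (N.cap i : ℝ)) ^ 2) := by gcongr; linarith
    _ = 1 + 1 / (N.cap i : ℝ) := by field_simp

variable [Fintype I]

/-- A fluid allocation `y` whose reduced revenue at each arrival covers that of `p` at the final
prices collects almost a fraction `1 - 1 / e` of the revenue of `p`. -/
theorem fluid_bound (N : Network I T) (y : Fin T → I → ℕ → ℝ) (hy : ∀ t i k, 0 ≤ y t i k)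
    (p : Fin T → I → ℝ) (hp : ∀ t i, 0 ≤ p t i)
    (hcap : ∀ t i, p t i + ∑ τ ∈ Finset.univ.filter (fun τ : Fin T => τ < t),
      p τ i * (1 - N.cdf i (N.elapsed τ t)) ≤ N.cap i)
    (hprice : ∀ t, ∑ i, p t i * N.price i (N.topUnit (remaining (N.fluidAvail y t) (y t)) i) ≤
      ∑ i, ∑ k ∈ Finset.Icc 1 (N.cap i), y t i k * N.price i k) :
    (1 - 1 / Real.exp 1) * ∑ i, N.meanRew i * ∑ t, p t i ≤
      ∑ i, (1 + 1 / (N.cap i : ℝ)) *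
        (N.meanRew i * ∑ t, ∑ k ∈ Finset.Icc 1 (N.cap i), y t i k) := by
  set K := fun t i => N.topUnit (remaining (N.fluidAvail y t) (y t)) i with hK
  set g := fun (i : I) (k : ℕ) => Real.exp (-((k : ℝ) / (N.cap i : ℝ))) with hg
  have hcap0 : ∀ i, (N.cap i : ℝ) ≠ 0 := fun i => by exact_mod_cast (N.cap_pos i).ne'
  have hcap1 : ∀ i, (0 : ℝ) < N.cap i := fun i => by exact_mod_cast N.cap_pos i
  have hKc : ∀ t i, K t i ≤ N.cap i := fun t i =>
    Finset.sup_le fun k hk => (Finset.mem_Icc.1 (Finset.mem_filter.1 hk).1).2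
  -- At times with `K t i < k`, unit `k` is fully occupied, so `c` copies of it carry occupancy at
  -- least `c`, and the occupancy of `p` is at most `c`. The comparison lemma turns this into a
  -- bound on the number of starts.
  have hunit : ∀ i, ∀ k ∈ Finset.Icc 1 (N.cap i),
      ∑ t, (if K t i < k then p t i else 0) ≤ N.cap i * ∑ t, y t i k := by
    intro i k hk
    rw [← Finset.sum_filter, Finset.mul_sum]
    refine sum_le_of_occupancy_le (N.surv i) (N.surv_nonneg i) (N.surv_mono i) (N.surv_self i) _
      (fun t => p t i) (fun t => N.cap i * y t i k) (fun t => hp t i)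
      (fun t => mul_nonneg (hcap1 i).le (hy t i k)) ?_
    intro t ht
    have hlt := (Finset.mem_filter.1 ht).2
    rw [N.sum_surv i (fun t => p t i)]
    refine (hcap t i).trans ?_
    rw [N.sum_surv i]
    have hnp : ¬ 0 < remaining (N.fluidAvail y t) (y t) i k := fun h =>
      absurd (N.le_topUnit hk h) (not_le.2 hlt)
    simp only [remaining, fluidAvail, not_lt] at hnp
    have : ∑ τ ∈ Finset.univ.filter (fun τ : Fin T => τ < t),
        N.cap i * y τ i k * (1 - N.cdf i (N.elapsed τ t)) = N.cap i *
        ∑ τ ∈ Finset.univ.filter (fun τ : Fin T => τ < t),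
          y τ i k * (1 - N.cdf i (N.elapsed τ t)) := by
      rw [Finset.mul_sum]
      exact Finset.sum_congr rfl fun τ _ => by ring
    rw [this, ← mul_add]
    exact le_mul_of_one_le_right (hcap1 i).le (by linarith)
  have hres : ∀ i, ∑ t, p t i * (g i (K t i) - 1 / Real.exp 1) ≤
      (1 + 1 / (N.cap i : ℝ)) * ∑ t, ∑ k ∈ Finset.Icc 1 (N.cap i), y t i k * g i k := by
    intro i
    have hgc : (1 : ℝ) / Real.exp 1 = Real.exp (-((N.cap i : ℝ) / N.cap i)) := by
      rw [div_self (hcap0 i), Real.exp_neg, one_div]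
    calc ∑ t, p t i * (g i (K t i) - 1 / Real.exp 1)
        = ∑ t, ∑ k ∈ Finset.Icc 1 (N.cap i), (Real.exp (1 / (N.cap i : ℝ)) - 1) * g i k *
            (if K t i < k then p t i else 0) := by
          refine Finset.sum_congr rfl fun t _ => ?_
          rw [hgc, exp_sub_exp_eq_sum _ (hKc t i), Finset.mul_sum]
          refine Finset.sum_congr rfl fun k _ => ?_
          split_ifs
          · simp only [hg]; ring
          · ring
      _ = ∑ k ∈ Finset.Icc 1 (N.cap i), (Real.exp (1 / (N.cap i : ℝ)) - 1) * g i k *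
            ∑ t, (if K t i < k then p t i else 0) := by
          rw [Finset.sum_comm]
          exact Finset.sum_congr rfl fun k _ => by rw [Finset.mul_sum]
      _ ≤ ∑ k ∈ Finset.Icc 1 (N.cap i), (Real.exp (1 / (N.cap i : ℝ)) - 1) * g i k *
            (N.cap i * ∑ t, y t i k) := by
          refine Finset.sum_le_sum fun k hk => mul_le_mul_of_nonneg_left (hunit i k hk) ?_
          refine mul_nonneg ?_ (Real.exp_pos _).le
          rw [sub_nonneg, Real.one_le_exp_iff]
          exact (div_pos one_pos (hcap1 i)).le
      _ = (N.cap i * (Real.exp (1 / (N.cap i : ℝ)) - 1)) *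
            ∑ t, ∑ k ∈ Finset.Icc 1 (N.cap i), y t i k * g i k := by
          rw [Finset.sum_comm, Finset.mul_sum]
          refine Finset.sum_congr rfl fun k _ => ?_
          rw [← Finset.sum_mul]
          ring
      _ ≤ _ := by
          refine mul_le_mul_of_nonneg_right (N.cap_mul_exp_sub_one_le i) ?_
          exact Finset.sum_nonneg fun t _ => Finset.sum_nonneg fun k _ =>
            mul_nonneg (hy t i k) (Real.exp_pos _).le
  have hsum := Finset.sum_le_sum fun t (_ : t ∈ Finset.univ) => hprice t
  rw [Finset.sum_comm, Finset.sum_comm (s := Finset.univ) (t := Finset.univ)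
    (f := fun t i => ∑ k ∈ Finset.Icc 1 (N.cap i), y t i k * N.price i k)] at hsum
  have hr := Finset.sum_le_sum fun i (_ : i ∈ Finset.univ) =>
    mul_le_mul_of_nonneg_left (hres i) (N.meanRew_nonneg i)
  have hle : ∀ i, ∑ t, ∑ k ∈ Finset.Icc 1 (N.cap i), y t i k * N.price i k ≤
      (1 + 1 / (N.cap i : ℝ)) *
        ∑ t, ∑ k ∈ Finset.Icc 1 (N.cap i), y t i k * N.price i k := fun i => by
    refine le_mul_of_one_le_left (Finset.sum_nonneg fun t _ => Finset.sum_nonneg fun k _ =>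
      mul_nonneg (hy t i k) (N.price_nonneg i k)) ?_
    have := div_pos one_pos (hcap1 i)
    linarith
  have hle' := Finset.sum_le_sum fun i (_ : i ∈ Finset.univ) => hle i
  -- Each unit of mass earns 1 - 1/e = (1 - g(K)) + (g(K) - 1/e): the reduced price, covered by
  -- `hprice`, and the part bounded by `hres`.
  have e1 : (1 - 1 / Real.exp 1) * ∑ i, N.meanRew i * ∑ t, p t i =
      ∑ i, ∑ t, p t i * N.price i (K t i) +
      ∑ i, N.meanRew i * ∑ t, p t i * (g i (K t i) - 1 / Real.exp 1) := by
    rw [← Finset.sum_add_distrib, Finset.mul_sum]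
    refine Finset.sum_congr rfl fun i _ => ?_
    rw [Finset.mul_sum, Finset.mul_sum, Finset.mul_sum, ← Finset.sum_add_distrib]
    refine Finset.sum_congr rfl fun t _ => ?_
    simp only [price, hg]
    ring
  have e2 : ∑ i, (1 + 1 / (N.cap i : ℝ)) *
        (N.meanRew i * ∑ t, ∑ k ∈ Finset.Icc 1 (N.cap i), y t i k) =
      ∑ i, (1 + 1 / (N.cap i : ℝ)) *
        ∑ t, ∑ k ∈ Finset.Icc 1 (N.cap i), y t i k * N.price i k +
      ∑ i, N.meanRew i * ((1 + 1 / (N.cap i : ℝ)) *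
        ∑ t, ∑ k ∈ Finset.Icc 1 (N.cap i), y t i k * g i k) := by
    rw [← Finset.sum_add_distrib]
    refine Finset.sum_congr rfl fun i _ => ?_
    rw [mul_left_comm (N.meanRew i), ← mul_add]
    congr 1
    rw [Finset.mul_sum, Finset.mul_sum, ← Finset.sum_add_distrib]
    refine Finset.sum_congr rfl fun t _ => ?_
    rw [Finset.mul_sum, Finset.mul_sum, ← Finset.sum_add_distrib]
    refine Finset.sum_congr rfl fun k _ => ?_
    simp only [price, hg]
    ring
  rw [e1, e2]
  linarith

end Network

/-! ### Sequential play -/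

theorem playout_of_lt {T : ℕ} {α : Type} (init : α) (dec : Fin T → (Fin T → α) → α) {n : ℕ}
    {τ : Fin T} (h : τ.val < n) :
    playout init dec n τ = dec τ (playout init dec τ.val) := by
  induction n with
  | zero => exact absurd h (Nat.not_lt_zero _)
  | succ n ih =>
    rw [playout]
    dsimp only
    split_ifs with h'
    · rw [← h']
    · exact ih (by omega)

theorem playout_eq {T : ℕ} {α : Type} (init : α) (dec : Fin T → (Fin T → α) → α) (t : Fin T) :
    playout init dec T t = dec t (playout init dec t.val) :=
  playout_of_lt init dec t.isLt

/-- The partial history seen by a decision is that of the completed run, which lets the recursion be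
read as a fixed-point equation for the whole outcome. -/
theorem playout_past {T : ℕ} {α : Type} (init : α) (dec : Fin T → (Fin T → α) → α) {τ t : Fin T}
    (h : τ < t) : playout init dec t.val τ = playout init dec T τ := by
  rw [playout_eq, playout_of_lt init dec h]

theorem iterate_induction {σ : Type} (f : σ → σ) (P : σ → Prop) (h : ∀ s, P s → P (f s)) (n : ℕ)
    (s : σ) (hs : P s) : P (f^[n] s) := by
  induction n generalizing s with
  | zero => exact hs
  | succ n ih => rw [Function.iterate_succ_apply]; exact ih _ (h _ hs)

/-! ### GALG for matching: loop invariants and the fluid bound -/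

namespace Network

variable {I : Type} {T : ℕ}

theorem fluidAvail_congr (N : Network I T) {y y' : Fin T → I → ℕ → ℝ} {t : Fin T}
    (h : ∀ τ < t, y τ = y' τ) : N.fluidAvail y t = N.fluidAvail y' t := by
  funext i k
  unfold fluidAvail
  congr 1
  refine Finset.sum_congr rfl fun τ hτ => ?_
  rw [h τ (Finset.mem_filter.1 hτ).2]

/-- Available fractions stay nonnegative if at most the available fraction is ever matched. -/
theorem fluidAvail_nonneg (N : Network I T) (y : Fin T → I → ℕ → ℝ) (hy : ∀ t i k, 0 ≤ y t i k)
    (hle : ∀ t i k, y t i k ≤ max (N.fluidAvail y t i k) 0) (t : Fin T) (i : I) (k : ℕ) :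
    0 ≤ N.fluidAvail y t i k := by
  obtain ⟨n, hn⟩ := t
  induction n with
  | zero =>
    have : Finset.univ.filter (fun τ : Fin T => τ < ⟨0, hn⟩) = ∅ :=
      Finset.filter_eq_empty_iff.2 fun τ _ h => absurd h (by simp [Fin.lt_def])
    simp [fluidAvail, this]
  | succ n ih =>
    have hn' : n < T := by omega
    have h0 := ih hn'
    set s : Fin T := ⟨n, hn'⟩
    set t : Fin T := ⟨n + 1, hn⟩
    have hst : s ≤ t := by simp [s, t, Fin.le_def]
    have h1 : y s i k ≤ N.fluidAvail y s i k := by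
      have := hle s i k
      rwa [max_eq_left h0] at this
    have hf : Finset.univ.filter (fun τ : Fin T => τ < t) =
        insert s (Finset.univ.filter (fun τ : Fin T => τ < s)) := by
      ext τ
      simp only [Finset.mem_filter, Finset.mem_univ, true_and, Finset.mem_insert, Fin.lt_def,
        Fin.ext_iff, s, t]
      omega
    -- From one arrival to the next, fractions in use before `s` can only return, so availability
    -- drops by at most what `s` takes.
    have h2 : ∑ τ ∈ Finset.univ.filter (fun τ : Fin T => τ < s),
        y τ i k * (1 - N.cdf i (N.elapsed τ t)) ≤
        ∑ τ ∈ Finset.univ.filter (fun τ : Fin T => τ < s),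
        y τ i k * (1 - N.cdf i (N.elapsed τ s)) :=
      Finset.sum_le_sum fun τ _ => mul_le_mul_of_nonneg_left
        (sub_le_sub_left (N.cdf_mono i (N.elapsed_mono τ hst)) _) (hy τ i k)
    have h3 : y s i k * (1 - N.cdf i (N.elapsed s t)) ≤ y s i k :=
      mul_le_of_le_one_right (hy s i k) (by linarith [N.cdf_nonneg i (N.elapsed s t)])
    unfold fluidAvail at h1 ⊢
    rw [hf, Finset.sum_insert (by simp)]
    linarith

/-- The units in use of a fluid allocation do not exceed the inventory. -/
theorem sum_surv_le_cap (N : Network I T) (y : Fin T → I → ℕ → ℝ) (t : Fin T) (i : I)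
    (h : ∀ k, 0 ≤ N.fluidAvail y t i k) :
    ∑ τ ∈ Finset.univ.filter (fun τ : Fin T => τ < t),
      (∑ k ∈ Finset.Icc 1 (N.cap i), y τ i k) * (1 - N.cdf i (N.elapsed τ t)) ≤ N.cap i := by
  simp only [Finset.sum_mul]
  rw [Finset.sum_comm]
  calc _ ≤ ∑ k ∈ Finset.Icc 1 (N.cap i), (1 : ℝ) :=
        Finset.sum_le_sum fun k _ => by have := h k; unfold fluidAvail at this; linarith
    _ = N.cap i := by simp

/-- Effect of one loop pass on a weighted total: each resource of `A` gains mass on its unit `K i`.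
The matching loop is the case of a singleton `A`; weights 1 give total mass, and prices give reduced
revenue. -/
theorem sum_add_ite_mul [Fintype I] [DecidableEq I] (N : Network I T) (f h : I → ℕ → ℝ)
    (A : Finset I) (K : I → ℕ) (hK : ∀ i ∈ A, K i ∈ Finset.Icc 1 (N.cap i)) (q : I → ℝ) :
    ∑ i, ∑ k ∈ Finset.Icc 1 (N.cap i), (f i k + if i ∈ A ∧ k = K i then q i else 0) * h i k =
      ∑ i, ∑ k ∈ Finset.Icc 1 (N.cap i), f i k * h i k + ∑ i ∈ A, q i * h i (K i) := by
  simp only [add_mul, Finset.sum_add_distrib]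
  congr 1
  rw [← Finset.sum_subset (Finset.subset_univ A)]
  · refine Finset.sum_congr rfl fun i hi => ?_
    rw [Finset.sum_eq_single (K i)]
    · simp [hi]
    · intro k _ hk
      simp [hk]
    · exact fun h => absurd (hK i hi) h
  · intro i _ hi
    simp [hi]

theorem sum_add_ite [DecidableEq I] (N : Network I T) (f : I → ℕ → ℝ) (A : Finset I) (K : I → ℕ)
    (hK : ∀ i ∈ A, K i ∈ Finset.Icc 1 (N.cap i)) (q : I → ℝ) (i : I) :
    ∑ k ∈ Finset.Icc 1 (N.cap i), (f i k + if i ∈ A ∧ k = K i then q i else 0) =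
      ∑ k ∈ Finset.Icc 1 (N.cap i), f i k + if i ∈ A then q i else 0 := by
  rw [Finset.sum_add_distrib]
  congr 1
  by_cases hi : i ∈ A
  · simp only [hi, true_and, if_true]
    rw [Finset.sum_ite_eq' _ (K i), if_pos (hK i hi)]
  · simp [hi]

section Matching

variable [Fintype I] [DecidableEq I]

/-- Invariants of the matching loop. -/
structure LoopInv (N : Network I T) (t : Fin T) (z₀ : I → ℕ → ℝ) (s : LoopState I) : Prop where
  frac_nonneg : ∀ i k, 0 ≤ s.frac i k
  frac_le : ∀ i k, s.frac i k ≤ max (z₀ i k) 0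
  frac_off : ∀ i ∉ N.nbr t, ∀ k, s.frac i k = 0
  eta_le : s.eta ≤ 1
  sum_frac : ∑ i, ∑ k ∈ Finset.Icc 1 (N.cap i), s.frac i k = s.eta
  price_le : ∀ i ∈ N.nbr t, s.eta * N.price i (N.topUnit (remaining z₀ s.frac) i) ≤
    ∑ i, ∑ k ∈ Finset.Icc 1 (N.cap i), s.frac i k * N.price i k

/-- The invariant that matters is `price_le`. The mass `m` of a pass is paid at the largest current
reduced price, and later prices are no larger because available units only disappear. So all mass
placed so far was paid at least the current price of every neighbour. -/
theorem LoopInv.step {N : Network I T} {t : Fin T} {z₀ : I → ℕ → ℝ} {s : LoopState I}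
    (h : N.LoopInv t z₀ s) (sel : ArgmaxRule I) : N.LoopInv t z₀ (N.galgStep sel t z₀ s) := by
  by_cases hg : s.eta < 1 ∧ (N.nbr t).Nonempty ∧ 0 < N.topUnit (remaining z₀ s.frac)
        (sel.select (N.nbr t) (fun i => N.price i (N.topUnit (remaining z₀ s.frac) i)))
  swap
  · simpa only [galgStep, if_neg hg] using h
  simp only [galgStep, if_pos hg]
  set z := remaining z₀ s.frac with hz
  have hmem := sel.select_mem (N.nbr t) (fun i => N.price i (N.topUnit z i)) hg.2.1
  have hsel := sel.le_select (N.nbr t) (fun i => N.price i (N.topUnit z i))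
  set i₀ := sel.select (N.nbr t) (fun i => N.price i (N.topUnit z i))
  obtain ⟨h1, h2⟩ := N.topUnit_spec z i₀ hg.2.2
  set m := min (z i₀ (N.topUnit z i₀)) (1 - s.eta) with hm
  have hm0 : 0 < m := lt_min h2 (by linarith [hg.1])
  have hmz : m ≤ z i₀ (N.topUnit z i₀) := min_le_left _ _
  have hme : m ≤ 1 - s.eta := min_le_right _ _
  have hfr : ∀ i k, (if i = i₀ ∧ k = N.topUnit z i₀ then m else 0) =
      if i ∈ ({i₀} : Finset I) ∧ k = N.topUnit z i then m else 0 := by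
    intro i k
    refine if_congr ?_ rfl rfl
    simp only [Finset.mem_singleton]
    constructor <;> rintro ⟨rfl, rfl⟩ <;> exact ⟨rfl, rfl⟩
  have hK : ∀ i ∈ ({i₀} : Finset I), N.topUnit z i ∈ Finset.Icc 1 (N.cap i) := by
    intro i hi
    rw [Finset.mem_singleton.1 hi]
    exact h1
  refine ⟨?_, ?_, ?_, by simp only; linarith, ?_, ?_⟩
  · intro i k
    have := h.frac_nonneg i k
    simp only
    split_ifs <;> linarith
  · intro i k
    simp only
    split_ifs with hc
    · obtain ⟨rfl, rfl⟩ := hc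
      refine le_max_of_le_left ?_
      have : z i₀ (N.topUnit z i₀) = z₀ i₀ (N.topUnit z i₀) - s.frac i₀ (N.topUnit z i₀) := rfl
      linarith
    · simpa using h.frac_le i k
  · intro i hi k
    simp only
    rw [if_neg (by rintro ⟨rfl, _⟩; exact hi hmem), h.frac_off i hi k, add_zero]
  · have := N.sum_add_ite_mul s.frac (fun _ _ => 1) {i₀} (fun i => N.topUnit z i) hK (fun _ => m)
    simp only [mul_one, Finset.sum_singleton] at this
    simp only [hfr]
    rw [this, h.sum_frac]
  · intro i hi
    simp only [hfr]
    rw [N.sum_add_ite_mul s.frac (fun i k => N.price i k) {i₀} (fun i => N.topUnit z i) hK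
      (fun _ => m), Finset.sum_singleton, add_mul]
    have hmono : N.price i (N.topUnit (remaining z₀ fun i k => s.frac i k +
        if i ∈ ({i₀} : Finset I) ∧ k = N.topUnit z i then m else 0) i) ≤
        N.price i (N.topUnit z i) := by
      refine N.price_mono i (N.topUnit_mono (fun i k => ?_) i)
      simp only [hz, remaining]
      split_ifs <;> linarith
    have he0 : 0 ≤ s.eta := h.sum_frac ▸ Finset.sum_nonneg fun i _ =>
      Finset.sum_nonneg fun k _ => h.frac_nonneg i k
    exact add_le_add ((mul_le_mul_of_nonneg_left hmono he0).trans (h.price_le i hi))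
      (mul_le_mul_of_nonneg_left (hmono.trans (hsel i hi)) hm0.le)

theorem loopInv_galgLoop (N : Network I T) (sel : ArgmaxRule I) (t : Fin T) (z₀ : I → ℕ → ℝ) :
    N.LoopInv t z₀ (N.galgLoop sel t z₀) :=
  iterate_induction _ (N.LoopInv t z₀) (fun _ h => h.step sel) _ _
    ⟨by simp, by simp, by simp, by simp, by simp, by simp⟩

/-- After the loop, the reduced revenue collected covers every reduced price. -/
theorem price_le_galgLoop (N : Network I T) (sel : ArgmaxRule I) (t : Fin T) (z₀ : I → ℕ → ℝ)
    (i : I) (hi : i ∈ N.nbr t) :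
    N.price i (N.topUnit (remaining z₀ (N.galgLoop sel t z₀).frac) i) ≤
      ∑ i, ∑ k ∈ Finset.Icc 1 (N.cap i), (N.galgLoop sel t z₀).frac i k * N.price i k := by
  have hfix := N.galgStep_galgLoop sel t z₀
  have hinv := N.loopInv_galgLoop sel t z₀
  set s := N.galgLoop sel t z₀
  have hng : ¬ (s.eta < 1 ∧ (N.nbr t).Nonempty ∧ 0 < N.topUnit (remaining z₀ s.frac)
      (sel.select (N.nbr t) (fun i => N.price i (N.topUnit (remaining z₀ s.frac) i)))) := by
    intro hg
    have := congrArg LoopState.eta hfix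
    simp only [galgStep, if_pos hg] at this
    have h2 := (N.topUnit_spec _ _ hg.2.2).2
    have := lt_min h2 (sub_pos.2 hg.1)
    linarith
  -- The loop ends either because the maximal reduced price belongs to an exhausted resource, so
  -- that all reduced prices are at most 0, or with `eta = 1`, where the invariant is the claim.
  by_cases he : s.eta < 1
  · have hk : N.topUnit (remaining z₀ s.frac)
        (sel.select (N.nbr t) (fun i => N.price i (N.topUnit (remaining z₀ s.frac) i))) = 0 := by
      by_contra hk
      exact hng ⟨he, ⟨i, hi⟩, Nat.pos_of_ne_zero hk⟩
    have := sel.le_select (N.nbr t) (fun i => N.price i (N.topUnit (remaining z₀ s.frac) i)) i hi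
    simp only [hk, price_zero] at this
    refine this.trans (Finset.sum_nonneg fun i _ => Finset.sum_nonneg fun k _ =>
      mul_nonneg (hinv.frac_nonneg i k) (N.price_nonneg i k))
  · have := hinv.price_le i hi
    rwa [le_antisymm hinv.eta_le (not_lt.1 he), one_mul] at this

theorem galg_eq (N : Network I T) (sel : Fin T → ArgmaxRule I) (t : Fin T) :
    N.galg sel t = (N.galgLoop (sel t) t (N.fluidAvail (N.galg sel) t)).frac := by
  unfold galg
  rw [playout_eq]
  congr 2
  exact N.fluidAvail_congr fun τ hτ => playout_past _ _ hτ

theorem galg_nonneg (N : Network I T) (sel : Fin T → ArgmaxRule I) (t : Fin T) (i : I) (k : ℕ) :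
    0 ≤ N.galg sel t i k := by
  rw [galg_eq]
  exact (N.loopInv_galgLoop (sel t) t _).frac_nonneg i k

theorem fluidAvail_galg_nonneg (N : Network I T) (sel : Fin T → ArgmaxRule I) (t : Fin T) (i : I)
    (k : ℕ) : 0 ≤ N.fluidAvail (N.galg sel) t i k := by
  refine N.fluidAvail_nonneg _ (N.galg_nonneg sel) (fun t i k => ?_) t i k
  conv_lhs => rw [galg_eq]
  exact (N.loopInv_galgLoop (sel t) t _).frac_le i k

theorem galgX_nonneg (N : Network I T) (sel : Fin T → ArgmaxRule I) (t : Fin T) (i : I) :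
    0 ≤ N.galgX sel t i := Finset.sum_nonneg fun k _ => N.galg_nonneg sel t i k

theorem galgX_off (N : Network I T) (sel : Fin T → ArgmaxRule I) (t : Fin T) (i : I)
    (hi : i ∉ N.nbr t) : N.galgX sel t i = 0 := by
  refine Finset.sum_eq_zero fun k _ => ?_
  rw [galg_eq]
  exact (N.loopInv_galgLoop (sel t) t _).frac_off i hi k

theorem sum_galgX_le (N : Network I T) (sel : Fin T → ArgmaxRule I) (t : Fin T) :
    ∑ i, N.galgX sel t i ≤ 1 := by
  unfold galgX
  rw [galg_eq, (N.loopInv_galgLoop (sel t) t _).sum_frac]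
  exact (N.loopInv_galgLoop (sel t) t _).eta_le

/-- The fluid-guided algorithm against any fluid solution. -/
theorem galg_bound (N : Network I T) (sel : Fin T → ArgmaxRule I)
    (p : Fin T → I → ℝ) (hp : ∀ t i, 0 ≤ p t i) (hoff : ∀ t, ∀ i ∉ N.nbr t, p t i = 0)
    (hone : ∀ t, ∑ i, p t i ≤ 1)
    (hcap : ∀ t i, p t i + ∑ τ ∈ Finset.univ.filter (fun τ : Fin T => τ < t),
      p τ i * (1 - N.cdf i (N.elapsed τ t)) ≤ N.cap i) :
    (1 - 1 / Real.exp 1) * ∑ i, N.meanRew i * ∑ t, p t i ≤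
      ∑ i, (1 + 1 / (N.cap i : ℝ)) * (N.meanRew i * ∑ t, N.galgX sel t i) := by
  refine N.fluid_bound (N.galg sel) (N.galg_nonneg sel) p hp hcap fun t => ?_
  set W := ∑ i, ∑ k ∈ Finset.Icc 1 (N.cap i), N.galg sel t i k * N.price i k with hW
  have hW0 : 0 ≤ W := Finset.sum_nonneg fun i _ => Finset.sum_nonneg fun k _ =>
      mul_nonneg (N.galg_nonneg sel t i k) (N.price_nonneg i k)
  calc _ ≤ ∑ i, p t i * W := by
        refine Finset.sum_le_sum fun i _ => ?_
        by_cases hi : i ∈ N.nbr t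
        · refine mul_le_mul_of_nonneg_left ?_ (hp t i)
          have := N.price_le_galgLoop (sel t) t (N.fluidAvail (N.galg sel) t) i hi
          rwa [← galg_eq] at this
        · simp [hoff t i hi]
    _ = (∑ i, p t i) * W := by rw [Finset.sum_mul]
    _ ≤ W := mul_le_of_le_one_left hW0 (hone t)

end Matching

end Network

/-! ### GALG for assortments: loop invariants and the fluid bound -/

namespace ChoiceNetwork

variable {I : Type} [Fintype I] {T : ℕ}

section Assortments

/-- Expected reduced revenue of an assortment. -/
noncomputable def revenue (N : ChoiceNetwork I T) (t : Fin T) (B : Finset I) (q : I → ℝ) : ℝ :=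
  ∑ i ∈ B, N.choice t B i * q i

theorem revenue_mono (N : ChoiceNetwork I T) (t : Fin T) (B : Finset I) {q q' : I → ℝ}
    (h : ∀ i, q i ≤ q' i) : N.revenue t B q ≤ N.revenue t B q' :=
  Finset.sum_le_sum fun i _ => mul_le_mul_of_nonneg_left (h i) (N.choice_nonneg t B i)

/-- Dropping resources of price zero does not lower the revenue of an assortment. -/
theorem revenue_le_of_price_zero (N : ChoiceNetwork I T) (t : Fin T) {B C : Finset I} {q : I → ℝ}
    (hCB : C ⊆ B) (hq : ∀ i, 0 ≤ q i) (h0 : ∀ i ∈ B, i ∉ C → q i = 0) :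
    N.revenue t B q ≤ N.revenue t C q := by
  unfold revenue
  rw [← Finset.sum_subset hCB fun i hi hC => by rw [h0 i hi hC, mul_zero]]
  exact Finset.sum_le_sum fun i hi =>
    mul_le_mul_of_nonneg_right (N.choice_subst t C B i hCB hi) (hq i)

variable [DecidableEq I]

/-- Invariants of the loop of the fluid-guided algorithm for assortments. -/
structure LoopInv (N : ChoiceNetwork I T) (t : Fin T) (z₀ : I → ℕ → ℝ) (s : LoopState I) :
    Prop where
  frac_nonneg : ∀ i k, 0 ≤ s.frac i k
  frac_le : ∀ i k, s.frac i k ≤ max (z₀ i k) 0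
  eta_nonneg : 0 ≤ s.eta
  eta_le : s.eta ≤ 1
  sum_menu : (s.menu.map Prod.snd).sum = s.eta
  menu_nonneg : ∀ q ∈ s.menu, 0 ≤ q.2
  menu_subset : ∀ q ∈ s.menu, q.1 ⊆ N.nbr t
  menu_pos : ∀ q ∈ s.menu, ∀ i ∈ q.1, 0 < N.choice t q.1 i
  sum_frac : ∀ i, ∑ k ∈ Finset.Icc 1 (N.cap i), s.frac i k =
    (s.menu.map fun q => q.2 * N.choice t q.1 i).sum
  revenue_le : ∀ B ∈ N.feas, B ⊆ N.nbr t →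
    s.eta * N.revenue t B (fun i => N.price i (N.topUnit (Network.remaining z₀ s.frac) i)) ≤
      ∑ i, ∑ k ∈ Finset.Icc 1 (N.cap i), s.frac i k * N.price i k

theorem LoopInv.step {N : ChoiceNetwork I T} {t : Fin T} {z₀ : I → ℕ → ℝ} {s : LoopState I}
    (h : N.LoopInv t z₀ s) (orc : N.Oracle) : N.LoopInv t z₀ (N.galgStep orc t z₀ s) := by
  by_cases hg : s.eta < 1 ∧ ((N.nbr t).filter
        (fun i => 0 < N.topUnit (Network.remaining z₀ s.frac) i)).Nonempty
  swap
  · simpa only [galgStep, if_neg hg] using h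
  simp only [galgStep, if_pos hg]
  set z := Network.remaining z₀ s.frac with hz
  set S := (N.nbr t).filter (fun i => 0 < N.topUnit z i) with hS
  have hp : ∀ i, 0 ≤ N.price i (N.topUnit z i) := fun i => N.price_nonneg _ _
  have hsub := orc.best_subset t (fun i => N.price i (N.topUnit z i)) S hp
  have hpos := orc.best_pos t (fun i => N.price i (N.topUnit z i)) S hp
  have hmax := orc.best_max t (fun i => N.price i (N.topUnit z i)) S hp
  set A := orc.best t (fun i => N.price i (N.topUnit z i)) S
  have hK : ∀ i ∈ A, N.topUnit z i ∈ Finset.Icc 1 (N.cap i) := fun i hi =>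
    (N.topUnit_spec z i (Finset.mem_filter.1 (hsub hi)).2).1
  have hzK : ∀ i ∈ A, 0 < z i (N.topUnit z i) := fun i hi =>
    (N.topUnit_spec z i (Finset.mem_filter.1 (hsub hi)).2).2
  set m := A.fold min (1 - s.eta) (fun i => z i (N.topUnit z i) / N.choice t A i) with hm
  have hm0 : 0 < m := by
    rw [hm, Finset.lt_fold_min]
    exact ⟨by linarith [hg.1], fun i hi => div_pos (hzK i hi) (hpos i hi)⟩
  obtain ⟨hme, hmz⟩ := (Finset.le_fold_min (s := A) (b := 1 - s.eta)
    (f := fun i => z i (N.topUnit z i) / N.choice t A i) m).1 le_rfl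
  refine ⟨?_, ?_, ?_, ?_, ?_, ?_, ?_, ?_, ?_, ?_⟩
  · intro i k
    have := h.frac_nonneg i k
    have := mul_nonneg hm0.le (N.choice_nonneg t A i)
    simp only
    split_ifs <;> linarith
  · intro i k
    simp only
    split_ifs with hc
    · obtain ⟨hi, rfl⟩ := hc
      refine le_max_of_le_left ?_
      have h1 := hmz i hi
      rw [le_div_iff₀ (hpos i hi)] at h1
      have : z i (N.topUnit z i) = z₀ i (N.topUnit z i) - s.frac i (N.topUnit z i) := rfl
      linarith
    · simpa using h.frac_le i k
  · simp only
    linarith [h.eta_nonneg]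
  · simp only
    linarith
  · simp [h.sum_menu]
  · intro q hq
    rcases List.mem_append.1 hq with hq | hq
    · exact h.menu_nonneg q hq
    · rw [List.mem_singleton.1 hq]
      exact hm0.le
  · intro q hq
    rcases List.mem_append.1 hq with hq | hq
    · exact h.menu_subset q hq
    · rw [List.mem_singleton.1 hq]
      exact hsub.trans (Finset.filter_subset _ _)
  · intro q hq
    rcases List.mem_append.1 hq with hq | hq
    · exact h.menu_pos q hq
    · rw [List.mem_singleton.1 hq]
      exact hpos
  · intro i
    simp only
    rw [N.toNetwork.sum_add_ite s.frac A (fun i => N.topUnit z i) hK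
      (fun i => m * N.choice t A i), h.sum_frac]
    by_cases hi : i ∈ A
    · simp [hi]
    · simp [hi, N.choice_off t A i hi]
  · intro B hB hBn
    simp only
    rw [N.toNetwork.sum_add_ite_mul s.frac (fun i k => N.price i k) A (fun i => N.topUnit z i) hK
      (fun i => m * N.choice t A i), add_mul]
    have hmono : ∀ i, N.price i (N.topUnit (Network.remaining z₀ fun i k => s.frac i k +
        if i ∈ A ∧ k = N.topUnit z i then m * N.choice t A i else 0) i) ≤
        N.price i (N.topUnit z i) := by
      intro i
      refine N.price_mono i (N.topUnit_mono (fun i k => ?_) i)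
      have := mul_nonneg hm0.le (N.choice_nonneg t A i)
      simp only [hz, Network.remaining]
      split_ifs <;> linarith
    refine add_le_add ((mul_le_mul_of_nonneg_left (N.revenue_mono t B hmono) h.eta_nonneg).trans
      (h.revenue_le B hB hBn)) ?_
    simp only [mul_assoc]
    rw [← Finset.mul_sum]
    refine mul_le_mul_of_nonneg_left ((N.revenue_mono t B hmono).trans ?_) hm0.le
    -- The oracle competes only with assortments inside `S`. Exhausted resources have price 0, so
    -- deleting them from `B` loses nothing, keeps `B` feasible, and by substitutability does not
    -- lower the other choice probabilities.
    have hC : B.filter (fun i => i ∈ S) ⊆ B := Finset.filter_subset _ _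
    refine (N.revenue_le_of_price_zero t hC hp fun i hi hiC => ?_).trans
      (hmax _ (N.feas_down B hB _ hC) fun i hi => (Finset.mem_filter.1 hi).2)
    have : N.topUnit z i = 0 := by
      by_contra h0
      exact hiC (Finset.mem_filter.2 ⟨hi, Finset.mem_filter.2 ⟨hBn hi, Nat.pos_of_ne_zero h0⟩⟩)
    rw [this, N.price_zero]

theorem loopInv_galgLoop (N : ChoiceNetwork I T) (orc : N.Oracle) (t : Fin T) (z₀ : I → ℕ → ℝ) :
    N.LoopInv t z₀ (N.galgLoop orc t z₀) :=
  iterate_induction _ (N.LoopInv t z₀) (fun _ h => h.step orc) _ _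
    ⟨by simp, by simp, by simp, by simp, by simp, by simp, by simp, by simp, by simp, by simp⟩

/-- After the loop, the reduced revenue collected covers that of every feasible assortment. -/
theorem revenue_le_galgLoop (N : ChoiceNetwork I T) (orc : N.Oracle) (t : Fin T)
    (z₀ : I → ℕ → ℝ) (B : Finset I) (hB : B ∈ N.feas) (hBn : B ⊆ N.nbr t) :
    N.revenue t B (fun i =>
      N.price i (N.topUnit (Network.remaining z₀ (N.galgLoop orc t z₀).frac) i)) ≤
      ∑ i, ∑ k ∈ Finset.Icc 1 (N.cap i), (N.galgLoop orc t z₀).frac i k * N.price i k := by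
  have hfix := N.galgStep_galgLoop orc t z₀
  have hinv := N.loopInv_galgLoop orc t z₀
  set s := N.galgLoop orc t z₀
  have hng : ¬ (s.eta < 1 ∧ ((N.nbr t).filter
        (fun i => 0 < N.topUnit (Network.remaining z₀ s.frac) i)).Nonempty) := by
    intro hg
    -- A pass that is carried out lengthens the menu, so at the fixed point the guard of the loop
    -- fails.
    have := congrArg (fun s => s.menu.length) hfix
    simp [galgStep, if_pos hg] at this
  by_cases he : s.eta < 1
  · have hk : ∀ i ∈ N.nbr t, N.topUnit (Network.remaining z₀ s.frac) i = 0 := by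
      intro i hi
      by_contra hk
      exact hng ⟨he, i, Finset.mem_filter.2 ⟨hi, Nat.pos_of_ne_zero hk⟩⟩
    have : N.revenue t B (fun i => N.price i (N.topUnit (Network.remaining z₀ s.frac) i)) = 0 :=
      Finset.sum_eq_zero fun i hi => by
        simp only [hk i (hBn hi), Network.price_zero, mul_zero]
    rw [this]
    exact Finset.sum_nonneg fun i _ => Finset.sum_nonneg fun k _ =>
      mul_nonneg (hinv.frac_nonneg i k) (N.price_nonneg i k)
  · have := hinv.revenue_le B hB hBn
    rwa [le_antisymm hinv.eta_le (not_lt.1 he), one_mul] at this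

/-- Fractions matched by the fluid-guided algorithm. -/
noncomputable def galgFrac (N : ChoiceNetwork I T) (orc : N.Oracle) (t : Fin T) (i : I) (k : ℕ) :
    ℝ := (N.galg orc t).frac i k

/-- Total fraction of an arrival matched to a resource by the fluid-guided algorithm. -/
noncomputable def galgX (N : ChoiceNetwork I T) (orc : N.Oracle) (t : Fin T) (i : I) : ℝ :=
  ∑ k ∈ Finset.Icc 1 (N.cap i), N.galgFrac orc t i k

theorem galg_eq (N : ChoiceNetwork I T) (orc : N.Oracle) (t : Fin T) :
    N.galg orc t = N.galgLoop orc t (N.fluidAvail (N.galgFrac orc) t) := by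
  unfold galg
  rw [playout_eq]
  congr 1
  refine N.fluidAvail_congr fun τ hτ => ?_
  rw [playout_past _ _ hτ]
  rfl

theorem loopInv_galg (N : ChoiceNetwork I T) (orc : N.Oracle) (t : Fin T) :
    N.LoopInv t (N.fluidAvail (N.galgFrac orc) t) (N.galg orc t) := by
  rw [galg_eq]
  exact N.loopInv_galgLoop orc t _

theorem galgFrac_nonneg (N : ChoiceNetwork I T) (orc : N.Oracle) (t : Fin T) (i : I) (k : ℕ) :
    0 ≤ N.galgFrac orc t i k := (N.loopInv_galg orc t).frac_nonneg i k

theorem fluidAvail_galgFrac_nonneg (N : ChoiceNetwork I T) (orc : N.Oracle) (t : Fin T) (i : I)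
    (k : ℕ) : 0 ≤ N.fluidAvail (N.galgFrac orc) t i k :=
  N.fluidAvail_nonneg _ (N.galgFrac_nonneg orc) (fun t => (N.loopInv_galg orc t).frac_le) t i k

theorem galgX_nonneg (N : ChoiceNetwork I T) (orc : N.Oracle) (t : Fin T) (i : I) :
    0 ≤ N.galgX orc t i := Finset.sum_nonneg fun k _ => N.galgFrac_nonneg orc t i k

/-- The fluid-guided algorithm for assortments against any fluid solution given by random
feasible assortments with probabilities `w t B`. -/
theorem galg_bound (N : ChoiceNetwork I T) (orc : N.Oracle)
    (p : Fin T → I → ℝ) (hp : ∀ t i, 0 ≤ p t i)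
    (w : Fin T → Finset I → ℝ) (hw : ∀ t B, 0 ≤ w t B) (hw1 : ∀ t, ∑ B, w t B ≤ 1)
    (hwf : ∀ t B, w t B ≠ 0 → B ∈ N.feas ∧ B ⊆ N.nbr t)
    (hpw : ∀ t i, p t i = ∑ B, w t B * N.choice t B i)
    (hcap : ∀ t i, p t i + ∑ τ ∈ Finset.univ.filter (fun τ : Fin T => τ < t),
      p τ i * (1 - N.cdf i (N.elapsed τ t)) ≤ N.cap i) :
    (1 - 1 / Real.exp 1) * ∑ i, N.meanRew i * ∑ t, p t i ≤
      ∑ i, (1 + 1 / (N.cap i : ℝ)) * (N.meanRew i * ∑ t, N.galgX orc t i) := by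
  refine N.fluid_bound (N.galgFrac orc) (N.galgFrac_nonneg orc) p hp hcap fun t => ?_
  set W := ∑ i, ∑ k ∈ Finset.Icc 1 (N.cap i), N.galgFrac orc t i k * N.price i k with hW
  have hW0 : 0 ≤ W := Finset.sum_nonneg fun i _ => Finset.sum_nonneg fun k _ =>
      mul_nonneg (N.galgFrac_nonneg orc t i k) (N.price_nonneg i k)
  set q := fun i => N.price i (N.topUnit (Network.remaining (N.fluidAvail (N.galgFrac orc) t)
    (N.galgFrac orc t)) i) with hq
  calc ∑ i, p t i * q i = ∑ B, w t B * N.revenue t B q := by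
        simp only [hpw, Finset.sum_mul, revenue, Finset.mul_sum]
        rw [Finset.sum_comm]
        refine Finset.sum_congr rfl fun B _ => ?_
        rw [← Finset.sum_subset (Finset.subset_univ B)]
        · exact Finset.sum_congr rfl fun i _ => by ring
        · intro i _ hi
          rw [N.choice_off t B i hi]
          ring
    _ ≤ ∑ B, w t B * W := by
        refine Finset.sum_le_sum fun B _ => ?_
        by_cases hB : w t B = 0
        · simp [hB]
        · refine mul_le_mul_of_nonneg_left ?_ (hw t B)
          have := N.revenue_le_galgLoop orc t (N.fluidAvail (N.galgFrac orc) t) B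
            (hwf t B hB).1 (hwf t B hB).2
          rwa [← galg_eq] at this
    _ = (∑ B, w t B) * W := by rw [Finset.sum_mul]
    _ ≤ W := mul_le_of_le_one_left hW0 (hw1 t)

end Assortments

end ChoiceNetwork

/-! ### Resampling one coordinate -/

/-- Independence is used in this form throughout: a fresh copy of one coordinate of a product leaves
the law unchanged, so conditioning on the other coordinates becomes an inner integral over the copy.
-/
theorem measurePreserving_update {ι α : Type} [Fintype ι] [DecidableEq ι] [MeasurableSpace α]
    (μ : ι → Measure α) [∀ i, IsProbabilityMeasure (μ i)] (t : ι) :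
    MeasurePreserving (fun q : (ι → α) × α => Function.update q.1 t q.2)
      ((Measure.pi μ).prod (μ t)) (Measure.pi μ) := by
  have hm : Measurable (fun q : (ι → α) × α => Function.update q.1 t q.2) := measurable_update'
  refine ⟨hm, (Measure.pi_eq fun s hs => ?_).symm⟩
  rw [Measure.map_apply hm (MeasurableSet.univ_pi hs)]
  have : (fun q : (ι → α) × α => Function.update q.1 t q.2) ⁻¹' Set.univ.pi s =
      (Set.univ.pi (Function.update s t Set.univ)) ×ˢ s t := by
    ext q
    simp only [Set.mem_preimage, Set.mem_univ_pi, Set.mem_prod]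
    constructor
    · intro h
      refine ⟨fun i => ?_, by simpa using h t⟩
      by_cases hi : i = t
      · subst hi; simp
      · simpa [Function.update_of_ne hi] using h i
    · rintro ⟨h, h'⟩ i
      by_cases hi : i = t
      · subst hi; simpa using h'
      · simpa [Function.update_of_ne hi] using h i
  rw [this, Measure.prod_prod, Measure.pi_pi, ← Finset.mul_prod_erase _ _ (Finset.mem_univ t),
    ← Finset.mul_prod_erase Finset.univ (fun i => μ i (s i)) (Finset.mem_univ t),
    Function.update_self, measure_univ, one_mul, mul_comm]
  congr 1
  refine Finset.prod_congr rfl fun i hi => ?_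
  rw [Function.update_of_ne (Finset.ne_of_mem_erase hi)]

theorem measurePreserving_prod_comm {α β γ δ : Type} [MeasurableSpace α] [MeasurableSpace β]
    [MeasurableSpace γ] [MeasurableSpace δ] (a : Measure α) (b : Measure β) (c : Measure γ)
    (d : Measure δ) [IsProbabilityMeasure a] [IsProbabilityMeasure b] [IsProbabilityMeasure c]
    [IsProbabilityMeasure d] :
    MeasurePreserving (fun q : (α × β) × (γ × δ) => ((q.1.1, q.2.1), (q.1.2, q.2.2)))
      ((a.prod b).prod (c.prod d)) ((a.prod c).prod (b.prod d)) := by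
  have hm : Measurable (fun q : (α × β) × (γ × δ) => ((q.1.1, q.2.1), (q.1.2, q.2.2))) := by
    fun_prop
  refine ⟨hm, Measure.ext_of_lintegral _ fun f hf => ?_⟩
  rw [lintegral_map hf hm, lintegral_prod _ (by fun_prop),
    lintegral_prod _ hf.aemeasurable, lintegral_prod _ (by fun_prop),
    lintegral_prod _ (by fun_prop)]
  refine lintegral_congr fun x => ?_
  have h1 : ∀ y : β, ∫⁻ z, f ((x, z.1), (y, z.2)) ∂(c.prod d) =
      ∫⁻ u, ∫⁻ v, f ((x, u), (y, v)) ∂d ∂c := fun y => lintegral_prod _ (by fun_prop)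
  have h2 : ∀ u : γ, ∫⁻ z, f ((x, u), z) ∂(b.prod d) =
      ∫⁻ y, ∫⁻ v, f ((x, u), (y, v)) ∂d ∂b := fun u => lintegral_prod _ (by fun_prop)
  simp only [h1, h2]
  exact lintegral_lintegral_swap (by fun_prop)

/-- Combines resampling of separate sources of randomness (internal numbers, customer choices,
durations). A source that must be kept is resampled by the first projection. -/
theorem measurePreserving_resample_prod {α β γ δ : Type} [MeasurableSpace α] [MeasurableSpace β]
    [MeasurableSpace γ] [MeasurableSpace δ] {a : Measure α} {b : Measure β} {c : Measure γ}
    {d : Measure δ} [IsProbabilityMeasure a] [IsProbabilityMeasure b] [IsProbabilityMeasure c]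
    [IsProbabilityMeasure d] {f : α × γ → α} {g : β × δ → β}
    (hf : MeasurePreserving f (a.prod c) a) (hg : MeasurePreserving g (b.prod d) b) :
    MeasurePreserving (fun q : (α × β) × (γ × δ) => (f (q.1.1, q.2.1), g (q.1.2, q.2.2)))
      ((a.prod b).prod (c.prod d)) (a.prod b) :=
  (hf.prod hg).comp (measurePreserving_prod_comm a b c d)

/-! ### Allocation processes: rewards, capacity and tails -/

namespace Network

variable {I : Type} {T : ℕ}

theorem usage_Ioi (N : Network I T) (i : I) (x : ℝ≥0∞) :
    (N.usage i).real (Set.Ioi x) = 1 - N.cdf i x := by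
  rw [← Set.compl_Iic, measureReal_compl measurableSet_Iic, probReal_univ]
  rfl

/-- An allocation process on a probability space: resampling what is random at arrival `t` does
not affect the past, and given everything else, arrival `t` is allocated to `i` with probability
`κ t i`, independently of the duration of this use. -/
structure OnlineRun (N : Network I T) {Ω Ω₀ : Type} [MeasurableSpace Ω] [MeasurableSpace Ω₀]
    (P : Measure Ω) (ν : Measure Ω₀) (R : Fin T → Ω × Ω₀ → Ω) (dur : Ω → Fin T → I → ℝ≥0∞)
    (X : Fin T → Ω → Option I) (κ : Fin T → I → Ω → ℝ≥0∞) : Prop where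
  resample : ∀ t, MeasurePreserving (R t) (P.prod ν) P
  measurable_dur : ∀ t i, Measurable fun ω => dur ω t i
  measurableSet_alloc : ∀ t i, MeasurableSet {ω | X t ω = some i}
  measurable_cond : ∀ t i, Measurable (κ t i)
  alloc_past : ∀ t τ, τ < t → ∀ ω v, X τ (R t (ω, v)) = X τ ω
  dur_past : ∀ t τ, τ < t → ∀ ω v, dur (R t (ω, v)) τ = dur ω τ
  cond : ∀ t i ω B, MeasurableSet B →
    ν {v | X t (R t (ω, v)) = some i ∧ dur (R t (ω, v)) t i ∈ B} = κ t i ω * N.usage i B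

namespace OnlineRun

variable {N : Network I T} {Ω Ω₀ : Type} [MeasurableSpace Ω] [MeasurableSpace Ω₀]
  {P : Measure Ω} {ν : Measure Ω₀}
  {R : Fin T → Ω × Ω₀ → Ω} {dur : Ω → Fin T → I → ℝ≥0∞}
  {X : Fin T → Ω → Option I} {κ : Fin T → I → Ω → ℝ≥0∞}

theorem measurableSet_alloc_dur (h : N.OnlineRun P ν R dur X κ) (t : Fin T) (i : I)
    {B : Set ℝ≥0∞} (hB : MeasurableSet B) : MeasurableSet {ω | X t ω = some i ∧ dur ω t i ∈ B} :=
  (h.measurableSet_alloc t i).inter (h.measurable_dur t i hB)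

variable [IsProbabilityMeasure ν]

/-- Resample at `t` and integrate the fresh copy first: `cond` factors its measure, and the duration
factor does not depend on `ω`. -/
theorem measure_alloc_dur (h : N.OnlineRun P ν R dur X κ) (t : Fin T) (i : I) {B : Set ℝ≥0∞}
    (hB : MeasurableSet B) :
    P {ω | X t ω = some i ∧ dur ω t i ∈ B} = (∫⁻ ω, κ t i ω ∂P) * N.usage i B := by
  have hm := h.measurableSet_alloc_dur t i hB
  rw [← (h.resample t).measure_preimage hm.nullMeasurableSet,
    Measure.prod_apply ((h.resample t).measurable hm),
    ← lintegral_mul_const _ (h.measurable_cond t i)]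
  exact lintegral_congr fun ω => h.cond t i ω B hB

theorem measure_alloc (h : N.OnlineRun P ν R dur X κ) (t : Fin T) (i : I) :
    P {ω | X t ω = some i} = ∫⁻ ω, κ t i ω ∂P := by
  simpa using h.measure_alloc_dur t i MeasurableSet.univ

theorem measure_alloc_dur' (h : N.OnlineRun P ν R dur X κ) (t : Fin T) (i : I) {B : Set ℝ≥0∞}
    (hB : MeasurableSet B) :
    P {ω | X t ω = some i ∧ dur ω t i ∈ B} = P {ω | X t ω = some i} * N.usage i B := by
  rw [h.measure_alloc_dur t i hB, h.measure_alloc]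

/-- Independence of allocation and duration as an identity of measures, which applies to integrable,
possibly unbounded reward functions. -/
theorem map_restrict (h : N.OnlineRun P ν R dur X κ) (t : Fin T) (i : I) :
    (P.restrict {ω | X t ω = some i}).map (fun ω => dur ω t i) =
      P {ω | X t ω = some i} • N.usage i := by
  refine Measure.ext fun B hB => ?_
  rw [Measure.map_apply (h.measurable_dur t i) hB,
    Measure.restrict_apply (h.measurable_dur t i hB), Measure.smul_apply, smul_eq_mul,
    ← h.measure_alloc_dur' t i hB]
  congr 1
  ext ω
  exact and_comm

theorem setIntegral_rew (h : N.OnlineRun P ν R dur X κ) (t : Fin T) (i : I) :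
    ∫ ω in {ω | X t ω = some i}, N.rew i (dur ω t i) ∂P =
      P.real {ω | X t ω = some i} * N.meanRew i := by
  have hs : AEStronglyMeasurable (N.rew i)
      ((P.restrict {ω | X t ω = some i}).map (fun ω => dur ω t i)) := by
    rw [h.map_restrict]
    exact (N.rew_integrable i).aestronglyMeasurable.smul_measure _
  rw [← integral_map (h.measurable_dur t i).aemeasurable hs, h.map_restrict,
    integral_smul_measure]
  rfl

variable [IsProbabilityMeasure P]

theorem integrableOn_rew (h : N.OnlineRun P ν R dur X κ) (t : Fin T) (i : I) :
    IntegrableOn (fun ω => N.rew i (dur ω t i)) {ω | X t ω = some i} P := by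
  have : Integrable (N.rew i) ((P.restrict {ω | X t ω = some i}).map (fun ω => dur ω t i)) := by
    rw [h.map_restrict]
    exact (N.rew_integrable i).smul_measure (measure_ne_top _ _)
  exact this.comp_measurable (h.measurable_dur t i)

/-- A Wald-type identity: each use earns its mean because its duration is independent of the
decision. Values of policies and algorithms thus depend only on allocation probabilities. -/
theorem integral_totalReward [Fintype I] [DecidableEq I] (h : N.OnlineRun P ν R dur X κ) :
    ∫ ω, N.totalReward (fun t => X t ω) (dur ω) ∂P =
      ∑ i, N.meanRew i * ∑ t, P.real {ω | X t ω = some i} := by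
  have hind : ∀ t i, (fun ω => if X t ω = some i then N.rew i (dur ω t i) else 0) =
      Set.indicator {ω | X t ω = some i} (fun ω => N.rew i (dur ω t i)) := by
    intro t i
    funext ω
    simp [Set.indicator_apply]
  have hint : ∀ t i, Integrable (fun ω => if X t ω = some i then N.rew i (dur ω t i) else 0) P := by
    intro t i
    rw [hind, integrable_indicator_iff (h.measurableSet_alloc t i)]
    exact h.integrableOn_rew t i
  unfold totalReward
  rw [integral_finsetSum _ fun t _ => integrable_finsetSum _ fun i _ => hint t i]
  simp only [Finset.mul_sum]
  rw [Finset.sum_comm]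
  refine Finset.sum_congr rfl fun t _ => ?_
  rw [integral_finsetSum _ fun i _ => hint t i]
  refine Finset.sum_congr rfl fun i _ => ?_
  rw [hind, integral_indicator (h.measurableSet_alloc t i), h.setIntegral_rew, mul_comm]

end OnlineRun

/-- If only available units are allocated, then no more units are in use than there are. -/
theorem inUse_add_le [DecidableEq I] (N : Network I T) (X : Fin T → Option I)
    (d : Fin T → I → ℝ≥0∞) (havail : ∀ t i, X t = some i → N.inUse X d t i < N.cap i)
    (t : Fin T) (i : I) :
    N.inUse X d t i + (if X t = some i then 1 else 0) ≤ N.cap i := by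
  split_ifs with hc
  · exact havail t i hc
  rw [add_zero]
  set U := Finset.univ.filter
    (fun τ : Fin T => τ < t ∧ X τ = some i ∧ N.elapsed τ t < d τ i) with hU
  rcases U.eq_empty_or_nonempty with h0 | hne
  · have : N.inUse X d t i = 0 := by
      rw [inUse, ← hU, h0, Finset.card_empty]
    omega
  -- Take the latest start `s` among the uses still running at `t`. The others were already running
  -- at `s`, when a unit was free, so together with `s` they number at most the inventory.
  have hs := U.max'_mem hne
  set s := U.max' hne
  have hs' := (Finset.mem_filter.1 hs).2
  have hsub : U.erase s ⊆ Finset.univ.filter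
      (fun τ : Fin T => τ < s ∧ X τ = some i ∧ N.elapsed τ s < d τ i) := by
    intro τ hτ
    obtain ⟨hne', hτU⟩ := Finset.mem_erase.1 hτ
    have hτ' := (Finset.mem_filter.1 hτU).2
    refine Finset.mem_filter.2 ⟨Finset.mem_univ _, lt_of_le_of_ne (U.le_max' τ hτU) hne',
      hτ'.2.1, (N.elapsed_mono τ hs'.1.le).trans_lt hτ'.2.2⟩
  have h1 := Finset.card_le_card hsub
  have h2 := havail s i hs'.2.1
  rw [Finset.card_erase_of_mem hs] at h1
  have h3 : N.inUse X d t i = U.card := rfl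
  unfold inUse at h2
  omega

namespace OnlineRun

variable {N : Network I T} {Ω Ω₀ : Type} [MeasurableSpace Ω] [MeasurableSpace Ω₀]
  {P : Measure Ω} {ν : Measure Ω₀} [IsProbabilityMeasure P] [IsProbabilityMeasure ν]
  {R : Fin T → Ω × Ω₀ → Ω} {dur : Ω → Fin T → I → ℝ≥0∞}
  {X : Fin T → Ω → Option I} {κ : Fin T → I → Ω → ℝ≥0∞}

/-- An allocation process that only uses available units satisfies the fluid constraints. -/
theorem fluid_capacity [DecidableEq I] (h : N.OnlineRun P ν R dur X κ)
    (havail : ∀ t i ω, X t ω = some i → N.inUse (fun τ => X τ ω) (dur ω) t i < N.cap i)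
    (t : Fin T) (i : I) :
    P.real {ω | X t ω = some i} + ∑ τ ∈ Finset.univ.filter (fun τ : Fin T => τ < t),
      P.real {ω | X τ ω = some i} * (1 - N.cdf i (N.elapsed τ t)) ≤ N.cap i := by
  set F := Finset.univ.filter (fun τ : Fin T => τ < t)
  set A := fun τ : Fin T => {ω | X τ ω = some i ∧ dur ω τ i ∈ Set.Ioi (N.elapsed τ t)} with hA
  have hAm : ∀ τ, MeasurableSet (A τ) := fun τ => h.measurableSet_alloc_dur τ i measurableSet_Ioi
  have hAr : ∀ τ, P.real (A τ) =
      P.real {ω | X τ ω = some i} * (1 - N.cdf i (N.elapsed τ t)) := by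
    intro τ
    rw [← N.usage_Ioi, measureReal_def, h.measure_alloc_dur' τ i measurableSet_Ioi,
      ENNReal.toReal_mul]
    rfl
  have hint : ∀ B : Set Ω, MeasurableSet B → Integrable (B.indicator fun _ => (1 : ℝ)) P :=
    fun B hB => (integrable_const _).indicator hB
  have hreal : ∀ B : Set Ω, MeasurableSet B → P.real B = ∫ ω, B.indicator (fun _ => (1 : ℝ)) ω ∂P :=
    fun B hB => by rw [integral_indicator hB, setIntegral_const, smul_eq_mul, mul_one]
  calc _ = P.real {ω | X t ω = some i} + ∑ τ ∈ F, P.real (A τ) := by simp only [hAr]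
    _ = ∫ ω, ({ω | X t ω = some i}.indicator (fun _ => (1 : ℝ)) ω +
          ∑ τ ∈ F, (A τ).indicator (fun _ => (1 : ℝ)) ω) ∂P := by
        rw [integral_add (hint _ (h.measurableSet_alloc t i))
          (integrable_finsetSum _ fun τ _ => hint _ (hAm τ)),
          integral_finsetSum _ fun τ _ => hint _ (hAm τ), hreal _ (h.measurableSet_alloc t i)]
        simp only [hreal _ (hAm _)]
    _ ≤ ∫ _, (N.cap i : ℝ) ∂P := by
        refine integral_mono ((hint _ (h.measurableSet_alloc t i)).add
          (integrable_finsetSum _ fun τ _ => hint _ (hAm τ))) (integrable_const _) fun ω => ?_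
        have hω := N.inUse_add_le (fun τ => X τ ω) (dur ω) (fun t i => havail t i ω) t i
        have e1 : ({ω | X t ω = some i}.indicator (fun _ => (1 : ℝ)) ω) =
            ((if X t ω = some i then 1 else 0 : ℕ) : ℝ) := by
          simp [Set.indicator_apply]
        have e2 : ∑ τ ∈ F, (A τ).indicator (fun _ => (1 : ℝ)) ω =
            (N.inUse (fun τ => X τ ω) (dur ω) t i : ℝ) := by
          simp only [Set.indicator_apply, hA, Set.mem_ofPred_eq, Set.mem_Ioi, Finset.sum_boole,
            F, Finset.filter_filter]
          rfl
        dsimp only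
        rw [e1, e2]
        have : ((N.inUse (fun τ => X τ ω) (dur ω) t i + (if X t ω = some i then 1 else 0) : ℕ) : ℝ)
            ≤ N.cap i := by exact_mod_cast hω
        push_cast at this ⊢
        linarith
    _ = N.cap i := by simp

section Tail

variable {i : I} {q : Fin T → ℝ}

/-- Exponential moments of the number of units in use. -/
theorem lintegral_prod_le (h : N.OnlineRun P ν R dur X κ) (hq : ∀ τ, 0 ≤ q τ)
    (hκ : ∀ τ ω, κ τ i ω ≤ ENNReal.ofReal (q τ)) [DecidableEq I] (t : Fin T) {E : ℝ} (hE : 1 ≤ E)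
    (n : ℕ) (hn : n ≤ T) :
    ∫⁻ ω, ∏ τ ∈ Finset.univ.filter (fun τ : Fin T => τ.val < n),
      (if X τ ω = some i ∧ N.elapsed τ t < dur ω τ i then ENNReal.ofReal E else 1) ∂P ≤
    ENNReal.ofReal (Real.exp ((E - 1) * ∑ τ ∈ Finset.univ.filter (fun τ : Fin T => τ.val < n),
      q τ * (1 - N.cdf i (N.elapsed τ t)))) := by
  set A := fun τ : Fin T => {ω | X τ ω = some i ∧ dur ω τ i ∈ Set.Ioi (N.elapsed τ t)} with hA
  have hAm : ∀ τ, MeasurableSet (A τ) := fun τ => h.measurableSet_alloc_dur τ i measurableSet_Ioi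
  set f := fun (τ : Fin T) (ω : Ω) => (if X τ ω = some i ∧ N.elapsed τ t < dur ω τ i then
    ENNReal.ofReal E else 1) with hf
  have hfm : ∀ τ, Measurable (f τ) := fun τ =>
    Measurable.ite (hAm τ) measurable_const measurable_const
  have hfA : ∀ τ ω, f τ ω = 1 + (A τ).indicator (fun _ => ENNReal.ofReal (E - 1)) ω := by
    intro τ ω
    simp only [hf, hA, Set.indicator_apply, Set.mem_ofPred_eq, Set.mem_Ioi]
    split_ifs
    · rw [← ENNReal.ofReal_one, ← ENNReal.ofReal_add zero_le_one (by linarith)]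
      congr 1
      ring
    · simp
  induction n with
  | zero => simp
  | succ n ih =>
    set s : Fin T := ⟨n, hn⟩ with hs
    have hfil : Finset.univ.filter (fun τ : Fin T => τ.val < n + 1) =
        insert s (Finset.univ.filter (fun τ : Fin T => τ.val < n)) := by
      ext τ
      simp only [Finset.mem_filter, Finset.mem_univ, true_and, Finset.mem_insert, Fin.ext_iff, hs]
      omega
    have hns : s ∉ Finset.univ.filter (fun τ : Fin T => τ.val < n) := by simp [hs]
    set F := fun ω => ∏ τ ∈ Finset.univ.filter (fun τ : Fin T => τ.val < n), f τ ω with hF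
    have hFm : Measurable F := Finset.measurable_fun_prod _ fun τ _ => hfm τ
    -- Only the conditional probability given the past is bounded; no independence between uses is
    -- needed. The last factor contributes at most 1 + (E - 1) q (1 - F) ≤ exp((E - 1) q (1 - F)),
    -- uniformly in `ω`.
    have hstep : ∀ ω, ∫⁻ v, f s (R s (ω, v)) ∂ν ≤
        ENNReal.ofReal (Real.exp ((E - 1) * (q s * (1 - N.cdf i (N.elapsed s t))))) := by
      intro ω
      have hms : MeasurableSet {v | R s (ω, v) ∈ A s} :=
        ((h.resample s).measurable.comp measurable_prodMk_left) (hAm s)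
      have e : ∀ v, f s (R s (ω, v)) =
          1 + {v | R s (ω, v) ∈ A s}.indicator (fun _ => ENNReal.ofReal (E - 1)) v := fun v => by
        rw [hfA]; rfl
      simp only [e]
      rw [lintegral_add_left measurable_const, lintegral_indicator_const hms, lintegral_const,
        measure_univ, mul_one]
      have hc : ν {v | R s (ω, v) ∈ A s} = κ s i ω * N.usage i (Set.Ioi (N.elapsed s t)) :=
        h.cond s i ω _ measurableSet_Ioi
      have hu : N.usage i (Set.Ioi (N.elapsed s t)) =
          ENNReal.ofReal (1 - N.cdf i (N.elapsed s t)) := by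
        rw [← N.usage_Ioi, ofReal_measureReal]
      have hG : 0 ≤ 1 - N.cdf i (N.elapsed s t) := sub_nonneg.2 (N.cdf_le_one _ _)
      have hle : κ s i ω * N.usage i (Set.Ioi (N.elapsed s t)) ≤
          ENNReal.ofReal (q s * (1 - N.cdf i (N.elapsed s t))) := by
        rw [ENNReal.ofReal_mul (hq s), hu]
        gcongr
        exact hκ s ω
      rw [hc]
      calc _ ≤ 1 + ENNReal.ofReal (E - 1) *
              ENNReal.ofReal (q s * (1 - N.cdf i (N.elapsed s t))) := by gcongr
        _ = ENNReal.ofReal (1 + (E - 1) * (q s * (1 - N.cdf i (N.elapsed s t)))) := by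
            rw [ENNReal.ofReal_add zero_le_one
              (mul_nonneg (by linarith) (mul_nonneg (hq s) hG)), ENNReal.ofReal_one,
              ENNReal.ofReal_mul (p := E - 1) (by linarith)]
        _ ≤ _ := ENNReal.ofReal_le_ofReal (by
            have := Real.add_one_le_exp ((E - 1) * (q s * (1 - N.cdf i (N.elapsed s t))))
            linarith)
    rw [hfil]
    simp only [Finset.prod_insert hns, Finset.sum_insert hns]
    calc ∫⁻ ω, f s ω * F ω ∂P = ∫⁻ z, f s (R s z) * F (R s z) ∂(P.prod ν) :=
          ((h.resample s).lintegral_comp ((hfm s).mul hFm)).symm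
      _ = ∫⁻ ω, ∫⁻ v, f s (R s (ω, v)) * F (R s (ω, v)) ∂ν ∂P :=
          lintegral_prod _ (((hfm s).mul hFm).comp (h.resample s).measurable).aemeasurable
      _ = ∫⁻ ω, (∫⁻ v, f s (R s (ω, v)) ∂ν) * F ω ∂P := by
          refine lintegral_congr fun ω => ?_
          have hFR : ∀ v, F (R s (ω, v)) = F ω := by
            intro v
            refine Finset.prod_congr rfl fun τ hτ => ?_
            have hlt : τ < s := (Finset.mem_filter.1 hτ).2
            simp only [hf, h.alloc_past s τ hlt, h.dur_past s τ hlt]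
          simp only [hFR]
          exact lintegral_mul_const _
            ((hfm s).comp ((h.resample s).measurable.comp measurable_prodMk_left))
      _ ≤ ∫⁻ ω, ENNReal.ofReal (Real.exp ((E - 1) * (q s * (1 - N.cdf i (N.elapsed s t))))) *
            F ω ∂P := lintegral_mono fun ω => mul_le_mul_left (hstep ω) _
      _ = ENNReal.ofReal (Real.exp ((E - 1) * (q s * (1 - N.cdf i (N.elapsed s t))))) *
            ∫⁻ ω, F ω ∂P := lintegral_const_mul _ hFm
      _ ≤ _ := by
          rw [mul_add, Real.exp_add, ENNReal.ofReal_mul (Real.exp_pos _).le]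
          gcongr
          exact ih (by omega)

/-- Chernoff bound for the number of units in use. -/
theorem measure_cap_le_inUse (h : N.OnlineRun P ν R dur X κ) (hq : ∀ τ, 0 ≤ q τ)
    (hκ : ∀ τ ω, κ τ i ω ≤ ENNReal.ofReal (q τ)) [DecidableEq I] (t : Fin T) {E : ℝ} (hE : 1 ≤ E)
    (c : ℕ) :
    P.real {ω | c ≤ N.inUse (fun τ => X τ ω) (dur ω) t i} ≤
      Real.exp ((E - 1) * ∑ τ ∈ Finset.univ.filter (fun τ : Fin T => τ < t),
        q τ * (1 - N.cdf i (N.elapsed τ t))) / E ^ c := by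
  have h1 := h.lintegral_prod_le hq hκ t hE t.val t.isLt.le
  set F := fun ω => ∏ τ ∈ Finset.univ.filter (fun τ : Fin T => τ.val < t.val),
      (if X τ ω = some i ∧ N.elapsed τ t < dur ω τ i then ENNReal.ofReal E else 1) with hF
  have hE0 : 0 < E := by linarith
  have hFe : ∀ ω, F ω = ENNReal.ofReal E ^ N.inUse (fun τ => X τ ω) (dur ω) t i := by
    intro ω
    rw [hF]
    dsimp only
    rw [← Finset.prod_filter, Finset.prod_const, Finset.filter_filter]
    rfl
  have hsub : {ω | c ≤ N.inUse (fun τ => X τ ω) (dur ω) t i} ⊆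
      {ω | ENNReal.ofReal (E ^ c) ≤ F ω} := by
    intro ω hω
    simp only [Set.mem_ofPred_eq] at hω ⊢
    rw [hFe, ENNReal.ofReal_pow hE0.le]
    exact pow_le_pow_right₀ (by simpa using ENNReal.ofReal_le_ofReal hE) hω
  have hFm : Measurable F := by
    refine Finset.measurable_fun_prod _ fun τ _ => Measurable.ite ?_ measurable_const
      measurable_const
    exact h.measurableSet_alloc_dur τ i (B := Set.Ioi (N.elapsed τ t)) measurableSet_Ioi
  have h2 := (mul_meas_ge_le_lintegral hFm (ENNReal.ofReal (E ^ c))).trans h1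
  rw [le_div_iff₀ (pow_pos hE0 c), mul_comm]
  have h3 : ENNReal.ofReal (E ^ c) * P {ω | c ≤ N.inUse (fun τ => X τ ω) (dur ω) t i} ≤
      ENNReal.ofReal (Real.exp ((E - 1) * ∑ τ ∈ Finset.univ.filter (fun τ : Fin T => τ < t),
        q τ * (1 - N.cdf i (N.elapsed τ t)))) :=
    (mul_le_mul_right (measure_mono hsub) _).trans h2
  have h4 := ENNReal.toReal_mono ENNReal.ofReal_ne_top h3
  rwa [ENNReal.toReal_mul, ENNReal.toReal_ofReal (pow_pos hE0 c).le,
    ENNReal.toReal_ofReal (Real.exp_pos _).le] at h4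

end Tail

end OnlineRun

/-- The Chernoff bound at E = 1 + d for mean at most c / (1 + d). For d ≤ 1 its exponent is at most
-c d² / 6 = -(100/6) log c, well below -log c; the constant 100 is generous. -/
theorem exp_div_pow_le_inv {c : ℕ} (hc : 2 ≤ c) {d : ℝ}
    (hd : d = Real.sqrt (100 * Real.log c / c)) (hd1 : d ≤ 1) :
    Real.exp (d * (c / (1 + d))) / (1 + d) ^ c ≤ 1 / c := by
  have hc0 : (0 : ℝ) < c := by positivity
  have hl : 0 < Real.log c := Real.log_pos (by exact_mod_cast hc)
  have hd0 : 0 ≤ d := hd ▸ Real.sqrt_nonneg _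
  have hd2 : c * d ^ 2 = 100 * Real.log c := by
    rw [hd, Real.sq_sqrt (by positivity)]
    field_simp
  have h1 := Real.le_log_one_add_of_nonneg hd0
  have hpow : (1 + d) ^ c = Real.exp (c * Real.log (1 + d)) := by
    rw [Real.exp_nat_mul, Real.exp_log (by linarith)]
  have hinv : (1 : ℝ) / c = Real.exp (-Real.log c) := by
    rw [Real.exp_neg, Real.exp_log hc0, one_div]
  rw [hpow, hinv, ← Real.exp_sub, Real.exp_le_exp]
  -- 2d / (d + 2) is a lower bound for log(1 + d). The 6 is (d + 2)(1 + d) at d = 1.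
  have h2 : d / (1 + d) ≤ 2 * d / (d + 2) - d ^ 2 / 6 := by
    have e : 2 * d / (d + 2) - d / (1 + d) = d ^ 2 / ((d + 2) * (1 + d)) := by
      field_simp
      ring
    have : d ^ 2 / 6 ≤ d ^ 2 / ((d + 2) * (1 + d)) := by
      apply div_le_div_of_nonneg_left (by positivity) (by positivity)
      nlinarith
    linarith
  have h3 : c * (d / (1 + d)) ≤ c * (Real.log (1 + d) - d ^ 2 / 6) := by gcongr; linarith
  have h4 : d * (c / (1 + d)) = c * (d / (1 + d)) := by ring
  rw [h4]
  nlinarith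

end Network

/-! ### Sampling from a list of weights -/

instance : IsProbabilityMeasure unif := ⟨by simp [unif]⟩

theorem unif_eq : unif = (volume : Measure ℝ).restrict (Set.Ioc 0 1) :=
  (restrict_Ioc_eq_restrict_Icc).symm

theorem measurableSet_pick {α : Type} (l : List (α × ℝ)) (o : Option α) :
    MeasurableSet {u | pick l u = o} := by
  induction l generalizing o with
  | nil => simp [pick]
  | cons q l ih =>
    obtain ⟨x, w⟩ := q
    have : {u | pick ((x, w) :: l) u = o} =
        (Set.Ioc 0 w ∩ {_u | some x = o}) ∪
          ((Set.Ioc 0 w)ᶜ ∩ (fun u => u - w) ⁻¹' {u | pick l u = o}) := by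
      ext u
      simp only [pick, Set.mem_ofPred_eq, Set.mem_union, Set.mem_inter_iff, Set.mem_Ioc,
        Set.mem_compl_iff, Set.mem_preimage]
      split_ifs with h <;> simp [h]
    rw [this]
    exact (measurableSet_Ioc.inter (MeasurableSet.const _)).union
      (measurableSet_Ioc.compl.inter ((measurable_id.sub_const w) (ih o)))

/-- Peel off the first interval and translate the rest back to 0. The right end `M` is free because
the translation shortens it; mass beyond the total weight draws nothing and counts 0. -/
theorem setLIntegral_pick {α : Type} (l : List (α × ℝ)) (hl : ∀ q ∈ l, 0 ≤ q.2) (f : α → ℝ≥0∞)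
    (M : ℝ) (hM : (l.map Prod.snd).sum ≤ M) :
    ∫⁻ u in Set.Ioc 0 M, (pick l u).elim 0 f =
      (l.map fun q => ENNReal.ofReal q.2 * f q.1).sum := by
  induction l generalizing M with
  | nil => simp [pick]
  | cons q l ih =>
    obtain ⟨x, w⟩ := q
    have hw : 0 ≤ w := hl (x, w) List.mem_cons_self
    have hl' : ∀ q ∈ l, 0 ≤ q.2 := fun q hq => hl q (List.mem_cons_of_mem _ hq)
    simp only [List.map_cons, List.sum_cons] at hM ⊢
    have hs : 0 ≤ (l.map Prod.snd).sum := List.sum_nonneg (by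
      simpa using fun b a hab => hl' (a, b) hab)
    have hwM : w ≤ M := by linarith
    rw [← Set.Ioc_union_Ioc_eq_Ioc hw hwM,
      lintegral_union measurableSet_Ioc (Set.Ioc_disjoint_Ioc_of_le le_rfl)]
    congr 1
    · rw [setLIntegral_congr_fun (g := fun _ => f x) measurableSet_Ioc, setLIntegral_const]
      · rw [Real.volume_Ioc, sub_zero, mul_comm]
      · intro u hu
        have : 0 < u ∧ u ≤ w := hu
        simp [pick, this]
    · rw [← ih hl' (M - w) (by linarith)]
      have hpre : (fun u => u - w) ⁻¹' Set.Ioc 0 (M - w) = Set.Ioc w M := by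
        ext u
        simp
      rw [← (measurePreserving_sub_right volume w).setLIntegral_comp_preimage_emb
        (measurableEmbedding_subRight w) _ (Set.Ioc 0 (M - w)), hpre]
      refine setLIntegral_congr_fun measurableSet_Ioc fun u hu => ?_
      have : ¬ (0 < u ∧ u ≤ w) := fun h => absurd hu.1 (not_lt.2 h.2)
      simp [pick, this]

/-- A draw from a list of weights. -/
theorem lintegral_pick {α : Type} (l : List (α × ℝ)) (hl : ∀ q ∈ l, 0 ≤ q.2) (f : α → ℝ≥0∞)
    (hM : (l.map Prod.snd).sum ≤ 1) :
    ∫⁻ u, (pick l u).elim 0 f ∂unif = (l.map fun q => ENNReal.ofReal q.2 * f q.1).sum := by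
  rw [unif_eq]
  exact setLIntegral_pick l hl f 1 hM

theorem unif_pick_eq {α : Type} [DecidableEq α] (l : List (α × ℝ)) (hl : ∀ q ∈ l, 0 ≤ q.2)
    (hM : (l.map Prod.snd).sum ≤ 1) (a : α) :
    unif {u | pick l u = some a} =
      (l.map fun q => ENNReal.ofReal q.2 * if q.1 = a then 1 else 0).sum := by
  rw [← lintegral_pick l hl (fun b => if b = a then 1 else 0) hM,
    ← lintegral_indicator_one (measurableSet_pick l _)]
  refine lintegral_congr fun u => ?_
  simp only [Set.indicator_apply, Set.mem_ofPred_eq, Pi.one_apply]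
  cases pick l u <;> simp

/-- A draw from the weights of a finite set. -/
theorem unif_pick_sort {α : Type} [LinearOrder α] (S : Finset α) (w : α → ℝ) (hw : ∀ a, 0 ≤ w a)
    (h1 : ∑ a ∈ S, w a ≤ 1) (a : α) :
    unif {u | pick ((S.sort (· ≤ ·)).map fun a => (a, w a)) u = some a} =
      if a ∈ S then ENNReal.ofReal (w a) else 0 := by
  have hsum : ∀ {β : Type} [AddCommMonoid β] (f : α → β),
      ((S.sort (· ≤ ·)).map f).sum = ∑ a ∈ S, f a := by
    intro β _ f
    rw [Finset.sum_eq_multiset_sum, ← Finset.sort_eq S (· ≤ ·), Multiset.map_coe,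
      Multiset.sum_coe]
  rw [unif_pick_eq]
  · rw [List.map_map]
    simp only [Function.comp_def, mul_ite, mul_one, mul_zero]
    rw [hsum, Finset.sum_ite_eq']
  · intro q hq
    obtain ⟨b, _, rfl⟩ := List.mem_map.1 hq
    exact hw b
  · rw [List.map_map]
    simp only [Function.comp_def]
    rwa [hsum]

/-! ### Probability matching -/

namespace ChoiceNetwork

section ProbMatch

variable {I : Type} [DecidableEq I]

/-- The smallest ratio keeps all reduced targets nonnegative and brings that of `s₀` to 0, so `s₀`
can be removed. The third claim holds for the resource removed last, which lies in every set of the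
list; it is what bounds the total weight. -/
theorem matchRounds_spec (sel : ArgmaxRule I) (φ : Finset I → I → ℝ)
    (hoff : ∀ S i, i ∉ S → φ S i = 0)
    (hsub : ∀ S S' i, S ⊆ S' → i ∈ S → φ S' i ≤ φ S i) (n : ℕ) (S : Finset I) (p : I → ℝ)
    (hn : S.card = n) (hp : ∀ s ∈ S, 0 ≤ p s) (hφ : ∀ s ∈ S, 0 < φ S s) :
    (∀ q ∈ matchRounds sel φ n S p, 0 ≤ q.2 ∧ q.1 ⊆ S) ∧
    (∀ s ∈ S, ((matchRounds sel φ n S p).map fun q => q.2 * φ q.1 s).sum = p s) ∧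
    (S.Nonempty → ∃ s ∈ S, ∀ q ∈ matchRounds sel φ n S p, s ∈ q.1) := by
  induction n generalizing S p with
  | zero =>
    rw [Finset.card_eq_zero] at hn
    subst hn
    simp [matchRounds]
  | succ n ih =>
    have hne : S.Nonempty := Finset.card_pos.1 (by omega)
    simp only [matchRounds]
    have hmem := sel.select_mem S (fun s => -(p s / φ S s)) hne
    have hle := sel.le_select S (fun s => -(p s / φ S s))
    set s₀ := sel.select S (fun s => -(p s / φ S s))
    set γ := p s₀ / φ S s₀ with hγ
    have hγ0 : 0 ≤ γ := div_nonneg (hp _ hmem) (hφ _ hmem).le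
    have hγs : ∀ s ∈ S, γ * φ S s ≤ p s := fun s hs => by
      rw [← le_div_iff₀ (hφ s hs)]
      exact neg_le_neg_iff.1 (hle s hs)
    have hcard : (S.erase s₀).card = n := by rw [Finset.card_erase_of_mem hmem]; omega
    obtain ⟨h1, h2, h3⟩ := ih (S.erase s₀) (fun s => p s - γ * φ S s) hcard
      (fun s hs => sub_nonneg.2 (hγs s (Finset.mem_of_mem_erase hs)))
      (fun s hs => (hφ s (Finset.mem_of_mem_erase hs)).trans_le
        (hsub _ _ s (Finset.erase_subset _ _) hs))
    refine ⟨?_, ?_, fun _ => ?_⟩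
    · intro q hq
      rcases List.mem_cons.1 hq with rfl | hq
      · exact ⟨hγ0, subset_rfl⟩
      · exact ⟨(h1 q hq).1, (h1 q hq).2.trans (Finset.erase_subset _ _)⟩
    · intro s hs
      rw [List.map_cons, List.sum_cons]
      by_cases hss : s = s₀
      · subst hss
        rw [List.sum_eq_zero]
        · rw [hγ, add_zero, div_mul_cancel₀ _ (hφ _ hmem).ne']
        · intro x hx
          obtain ⟨q, hq, rfl⟩ := List.mem_map.1 hx
          rw [hoff q.1 _ fun h => Finset.notMem_erase _ _ ((h1 q hq).2 h), mul_zero]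
      · rw [h2 s (Finset.mem_erase.2 ⟨hss, hs⟩)]
        ring
    · rcases (S.erase s₀).eq_empty_or_nonempty with h0 | h0
      · refine ⟨s₀, hmem, fun q hq => ?_⟩
        have hn0 : n = 0 := by rw [← hcard, h0, Finset.card_empty]
        subst hn0
        simp only [matchRounds, List.mem_singleton] at hq
        rw [hq]
        exact hmem
      · obtain ⟨s, hs, hq⟩ := h3 h0
        refine ⟨s, Finset.mem_of_mem_erase hs, fun q hq' => ?_⟩
        rcases List.mem_cons.1 hq' with rfl | hq'
        · exact Finset.mem_of_mem_erase hs
        · exact hq q hq'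

/-- Probability matching on a subset of an assortment, with targets at most the choice
probabilities of this assortment, gives a subprobability distribution on assortments that
attains the targets. -/
theorem probMatch_spec (sel : ArgmaxRule I) (φ : Finset I → I → ℝ)
    (hoff : ∀ S i, i ∉ S → φ S i = 0)
    (hsub : ∀ S S' i, S ⊆ S' → i ∈ S → φ S' i ≤ φ S i) (A S : Finset I) (hSA : S ⊆ A)
    (p : I → ℝ) (hp : ∀ s ∈ S, 0 ≤ p s) (hφ : ∀ s ∈ A, 0 < φ A s) (hpA : ∀ s ∈ S, p s ≤ φ A s) :
    (∀ q ∈ probMatch sel φ S p, 0 ≤ q.2) ∧ ((probMatch sel φ S p).map Prod.snd).sum ≤ 1 ∧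
    ∀ s, ((probMatch sel φ S p).map fun q => q.2 * φ q.1 s).sum = if s ∈ S then p s else 0 := by
  obtain ⟨h1, h2, h3⟩ := matchRounds_spec sel φ hoff hsub S.card S p rfl hp
    (fun s hs => (hφ s (hSA hs)).trans_le (hsub _ _ s hSA hs))
  refine ⟨fun q hq => (h1 q hq).1, ?_, fun s => ?_⟩
  · rcases S.eq_empty_or_nonempty with h0 | h0
    · subst h0
      simp [probMatch, matchRounds]
    · obtain ⟨s, hs, hsq⟩ := h3 h0
      -- For a resource `s` common to all output sets, substitutability gives total weight times `φ
      -- A s` ≤ `p s` ≤ `φ A s`, hence total weight at most 1.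
      have hle : ((probMatch sel φ S p).map fun q => q.2 * φ A s).sum ≤
          ((probMatch sel φ S p).map fun q => q.2 * φ q.1 s).sum := by
        refine List.sum_le_sum fun q hq => mul_le_mul_of_nonneg_left ?_ (h1 q hq).1
        exact hsub _ _ s ((h1 q hq).2.trans hSA) (hsq q hq)
      have h4 : ((probMatch sel φ S p).map fun q => q.2 * φ q.1 s).sum = p s := h2 s hs
      rw [h4, List.sum_map_mul_right] at hle
      have hpos := hφ s (hSA hs)
      have := hle.trans (hpA s hs)
      exact le_of_mul_le_mul_right (by simpa using this) hpos
  · split_ifs with hs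
    · exact h2 s hs
    · refine List.sum_eq_zero fun x hx => ?_
      obtain ⟨q, hq, rfl⟩ := List.mem_map.1 hx
      rw [hoff q.1 s fun h => hs ((h1 q hq).2 h), mul_zero]

end ProbMatch

end ChoiceNetwork

/-! ### Measurability of finite-valued processes -/

section FiniteValued

variable {Ω : Type} [MeasurableSpace Ω]

theorem measurableSet_finite_cases {β : Type} [Finite β] (f : Ω → β)
    (hf : ∀ b, MeasurableSet {ω | f ω = b}) (Q : β → Set Ω) (hQ : ∀ b, MeasurableSet (Q b)) :
    MeasurableSet {ω | ω ∈ Q (f ω)} := by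
  have : {ω | ω ∈ Q (f ω)} = ⋃ b, {ω | f ω = b} ∩ Q b := by
    ext ω
    simp
  rw [this]
  exact MeasurableSet.iUnion fun b => (hf b).inter (hQ b)

theorem measurableSet_bind {α β : Type} [Finite α] (f : Ω → Option α) (g : Ω → α → Option β)
    (hf : ∀ a, MeasurableSet {ω | f ω = a}) (hg : ∀ a o, MeasurableSet {ω | g ω a = o})
    (o : Option β) : MeasurableSet {ω | (f ω).bind (g ω) = o} := by
  refine measurableSet_finite_cases f hf (fun a => {ω | a.bind (g ω) = o}) fun a => ?_
  cases a with
  | none => exact MeasurableSet.const (none = o)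
  | some a => exact hg a o

/-- There are finitely many histories, so it suffices that the decision is measurable for each fixed
history. -/
theorem measurableSet_playout {T : ℕ} {α : Type} [Finite α] (init : α)
    (dec : Ω → Fin T → (Fin T → α) → α) (h : ∀ t X o, MeasurableSet {ω | dec ω t X = o}) (n : ℕ)
    (τ : Fin T) (o : α) : MeasurableSet {ω | playout init (dec ω) n τ = o} := by
  induction n generalizing τ o with
  | zero => exact MeasurableSet.const (init = o)
  | succ n ih =>
    by_cases hτ : τ.val = n
    · simp only [playout, hτ, if_true]
      refine measurableSet_finite_cases (fun ω => playout init (dec ω) n) (fun X => ?_)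
        (fun X => {ω | dec ω τ X = o}) fun X => h τ X o
      have : {ω | playout init (dec ω) n = X} = ⋂ σ, {ω | playout init (dec ω) n σ = X σ} := by
        ext ω
        simp [funext_iff]
      rw [this]
      exact MeasurableSet.iInter fun σ => ih σ (X σ)
    · simp only [playout, if_neg hτ]
      exact ih τ o

end FiniteValued

namespace Network

variable {I : Type} {T : ℕ}

theorem measurable_inUse [DecidableEq I] {Ω : Type} [MeasurableSpace Ω] (N : Network I T)
    (X : Ω → Fin T → Option I) (dur : Ω → Fin T → I → ℝ≥0∞) (t : Fin T) (i : I)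
    (hX : ∀ τ, MeasurableSet {ω | X ω τ = some i}) (hd : ∀ τ, Measurable fun ω => dur ω τ i) :
    Measurable fun ω => N.inUse (X ω) (dur ω) t i := by
  simp only [inUse, Finset.card_filter]
  refine Finset.measurable_fun_sum _ fun τ _ => Measurable.ite ?_ measurable_const measurable_const
  exact (MeasurableSet.const _).inter ((hX τ).inter (measurableSet_lt measurable_const (hd τ)))

theorem inUse_congr [DecidableEq I] (N : Network I T) {X X' : Fin T → Option I}
    {d d' : Fin T → I → ℝ≥0∞} {t : Fin T} (hX : ∀ τ < t, X τ = X' τ) (hd : ∀ τ < t, d τ = d' τ)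
    (i : I) : N.inUse X d t i = N.inUse X' d' t i := by
  unfold inUse
  congr 1
  refine Finset.filter_congr fun τ _ => ?_
  refine and_congr_right fun h => ?_
  rw [hX τ h, hd τ h]

/-! ### The competitive ratio -/

theorem del_nonneg (N : Network I T) (i : I) : 0 ≤ N.del i := Real.sqrt_nonneg _

/-- A run that allocates `i` with conditional probability `x t i / (1 + δ i)` while units are
available attains almost all of the fluid solution `x`. -/
theorem OnlineRun.measureReal_ge [DecidableEq I] {N : Network I T} {Ω Ω₀ : Type}
    [MeasurableSpace Ω] [MeasurableSpace Ω₀] {P : Measure Ω} {ν : Measure Ω₀}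
    [IsProbabilityMeasure P] [IsProbabilityMeasure ν]
    {R : Fin T → Ω × Ω₀ → Ω} {dur : Ω → Fin T → I → ℝ≥0∞} {X : Fin T → Ω → Option I}
    {x : Fin T → I → ℝ} (hx : ∀ t i, 0 ≤ x t i)
    (h : N.OnlineRun P ν R dur X fun t i ω =>
      if N.inUse (fun τ => X τ ω) (dur ω) t i < N.cap i then
        ENNReal.ofReal (x t i / (1 + N.del i)) else 0)
    (i : I) (hcap : ∀ t, ∑ τ ∈ Finset.univ.filter (fun τ : Fin T => τ < t),
      x τ i * (1 - N.cdf i (N.elapsed τ t)) ≤ N.cap i)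
    (hc : 2 ≤ N.cap i) (hd : N.del i ≤ 1) (t : Fin T) :
    x t i / (1 + N.del i) * (1 - 1 / N.cap i) ≤ P.real {ω | X t ω = some i} := by
  have hd0 := N.del_nonneg i
  have hd1 : 0 < 1 + N.del i := by linarith
  have hq : ∀ τ, 0 ≤ x τ i / (1 + N.del i) := fun τ => div_nonneg (hx τ i) hd1.le
  have htail := h.measure_cap_le_inUse hq (fun τ ω => by
    split_ifs
    · exact le_rfl
    · exact zero_le) t (E := 1 + N.del i) (by linarith) (N.cap i)
  have hmu : ∑ τ ∈ Finset.univ.filter (fun τ : Fin T => τ < t),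
      x τ i / (1 + N.del i) * (1 - N.cdf i (N.elapsed τ t)) ≤ N.cap i / (1 + N.del i) := by
    rw [le_div_iff₀ hd1, Finset.sum_mul]
    refine le_trans (le_of_eq (Finset.sum_congr rfl fun τ _ => ?_)) (hcap t)
    field_simp
  have htail' : P.real {ω | N.cap i ≤ N.inUse (fun τ => X τ ω) (dur ω) t i} ≤ 1 / N.cap i := by
    refine (htail.trans ?_).trans (exp_div_pow_le_inv hc rfl hd)
    have : (1 + N.del i - 1) * ∑ τ ∈ Finset.univ.filter (fun τ : Fin T => τ < t),
        x τ i / (1 + N.del i) * (1 - N.cdf i (N.elapsed τ t)) ≤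
        N.del i * (N.cap i / (1 + N.del i)) := by
      rw [add_sub_cancel_left]
      exact mul_le_mul_of_nonneg_left hmu hd0
    exact div_le_div_of_nonneg_right (Real.exp_le_exp.2 this) (pow_pos hd1 _).le
  have hm : Measurable fun ω => N.inUse (fun τ => X τ ω) (dur ω) t i :=
    N.measurable_inUse (fun ω τ => X τ ω) dur t i (fun τ => h.measurableSet_alloc τ i)
      (fun τ => h.measurable_dur τ i)
  have hms : MeasurableSet {ω | N.cap i ≤ N.inUse (fun τ => X τ ω) (dur ω) t i} :=
    measurableSet_le measurable_const hm
  -- The conditional probability is constant on the event that a unit is free and 0 off it, so the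
  -- allocation probability is a product.
  have hP : P {ω | X t ω = some i} = ENNReal.ofReal (x t i / (1 + N.del i)) *
      P {ω | N.cap i ≤ N.inUse (fun τ => X τ ω) (dur ω) t i}ᶜ := by
    rw [h.measure_alloc, ← lintegral_indicator_const hms.compl]
    refine lintegral_congr fun ω => ?_
    simp [Set.indicator_apply]
  rw [measureReal_def, hP, ENNReal.toReal_mul, ENNReal.toReal_ofReal (hq t), ← measureReal_def,
    measureReal_compl hms, probReal_univ]
  exact mul_le_mul_of_nonneg_left (by linarith) (hq t)

end Network

/-- The loss in the competitive ratio as a function of the smallest inventory. -/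
noncomputable def loss (c : ℕ) : ℝ := if c < 3 then 1 else 12 * Real.sqrt (Real.log c / c)

theorem isBigO_loss : loss =O[atTop] fun c : ℕ => Real.sqrt (Real.log (c : ℝ) / (c : ℝ)) := by
  refine IsBigO.of_bound 12 ?_
  filter_upwards [eventually_ge_atTop 3] with c hc
  rw [loss, if_neg (by omega), norm_mul]
  simp

theorem tendsto_loss : Tendsto loss atTop (𝓝 0) := by
  refine isBigO_loss.trans_tendsto ?_
  have h1 : Tendsto (fun x : ℝ => Real.log x / x) atTop (𝓝 0) := by
    simpa using Real.tendsto_pow_log_div_mul_add_atTop 1 0 1 one_ne_zero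
  have h2 := (h1.comp tendsto_natCast_atTop_atTop).sqrt
  simpa using h2

namespace Network

variable {I : Type} {T : ℕ}

/-- Here `V` is the value of the policy, `x i` the revenue of GALG from `i`, and `a i` that of ALG.
With s = √(log c / c) at the smallest inventory, the losses are s from discretization, 10 s from δ,
and s from unavailability; hence the 12 in `loss`. -/
theorem competitive [Fintype I] [Nonempty I] (N : Network I T) (V : ℝ) (x a : I → ℝ) (hV : 0 ≤ V)
    (hx : ∀ i, 0 ≤ x i) (ha : ∀ i, 0 ≤ a i)
    (hVx : (1 - 1 / Real.exp 1) * V ≤ ∑ i, (1 + 1 / (N.cap i : ℝ)) * x i)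
    (hxa : ∀ i, 2 ≤ N.cap i → N.del i ≤ 1 →
      x i * ((1 - 1 / N.cap i) / (1 + N.del i)) ≤ a i) :
    (1 - 1 / Real.exp 1 - loss N.cmin) * V ≤ ∑ i, a i := by
  have he : 0 < 1 / Real.exp 1 := by positivity
  have he1 : 1 / Real.exp 1 ≤ 1 := by
    rw [div_le_one (Real.exp_pos 1)]
    exact Real.one_le_exp zero_le_one
  have hA : 0 ≤ ∑ i, a i := Finset.sum_nonneg fun i _ => ha i
  by_cases hl : 1 ≤ loss N.cmin
  -- A loss of at least 1 makes the claim trivial. Otherwise the smallest inventory is at least 3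
  -- and s < 1/12, whence δ ≤ 1 for every resource.
  · exact (mul_nonpos_of_nonpos_of_nonneg (by linarith) hV).trans hA
  push Not at hl
  have hc3 : 3 ≤ N.cmin := by
    by_contra hc
    rw [loss, if_pos (by omega)] at hl
    exact lt_irrefl _ hl
  have hloss : loss N.cmin = 12 * Real.sqrt (Real.log N.cmin / N.cmin) := if_neg (by omega)
  set s := Real.sqrt (Real.log N.cmin / N.cmin) with hs
  have hs0 : 0 ≤ s := Real.sqrt_nonneg _
  have hcm : ∀ i, N.cmin ≤ N.cap i := fun i => Finset.inf'_le _ (Finset.mem_univ i)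
  have hc3' : ∀ i, (3 : ℝ) ≤ N.cap i := fun i => by exact_mod_cast hc3.trans (hcm i)
  have he3 : Real.exp 1 ≤ 3 := (Real.exp_one_lt_d9.trans (by norm_num)).le
  have hsi : ∀ i, Real.sqrt (Real.log (N.cap i) / N.cap i) ≤ s := fun i => by
    -- log x / x decreases only from e on; this is why inventories below 3 are set aside.
    refine Real.sqrt_le_sqrt (Real.log_div_self_antitoneOn ?_ ?_ ?_)
    · exact he3.trans (by exact_mod_cast hc3)
    · exact he3.trans (hc3' i)
    · exact_mod_cast hcm i
  have hdel : ∀ i, N.del i ≤ 10 * s := fun i => by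
    have : N.del i = 10 * Real.sqrt (Real.log (N.cap i) / N.cap i) := by
      rw [del, mul_div_assoc, Real.sqrt_mul (by norm_num), show (100 : ℝ) = 10 ^ 2 by norm_num,
        Real.sqrt_sq (by norm_num)]
    rw [this]
    linarith [hsi i]
  have hinv : ∀ i, 1 / (N.cap i : ℝ) ≤ s := fun i => by
    refine le_trans (Real.le_sqrt_of_sq_le ?_) (hsi i)
    have hc := hc3' i
    have hlog : 1 ≤ Real.log (N.cap i) := by
      rw [Real.le_log_iff_exp_le (by linarith)]
      exact he3.trans hc
    rw [div_pow, one_pow, div_le_div_iff₀ (by positivity) (by linarith)]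
    nlinarith
  have hX : 0 ≤ ∑ i, x i := Finset.sum_nonneg fun i _ => hx i
  have h1 : (1 - 1 / Real.exp 1) * V ≤ (1 + s) * ∑ i, x i := by
    refine hVx.trans ?_
    rw [Finset.mul_sum]
    exact Finset.sum_le_sum fun i _ => mul_le_mul_of_nonneg_right (by linarith [hinv i]) (hx i)
  have h2 : ((1 - s) / (1 + 10 * s)) * ∑ i, x i ≤ ∑ i, a i := by
    rw [Finset.mul_sum]
    refine Finset.sum_le_sum fun i _ => ?_
    have hd0 := N.del_nonneg i
    refine le_trans ?_ (hxa i (by have := hcm i; omega) (by linarith [hdel i]))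
    rw [mul_comm]
    refine mul_le_mul_of_nonneg_left ?_ (hx i)
    have := hinv i
    have := hdel i
    exact div_le_div₀ (by linarith) (by linarith) (by linarith) (by linarith)
  -- After multiplying out, the constant and linear terms agree on both sides and the remaining
  -- terms have the right sign.
  have h3 : (1 - 12 * s) * (1 + s) ≤ (1 - s) / (1 + 10 * s) := by
    rw [le_div_iff₀ (by linarith)]
    nlinarith [mul_nonneg hs0 hs0, mul_nonneg hs0 (mul_nonneg hs0 hs0)]
  rw [hloss] at hl ⊢
  calc (1 - 1 / Real.exp 1 - 12 * s) * V ≤ (1 - 12 * s) * ((1 - 1 / Real.exp 1) * V) := by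
        have := mul_nonneg (mul_nonneg hs0 he.le) hV
        nlinarith
    _ ≤ (1 - 12 * s) * ((1 + s) * ∑ i, x i) := mul_le_mul_of_nonneg_left h1 (by linarith)
    _ = ((1 - 12 * s) * (1 + s)) * ∑ i, x i := by ring
    _ ≤ ((1 - s) / (1 + 10 * s)) * ∑ i, x i := mul_le_mul_of_nonneg_right h3 hX
    _ ≤ ∑ i, a i := h2

end Network

theorem sum_measureReal_le_one {Ω β : Type} [MeasurableSpace Ω] (P : Measure Ω)
    [IsProbabilityMeasure P] [Fintype β] (A : β → Set Ω) (hA : ∀ b, MeasurableSet (A b))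
    (hd : Pairwise fun b b' => Disjoint (A b) (A b')) : ∑ b, P.real (A b) ≤ 1 := by
  rw [← measureReal_biUnion_finset (fun b _ b' _ h => hd h) fun b _ => hA b]
  exact measureReal_le_one

theorem lintegral_finite_cases {Ω β : Type} [MeasurableSpace Ω] (P : Measure Ω) [Fintype β]
    (f : Ω → β) (hf : ∀ b, MeasurableSet {ω | f ω = b}) (g : β → ℝ≥0∞) :
    ∫⁻ ω, g (f ω) ∂P = ∑ b, g b * P {ω | f ω = b} := by
  classical
  have h : ∀ ω, g (f ω) = ∑ b, {ω | f ω = b}.indicator (fun _ => g b) ω := fun ω => by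
    simp [Set.indicator_apply]
  simp only [h]
  rw [lintegral_finsetSum _ fun b _ => measurable_const.indicator (hf b)]
  exact Finset.sum_congr rfl fun b _ => lintegral_indicator_const (hf b) _

/-! ### Matching: policies and ALG as allocation processes -/

namespace Network

variable {I : Type} {T : ℕ}

theorem pi_usage_eval [Fintype I] (N : Network I T) (i : I) {B : Set ℝ≥0∞}
    (hB : MeasurableSet B) : Measure.pi N.usage {d | d i ∈ B} = N.usage i B :=
  (measurePreserving_eval N.usage i).measure_preimage hB.nullMeasurableSet

instance [Fintype I] (N : Network I T) : IsProbabilityMeasure N.durationLaw := by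
  unfold durationLaw; infer_instance

instance [Fintype I] (N : Network I T) : IsProbabilityMeasure N.law := by
  unfold law; infer_instance

section Matching

variable [Fintype I]

/-- Nonanticipation refers to the policy's own past allocations; strong induction over arrivals
reduces it to dependence on earlier durations. -/
theorem Policy.assign_congr [DecidableEq I] {N : Network I T} (π : N.Policy) {ω ω' : Sample I T}
    (h : ω.1 = ω'.1) (t : Fin T) (hd : ∀ τ < t, ω.2 τ = ω'.2 τ) :
    π.assign t ω = π.assign t ω' := by
  induction t using WellFoundedLT.induction with
  | ind t ih =>
    refine π.nonanticipating t ω ω' h fun τ hτ => ⟨ih τ hτ fun σ hσ => hd σ (hσ.trans hτ), ?_⟩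
    intro i _ _
    rw [hd τ hτ]

/-- Only the durations of arrival `t` are resampled: a policy may use all its internal random
numbers at any time. Its decision is then fixed given `ω`, so the conditional probability is an
indicator. -/
theorem Policy.onlineRun [DecidableEq I] {N : Network I T} (π : N.Policy) :
    N.OnlineRun N.law ((Measure.dirac ()).prod (Measure.pi N.usage))
      (fun t q => (q.1.1, Function.update q.1.2 t q.2.2)) (fun ω => ω.2) π.assign
      (fun t i ω => {ω | π.assign t ω = some i}.indicator 1 ω) where
  resample t := measurePreserving_resample_prod (f := Prod.fst)
    (g := fun q => Function.update q.1 t q.2) measurePreserving_fst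
    (measurePreserving_update (fun _ => Measure.pi N.usage) t)
  measurable_dur t i := by fun_prop
  measurableSet_alloc := π.measurable_assign
  measurable_cond t i := measurable_one.indicator (π.measurable_assign t i)
  alloc_past t τ h ω v := π.assign_congr (ω' := ω) (ω := (ω.1, Function.update ω.2 t v.2)) rfl
    τ fun σ hσ => Function.update_of_ne (hσ.trans h).ne _ _
  dur_past t τ h ω v := Function.update_of_ne h.ne _ _
  cond t i ω B hB := by
    have h : ∀ v : Unit × (I → ℝ≥0∞),
        π.assign t (ω.1, Function.update ω.2 t v.2) = π.assign t ω := fun v =>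
      π.assign_congr (ω' := ω) (ω := (ω.1, Function.update ω.2 t v.2)) rfl t
        fun σ hσ => Function.update_of_ne hσ.ne _ _
    simp only [h, Function.update_self]
    by_cases hi : π.assign t ω = some i
    · have e : {v : Unit × (I → ℝ≥0∞) | π.assign t ω = some i ∧ v.2 i ∈ B} =
          Set.univ ×ˢ {d | d i ∈ B} := by
        ext v
        simp [hi]
      rw [e, Measure.prod_prod, measure_univ, N.pi_usage_eval i hB]
      simp [hi]
    · simp [hi]

variable [LinearOrder I]

theorem alg_eq (N : Network I T) (sel : Fin T → ArgmaxRule I) (ω : Sample I T) (t : Fin T) :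
    N.alg sel ω t =
      (pick (((N.nbr t).sort (· ≤ ·)).map fun i => (i, N.galgX sel t i / (1 + N.del i)))
        (ω.1 t)).bind
      fun i => if N.inUse (N.alg sel ω) ω.2 t i < N.cap i then some i else none := by
  unfold alg
  rw [playout_eq]
  congr 1
  funext i
  rw [N.inUse_congr (fun τ hτ => playout_past _ _ hτ) (fun _ _ => rfl)]

theorem alg_congr (N : Network I T) (sel : Fin T → ArgmaxRule I) {ω ω' : Sample I T} (t : Fin T)
    (h : ∀ τ ≤ t, ω.1 τ = ω'.1 τ) (hd : ∀ τ < t, ω.2 τ = ω'.2 τ) :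
    N.alg sel ω t = N.alg sel ω' t := by
  induction t using WellFoundedLT.induction with
  | ind t ih =>
    rw [alg_eq, alg_eq, h t le_rfl]
    congr 1
    funext i
    rw [N.inUse_congr (fun τ hτ => ih τ hτ (fun σ hσ => h σ (hσ.trans hτ.le))
      fun σ hσ => hd σ (hσ.trans hτ)) hd]

theorem measurableSet_alg (N : Network I T) (sel : Fin T → ArgmaxRule I) (t : Fin T)
    (o : Option I) : MeasurableSet {ω | N.alg sel ω t = o} := by
  refine measurableSet_playout none _ (fun t X o => ?_) T t o
  refine measurableSet_bind _ _ (fun a => ?_) (fun i o => ?_) o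
  · have hm : Measurable fun ω : Sample I T => ω.1 t := by fun_prop
    exact hm (measurableSet_pick _ a)
  · have hm : Measurable fun ω : Sample I T => N.inUse X ω.2 t i :=
      N.measurable_inUse (fun _ => X) (fun ω : Sample I T => ω.2) t i
        (fun _ => MeasurableSet.const _) fun τ => by fun_prop
    have hlt : MeasurableSet {ω : Sample I T | N.inUse X ω.2 t i < N.cap i} :=
      measurableSet_lt hm measurable_const
    have : {ω : Sample I T | (if N.inUse X ω.2 t i < N.cap i then some i else none) = o} =
        ({ω | N.inUse X ω.2 t i < N.cap i} ∩ {_ω | some i = o}) ∪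
        ({ω | N.inUse X ω.2 t i < N.cap i}ᶜ ∩ {_ω | none = o}) := by
      ext ω
      simp only [Set.mem_ofPred_eq, Set.mem_union, Set.mem_inter_iff, Set.mem_compl_iff]
      split_ifs with hc <;> simp [hc]
    rw [this]
    exact (hlt.inter (MeasurableSet.const _)).union (hlt.compl.inter (MeasurableSet.const _))

/-- ALG uses the number of arrival `t` only at `t`, so it is resampled as well. Whether a unit is
free depends on the past alone, and the fresh draw yields the conditional probability. -/
theorem algRun (N : Network I T) (sel : Fin T → ArgmaxRule I) :
    N.OnlineRun N.law (unif.prod (Measure.pi N.usage))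
      (fun t q => (Function.update q.1.1 t q.2.1, Function.update q.1.2 t q.2.2))
      (fun ω => ω.2) (fun t ω => N.alg sel ω t)
      (fun t i ω => if N.inUse (fun τ => N.alg sel ω τ) ω.2 t i < N.cap i then
        ENNReal.ofReal (N.galgX sel t i / (1 + N.del i)) else 0) where
  resample t := measurePreserving_resample_prod (f := fun q => Function.update q.1 t q.2)
    (g := fun q => Function.update q.1 t q.2) (measurePreserving_update (fun _ => unif) t)
    (measurePreserving_update (fun _ => Measure.pi N.usage) t)
  measurable_dur t i := by fun_prop
  measurableSet_alloc t i := N.measurableSet_alg sel t (some i)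
  measurable_cond t i := Measurable.ite (measurableSet_lt
      (N.measurable_inUse (fun ω => N.alg sel ω) (fun ω => ω.2) t i
        (fun τ => N.measurableSet_alg sel τ (some i)) fun τ => by fun_prop) measurable_const)
      measurable_const measurable_const
  alloc_past t τ h ω v := N.alg_congr sel τ
    (fun σ hσ => Function.update_of_ne (hσ.trans_lt h).ne _ _)
    (fun σ hσ => Function.update_of_ne (hσ.trans h).ne _ _)
  dur_past t τ h ω v := Function.update_of_ne h.ne _ _
  cond t i ω B hB := by
    set w := fun i => N.galgX sel t i / (1 + N.del i) with hw
    have hw0 : ∀ i, 0 ≤ w i := fun i =>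
      div_nonneg (N.galgX_nonneg sel t i) (by linarith [N.del_nonneg i])
    have hw1 : ∑ i ∈ N.nbr t, w i ≤ 1 := by
      refine le_trans (Finset.sum_le_sum fun i _ => ?_) ((Finset.sum_le_univ_sum_of_nonneg
        fun i => N.galgX_nonneg sel t i).trans (N.sum_galgX_le sel t))
      exact div_le_self (N.galgX_nonneg sel t i) (by linarith [N.del_nonneg i])
    have hpast : ∀ v : ℝ × (I → ℝ≥0∞), ∀ τ < t,
        N.alg sel (Function.update ω.1 t v.1, Function.update ω.2 t v.2) τ = N.alg sel ω τ :=
      fun v τ hτ => N.alg_congr sel τ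
        (fun σ hσ => Function.update_of_ne (hσ.trans_lt hτ).ne _ _)
        (fun σ hσ => Function.update_of_ne (hσ.trans hτ).ne _ _)
    have halg : ∀ v : ℝ × (I → ℝ≥0∞),
        N.alg sel (Function.update ω.1 t v.1, Function.update ω.2 t v.2) t =
        (pick (((N.nbr t).sort (· ≤ ·)).map fun i => (i, w i)) v.1).bind
          fun i => if N.inUse (N.alg sel ω) ω.2 t i < N.cap i then some i else none := by
      intro v
      rw [alg_eq]
      simp only [Function.update_self]
      congr 1
      funext i
      rw [N.inUse_congr (hpast v) fun σ hσ => Function.update_of_ne hσ.ne _ _]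
    simp only [halg, Function.update_self]
    have e : {v : ℝ × (I → ℝ≥0∞) |
        (pick (((N.nbr t).sort (· ≤ ·)).map fun i => (i, w i)) v.1).bind
          (fun i => if N.inUse (N.alg sel ω) ω.2 t i < N.cap i then some i else none) = some i ∧
          v.2 i ∈ B} =
        {u | pick (((N.nbr t).sort (· ≤ ·)).map fun i => (i, w i)) u = some i ∧
          N.inUse (N.alg sel ω) ω.2 t i < N.cap i} ×ˢ {d | d i ∈ B} := by
      ext v
      simp only [Set.mem_ofPred_eq, Set.mem_prod, Option.bind_eq_some_iff,
        Option.ite_none_right_eq_some, Option.some.injEq]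
      constructor
      · rintro ⟨⟨j, h1, h2, rfl⟩, h3⟩
        exact ⟨⟨h1, h2⟩, h3⟩
      · rintro ⟨⟨h1, h2⟩, h3⟩
        exact ⟨⟨i, h1, h2, rfl⟩, h3⟩
    rw [e, Measure.prod_prod, N.pi_usage_eval i hB]
    congr 1
    by_cases ha : N.inUse (N.alg sel ω) ω.2 t i < N.cap i
    · simp only [ha, and_true, if_true]
      rw [unif_pick_sort _ w hw0 hw1 i]
      split_ifs with hi
      · rfl
      · simp [N.galgX_off sel t i hi]
    · simp [ha]

/-- The guarantee for matching. -/
theorem competitive_alg [Nonempty I] (N : Network I T) (sel : Fin T → ArgmaxRule I)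
    (π : N.Policy) : (1 - 1 / Real.exp 1 - loss N.cmin) * π.value ≤ N.algValue sel := by
  have hπ := π.onlineRun
  have hA := N.algRun sel
  have e1 : π.value = _ := hπ.integral_totalReward
  have e2 : N.algValue sel = _ := hA.integral_totalReward
  rw [e1, e2]
  refine N.competitive _ (fun i => N.meanRew i * ∑ t, N.galgX sel t i) _
    (Finset.sum_nonneg fun i _ => mul_nonneg (N.meanRew_nonneg i)
      (Finset.sum_nonneg fun t _ => measureReal_nonneg))
    (fun i => mul_nonneg (N.meanRew_nonneg i) (Finset.sum_nonneg fun t _ => N.galgX_nonneg sel t i))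
    (fun i => mul_nonneg (N.meanRew_nonneg i) (Finset.sum_nonneg fun t _ => measureReal_nonneg))
    ?_ ?_
  · refine N.galg_bound sel (fun t i => N.law.real {ω | π.assign t ω = some i})
      (fun t i => measureReal_nonneg) ?_ ?_ (hπ.fluid_capacity fun t i ω => π.available t ω i)
    · intro t i hi
      have : {ω | π.assign t ω = some i} = ∅ :=
        Set.eq_empty_of_forall_notMem fun ω hω => hi (π.adjacent t ω i hω)
      simp [this]
    · intro t
      refine sum_measureReal_le_one _ _ (π.measurable_assign t) fun i j hij => ?_
      refine Set.disjoint_left.2 fun ω hi hj => hij ?_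
      exact Option.some.inj ((Eq.symm hi).trans hj)
  · intro i hc hd
    rw [mul_assoc, Finset.sum_mul]
    refine mul_le_mul_of_nonneg_left (Finset.sum_le_sum fun t _ => ?_) (N.meanRew_nonneg i)
    refine le_trans (le_of_eq ?_) (hA.measureReal_ge (N.galgX_nonneg sel) i (fun t =>
      N.sum_surv_le_cap (N.galg sel) t i (N.fluidAvail_galg_nonneg sel t i)) hc hd t)
    ring

end Matching

end Network

theorem exists_mem_of_pick {α : Type} {l : List (α × ℝ)} {u : ℝ} {a : α}
    (h : pick l u = some a) : ∃ q ∈ l, q.1 = a := by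
  induction l generalizing u with
  | nil => simp [pick] at h
  | cons q l ih =>
    rw [pick] at h
    split_ifs at h
    · exact ⟨q, List.mem_cons_self, Option.some.inj h⟩
    · obtain ⟨q', hq', e⟩ := ih h
      exact ⟨q', List.mem_cons_of_mem _ hq', e⟩

/-! ### Customer choice: policies and the assortment algorithm -/

namespace ChoiceNetwork

variable {I : Type} [Fintype I] {T : ℕ}

instance (N : ChoiceNetwork I T) : IsProbabilityMeasure N.law := by
  unfold law; infer_instance

variable [LinearOrder I]

theorem mem_of_chosen (N : ChoiceNetwork I T) {t : Fin T} {S : Finset I} {w : ℝ} {i : I}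
    (h : N.chosen t S w = some i) : i ∈ S := by
  obtain ⟨q, hq, rfl⟩ := exists_mem_of_pick h
  obtain ⟨j, hj, rfl⟩ := List.mem_map.1 hq
  simpa using hj

theorem measurableSet_chosen (N : ChoiceNetwork I T) (t : Fin T) (S : Finset I) (o : Option I) :
    MeasurableSet {w | N.chosen t S w = o} := measurableSet_pick _ o

theorem unif_chosen (N : ChoiceNetwork I T) (t : Fin T) (S : Finset I) (i : I) :
    unif {w | N.chosen t S w = some i} = ENNReal.ofReal (N.choice t S i) := by
  refine (unif_pick_sort S (N.choice t S) (N.choice_nonneg t S) (N.choice_sum t S) i).trans ?_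
  split_ifs with hi
  · rfl
  · simp [N.choice_off t S i hi]

/-- Resource chosen at an arrival under a policy. -/
noncomputable def Policy.alloc {N : ChoiceNetwork I T} (π : N.Policy) (t : Fin T) (ω : Sample I T) :
    Option I := N.chosen t (π.offer t ω) (ω.2.1 t)

theorem Policy.offer_congr {N : ChoiceNetwork I T} (π : N.Policy) {ω ω' : Sample I T}
    (h : ω.1 = ω'.1) (t : Fin T) (hw : ∀ τ < t, ω.2.1 τ = ω'.2.1 τ)
    (hd : ∀ τ < t, ω.2.2 τ = ω'.2.2 τ) : π.offer t ω = π.offer t ω' := by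
  induction t using WellFoundedLT.induction with
  | ind t ih =>
    refine π.nonanticipating t ω ω' h fun τ hτ => ⟨?_, ?_⟩
    · dsimp only
      rw [ih τ hτ (fun σ hσ => hw σ (hσ.trans hτ)) (fun σ hσ => hd σ (hσ.trans hτ)), hw τ hτ]
    · intro i _ _
      rw [hd τ hτ]

theorem Policy.onlineRun {N : ChoiceNetwork I T} (π : N.Policy) :
    N.toNetwork.OnlineRun N.law ((Measure.dirac ()).prod (unif.prod (Measure.pi N.usage)))
      (fun t q => (q.1.1, (Function.update q.1.2.1 t q.2.2.1, Function.update q.1.2.2 t q.2.2.2)))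
      (fun ω => ω.2.2) π.alloc
      (fun t i ω => ENNReal.ofReal (N.choice t (π.offer t ω) i)) where
  resample t := by
    have h := measurePreserving_resample_prod (measurePreserving_update (fun _ => unif) t)
      (measurePreserving_update (fun _ => Measure.pi N.usage) t)
    exact measurePreserving_resample_prod (f := Prod.fst) measurePreserving_fst h
  measurable_dur t i := by fun_prop
  measurableSet_alloc t i := by
    refine measurableSet_finite_cases (π.offer t) (π.measurable_offer t)
      (fun S => {ω | N.chosen t S (ω.2.1 t) = some i}) fun S => ?_
    have hm : Measurable fun ω : Sample I T => ω.2.1 t := by fun_prop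
    exact hm (N.measurableSet_chosen t S _)
  measurable_cond t i := by
    intro B _
    exact measurableSet_finite_cases (π.offer t) (π.measurable_offer t)
      (fun S => {_ω | ENNReal.ofReal (N.choice t S i) ∈ B}) fun S => MeasurableSet.const _
  alloc_past t τ h ω v := by
    unfold Policy.alloc
    dsimp only
    rw [π.offer_congr (ω' := ω)
        (ω := (ω.1, (Function.update ω.2.1 t v.2.1, Function.update ω.2.2 t v.2.2))) rfl τ
      (fun σ hσ => Function.update_of_ne (hσ.trans h).ne _ _)
      (fun σ hσ => Function.update_of_ne (hσ.trans h).ne _ _)]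
    simp only [Function.update_of_ne h.ne]
  dur_past t τ h ω v := Function.update_of_ne h.ne _ _
  cond t i ω B hB := by
    have h : ∀ v : Unit × (ℝ × (I → ℝ≥0∞)), π.alloc t
        (ω.1, (Function.update ω.2.1 t v.2.1, Function.update ω.2.2 t v.2.2)) =
        N.chosen t (π.offer t ω) v.2.1 := by
      intro v
      unfold Policy.alloc
      rw [π.offer_congr (ω' := ω)
        (ω := (ω.1, (Function.update ω.2.1 t v.2.1, Function.update ω.2.2 t v.2.2))) rfl t
      (fun σ hσ => Function.update_of_ne hσ.ne _ _)
        (fun σ hσ => Function.update_of_ne hσ.ne _ _)]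
      simp only [Function.update_self]
    simp only [h, Function.update_self]
    have e : {v : Unit × (ℝ × (I → ℝ≥0∞)) | N.chosen t (π.offer t ω) v.2.1 = some i ∧
        v.2.2 i ∈ B} = Set.univ ×ˢ ({w | N.chosen t (π.offer t ω) w = some i} ×ˢ
          {d | d i ∈ B}) := by
      ext v
      simp
    rw [e, Measure.prod_prod, measure_univ, one_mul, Measure.prod_prod, N.pi_usage_eval i hB,
      unif_chosen]

/-- Adjacent resources with an available unit at an arrival. -/
noncomputable def availSet (N : ChoiceNetwork I T) (X : Fin T → Option I) (d : Fin T → I → ℝ≥0∞)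
    (t : Fin T) : Finset I := (N.nbr t).filter (fun i => N.inUse X d t i < N.cap i)

/-- Decision of the assortment algorithm, as a function of the available resources, its two
uniform numbers and the uniform number of the customer. -/
noncomputable def draw (N : ChoiceNetwork I T) (orc : N.Oracle) (sel : Fin T → ArgmaxRule I)
    (t : Fin T) (S : Finset I) (u : ℝ × ℝ) (w : ℝ) : Option I :=
  (pick (N.galg orc t).menu u.1).bind fun A =>
    (pick (probMatch (sel t) (N.choice t) (A ∩ S)
      (fun s => N.choice t A s / (1 + N.del s))) u.2).bind fun B => N.chosen t B w

theorem alg_eq (N : ChoiceNetwork I T) (orc : N.Oracle) (sel : Fin T → ArgmaxRule I)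
    (ω : Sample I T) (t : Fin T) :
    N.alg orc sel ω t =
      N.draw orc sel t (N.availSet (N.alg orc sel ω) ω.2.2 t) (ω.1 t) (ω.2.1 t) := by
  have h : N.availSet (playout none _ t.val) ω.2.2 t =
      N.availSet (N.alg orc sel ω) ω.2.2 t := Finset.filter_congr fun i _ => by
    rw [N.inUse_congr (fun τ hτ => playout_past _ _ hτ) (fun _ _ => rfl)]
    rfl
  rw [← h]
  unfold alg
  rw [playout_eq]
  rfl

theorem alg_congr (N : ChoiceNetwork I T) (orc : N.Oracle) (sel : Fin T → ArgmaxRule I)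
    {ω ω' : Sample I T} (t : Fin T) (h : ∀ τ ≤ t, ω.1 τ = ω'.1 τ)
    (hw : ∀ τ ≤ t, ω.2.1 τ = ω'.2.1 τ) (hd : ∀ τ < t, ω.2.2 τ = ω'.2.2 τ) :
    N.alg orc sel ω t = N.alg orc sel ω' t := by
  induction t using WellFoundedLT.induction with
  | ind t ih =>
    rw [alg_eq, alg_eq, h t le_rfl, hw t le_rfl]
    congr 1
    refine Finset.filter_congr fun i _ => ?_
    rw [N.inUse_congr (fun τ hτ => ih τ hτ (fun σ hσ => h σ (hσ.trans hτ.le))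
      (fun σ hσ => hw σ (hσ.trans hτ.le)) fun σ hσ => hd σ (hσ.trans hτ)) hd]

theorem measurableSet_draw (N : ChoiceNetwork I T) (orc : N.Oracle) (sel : Fin T → ArgmaxRule I)
    (t : Fin T) (S : Finset I) (o : Option I) :
    MeasurableSet {q : (ℝ × ℝ) × ℝ | N.draw orc sel t S q.1 q.2 = o} := by
  refine measurableSet_bind _ _ (fun A => ?_) (fun A o => ?_) o
  · exact (by fun_prop : Measurable fun q : (ℝ × ℝ) × ℝ => q.1.1) (measurableSet_pick _ A)
  refine measurableSet_bind _ _ (fun B => ?_) (fun B o => ?_) o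
  · exact (by fun_prop : Measurable fun q : (ℝ × ℝ) × ℝ => q.1.2) (measurableSet_pick _ B)
  · exact (by fun_prop : Measurable fun q : (ℝ × ℝ) × ℝ => q.2) (N.measurableSet_chosen t B o)

theorem measurableSet_availSet (N : ChoiceNetwork I T) (X : Sample I T → Fin T → Option I)
    (hX : ∀ τ i, MeasurableSet {ω | X ω τ = some i}) (t : Fin T) (S : Finset I) :
    MeasurableSet {ω : Sample I T | N.availSet (X ω) ω.2.2 t = S} := by
  have : {ω : Sample I T | N.availSet (X ω) ω.2.2 t = S} =
      ⋂ i, {ω | N.inUse (X ω) ω.2.2 t i ∈ {n | (i ∈ N.nbr t ∧ n < N.cap i) ↔ i ∈ S}} := by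
    ext ω
    simp [availSet, Finset.ext_iff]
  rw [this]
  exact MeasurableSet.iInter fun i => N.measurable_inUse X (fun ω => ω.2.2) t i
    (fun τ => hX τ i) (fun τ => by fun_prop) trivial

theorem measurableSet_alg (N : ChoiceNetwork I T) (orc : N.Oracle) (sel : Fin T → ArgmaxRule I)
    (t : Fin T) (o : Option I) : MeasurableSet {ω | N.alg orc sel ω t = o} := by
  refine measurableSet_playout none _ (fun t X o => ?_) T t o
  refine measurableSet_finite_cases (fun ω : Sample I T => N.availSet X ω.2.2 t)
    (N.measurableSet_availSet (fun _ => X) (fun _ _ => MeasurableSet.const _) t)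
    (fun S => {ω | N.draw orc sel t S (ω.1 t) (ω.2.1 t) = o}) fun S => ?_
  exact (by fun_prop : Measurable fun ω : Sample I T => (ω.1 t, ω.2.1 t))
    (N.measurableSet_draw orc sel t S o)

/-- Conditional probability with which the assortment algorithm allocates a resource. -/
theorem measure_draw (N : ChoiceNetwork I T) (orc : N.Oracle) (sel : Fin T → ArgmaxRule I)
    (t : Fin T) (S : Finset I) (i : I) :
    ((unif.prod unif).prod unif) {q | N.draw orc sel t S q.1 q.2 = some i} =
      if i ∈ S then ENNReal.ofReal (N.galgX orc t i / (1 + N.del i)) else 0 := by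
  have hinv := N.loopInv_galg orc t
  have hd : ∀ s, 0 < 1 + N.del s := fun s => by linarith [N.toNetwork.del_nonneg s]
  set pm := fun A : Finset I => probMatch (sel t) (N.choice t) (A ∩ S)
      (fun s => N.choice t A s / (1 + N.del s)) with hpm
  have hspec : ∀ A : Finset I, (∀ j ∈ A, 0 < N.choice t A j) →
      (∀ q ∈ pm A, 0 ≤ q.2) ∧ ((pm A).map Prod.snd).sum ≤ 1 ∧
      ∀ s, ((pm A).map fun q => q.2 * N.choice t q.1 s).sum =
        if s ∈ A ∩ S then N.choice t A s / (1 + N.del s) else 0 := fun A hA =>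
    probMatch_spec (sel t) (N.choice t) (N.choice_off t) (N.choice_subst t) A (A ∩ S)
      Finset.inter_subset_left _ (fun s _ => div_nonneg (N.choice_nonneg t A s) (hd s).le) hA
      fun s _ => div_le_self (N.choice_nonneg t A s) (by linarith [N.toNetwork.del_nonneg s])
  have hsum : ∀ (l : List (Finset I × ℝ)), (∀ q ∈ l, 0 ≤ q.2) →
      (l.map fun q => ENNReal.ofReal q.2 * ENNReal.ofReal (N.choice t q.1 i)).sum =
        ENNReal.ofReal (l.map fun q => q.2 * N.choice t q.1 i).sum := by
    intro l hl
    induction l with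
    | nil => simp
    | cons q l ih =>
      have hl' : ∀ q ∈ l, 0 ≤ q.2 := fun q hq => hl q (List.mem_cons_of_mem _ hq)
      simp only [List.map_cons, List.sum_cons]
      rw [ih hl', ENNReal.ofReal_add, ENNReal.ofReal_mul (hl q List.mem_cons_self)]
      · exact mul_nonneg (hl q List.mem_cons_self) (N.choice_nonneg t q.1 i)
      · refine List.sum_nonneg fun x hx => ?_
        obtain ⟨b, hb, rfl⟩ := List.mem_map.1 hx
        exact mul_nonneg (hl' b hb) (N.choice_nonneg t b.1 i)
  -- Integrate from the inside out: the customer's choice, then the draw from probability matching,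
  -- then the draw from the menu.
  have hfib : ∀ u : ℝ × ℝ, unif {w | N.draw orc sel t S u w = some i} =
      (pick (N.galg orc t).menu u.1).elim 0 fun A => (pick (pm A) u.2).elim 0 fun B =>
        ENNReal.ofReal (N.choice t B i) := by
    intro u
    simp only [draw]
    cases pick (N.galg orc t).menu u.1 with
    | none => simp
    | some A =>
      simp only [Option.bind_some, Option.elim_some]
      change unif {w | (pick (pm A) u.2).bind (fun B => N.chosen t B w) = some i} = _
      cases pick (pm A) u.2 with
      | none => simp
      | some B => exact N.unif_chosen t B i
  have hmeas : Measurable fun u : ℝ × ℝ => unif {w | N.draw orc sel t S u w = some i} :=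
    measurable_measure_prodMk_left (N.measurableSet_draw orc sel t S (some i))
  rw [Measure.prod_apply (N.measurableSet_draw orc sel t S (some i))]
  change ∫⁻ u, unif {w | N.draw orc sel t S u w = some i} ∂(unif.prod unif) = _
  rw [lintegral_prod _ hmeas.aemeasurable]
  simp only [hfib]
  have hin : ∀ u : ℝ, ∫⁻ u', ((pick (N.galg orc t).menu u).elim 0 fun A =>
      (pick (pm A) u').elim 0 fun B => ENNReal.ofReal (N.choice t B i)) ∂unif =
      (pick (N.galg orc t).menu u).elim 0 fun A =>
        ∫⁻ u', ((pick (pm A) u').elim 0 fun B => ENNReal.ofReal (N.choice t B i)) ∂unif := by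
    intro u
    cases pick (N.galg orc t).menu u <;> simp
  simp only [hin]
  rw [lintegral_pick _ hinv.menu_nonneg _ (hinv.sum_menu.le.trans hinv.eta_le)]
  -- Probability matching attains its targets exactly, so an available `i` gets φ(A, i) / (1 + δ)
  -- whichever other resources are free. Summed over the menu this is the fluid fraction over 1 + δ,
  -- by `sum_frac`.
  have hterm : ∀ q ∈ (N.galg orc t).menu, ENNReal.ofReal q.2 *
      ∫⁻ u', ((pick (pm q.1) u').elim 0 fun B => ENNReal.ofReal (N.choice t B i)) ∂unif =
      ENNReal.ofReal q.2 * ENNReal.ofReal (N.choice t q.1 i) *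
        if i ∈ S then ENNReal.ofReal (1 / (1 + N.del i)) else 0 := by
    intro q hq
    obtain ⟨h1, h2, h3⟩ := hspec q.1 (hinv.menu_pos q hq)
    rw [lintegral_pick _ h1 _ h2, hsum _ h1, h3 i, mul_assoc]
    congr 1
    by_cases hiS : i ∈ S
    · by_cases hiA : i ∈ q.1
      · rw [if_pos (Finset.mem_inter.2 ⟨hiA, hiS⟩), if_pos hiS,
          ← ENNReal.ofReal_mul (N.choice_nonneg t q.1 i), mul_one_div]
      · rw [if_neg fun h => hiA (Finset.mem_inter.1 h).1, N.choice_off t q.1 i hiA]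
        simp
    · rw [if_neg fun h => hiS (Finset.mem_inter.1 h).2, if_neg hiS]
      simp
  rw [List.map_congr_left hterm, List.sum_map_mul_right, hsum _ hinv.menu_nonneg,
    ← hinv.sum_frac i]
  split_ifs with hiS
  · rw [← ENNReal.ofReal_mul, mul_one_div]
    · rfl
    · exact Finset.sum_nonneg fun k _ => hinv.frac_nonneg i k
  · rw [mul_zero]

theorem galgX_off (N : ChoiceNetwork I T) (orc : N.Oracle) (t : Fin T) (i : I)
    (hi : i ∉ N.nbr t) : N.galgX orc t i = 0 := by
  have hinv := N.loopInv_galg orc t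
  refine (hinv.sum_frac i).trans (List.sum_eq_zero fun x hx => ?_)
  obtain ⟨q, hq, rfl⟩ := List.mem_map.1 hx
  rw [N.choice_off t q.1 i fun h => hi (hinv.menu_subset q hq h), mul_zero]

theorem algRun (N : ChoiceNetwork I T) (orc : N.Oracle) (sel : Fin T → ArgmaxRule I) :
    N.toNetwork.OnlineRun N.law ((unif.prod unif).prod (unif.prod (Measure.pi N.usage)))
      (fun t q => (Function.update q.1.1 t q.2.1,
        (Function.update q.1.2.1 t q.2.2.1, Function.update q.1.2.2 t q.2.2.2)))
      (fun ω => ω.2.2) (fun t ω => N.alg orc sel ω t)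
      (fun t i ω => if N.inUse (fun τ => N.alg orc sel ω τ) ω.2.2 t i < N.cap i then
        ENNReal.ofReal (N.galgX orc t i / (1 + N.del i)) else 0) where
  resample t := by
    have h := measurePreserving_resample_prod (measurePreserving_update (fun _ => unif) t)
      (measurePreserving_update (fun _ => Measure.pi N.usage) t)
    exact measurePreserving_resample_prod
      (measurePreserving_update (fun _ => unif.prod unif) t) h
  measurable_dur t i := by fun_prop
  measurableSet_alloc t i := N.measurableSet_alg orc sel t (some i)
  measurable_cond t i := Measurable.ite (measurableSet_lt
      (N.measurable_inUse (fun ω => N.alg orc sel ω) (fun ω => ω.2.2) t i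
        (fun τ => N.measurableSet_alg orc sel τ (some i)) fun τ => by fun_prop) measurable_const)
      measurable_const measurable_const
  alloc_past t τ h ω v := N.alg_congr orc sel τ
    (fun σ hσ => Function.update_of_ne (hσ.trans_lt h).ne _ _)
    (fun σ hσ => Function.update_of_ne (hσ.trans_lt h).ne _ _)
    (fun σ hσ => Function.update_of_ne (hσ.trans h).ne _ _)
  dur_past t τ h ω v := Function.update_of_ne h.ne _ _
  cond t i ω B hB := by
    set S := N.availSet (N.alg orc sel ω) ω.2.2 t with hS
    have halg : ∀ v : (ℝ × ℝ) × (ℝ × (I → ℝ≥0∞)),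
        N.alg orc sel (Function.update ω.1 t v.1,
          (Function.update ω.2.1 t v.2.1, Function.update ω.2.2 t v.2.2)) t =
        N.draw orc sel t S v.1 v.2.1 := by
      intro v
      rw [alg_eq]
      simp only [Function.update_self]
      congr 1
      refine Finset.filter_congr fun i _ => ?_
      rw [N.inUse_congr (fun τ hτ => N.alg_congr orc sel τ
        (fun σ hσ => Function.update_of_ne (hσ.trans_lt hτ).ne _ _)
        (fun σ hσ => Function.update_of_ne (hσ.trans_lt hτ).ne _ _)
        (fun σ hσ => Function.update_of_ne (hσ.trans hτ).ne _ _))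
        fun σ hσ => Function.update_of_ne hσ.ne _ _]
    simp only [halg, Function.update_self]
    -- Regrouping puts the numbers that determine the allocation on one side and the durations on
    -- the other, so the event becomes a rectangle.
    rw [← (measurePreserving_prodAssoc (unif.prod unif) unif
      (Measure.pi N.usage)).measure_preimage_equiv]
    have e : MeasurableEquiv.prodAssoc ⁻¹' {v : (ℝ × ℝ) × (ℝ × (I → ℝ≥0∞)) |
        N.draw orc sel t S v.1 v.2.1 = some i ∧ v.2.2 i ∈ B} =
        {q : (ℝ × ℝ) × ℝ | N.draw orc sel t S q.1 q.2 = some i} ×ˢ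
          {d : I → ℝ≥0∞ | d i ∈ B} := rfl
    rw [e, Measure.prod_prod, N.pi_usage_eval i hB, measure_draw]
    congr 1
    by_cases hi : i ∈ N.nbr t
    · simp [hS, availSet, hi]
    · simp [N.galgX_off orc t i hi]

/-- The guarantee for assortments. -/
theorem competitive_alg [Nonempty I] (N : ChoiceNetwork I T) (orc : N.Oracle)
    (sel : Fin T → ArgmaxRule I) (π : N.Policy) :
    (1 - 1 / Real.exp 1 - loss N.cmin) * π.value ≤ N.algValue orc sel := by
  have hπ := π.onlineRun
  have hA := N.algRun orc sel
  have e1 : π.value = _ := hπ.integral_totalReward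
  have e2 : N.algValue orc sel = _ := hA.integral_totalReward
  rw [e1, e2]
  refine N.competitive _ (fun i => N.meanRew i * ∑ t, N.galgX orc t i) _
    (Finset.sum_nonneg fun i _ => mul_nonneg (N.meanRew_nonneg i)
      (Finset.sum_nonneg fun t _ => measureReal_nonneg))
    (fun i => mul_nonneg (N.meanRew_nonneg i) (Finset.sum_nonneg fun t _ => N.galgX_nonneg orc t i))
    (fun i => mul_nonneg (N.meanRew_nonneg i) (Finset.sum_nonneg fun t _ => measureReal_nonneg))
    ?_ ?_
  · refine N.galg_bound orc (fun t i => N.law.real {ω | π.alloc t ω = some i})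
      (fun t i => measureReal_nonneg) (fun t B => N.law.real {ω | π.offer t ω = B})
      (fun t B => measureReal_nonneg) (fun t => ?_) (fun t B hB => ?_) (fun t i => ?_)
      (hπ.fluid_capacity fun t i ω hi => ?_)
    · refine sum_measureReal_le_one _ _ (π.measurable_offer t) fun B C hBC => ?_
      exact Set.disjoint_left.2 fun ω hB hC => hBC ((Eq.symm hB).trans hC)
    · obtain ⟨ω, rfl⟩ : ∃ ω, π.offer t ω = B := by
        by_contra hne
        push Not at hne
        have : {ω | π.offer t ω = B} = ∅ := Set.eq_empty_of_forall_notMem hne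
        simp [this] at hB
      exact ⟨π.feasible t ω, π.adjacent t ω⟩
    · rw [measureReal_def, hπ.measure_alloc,
        lintegral_finite_cases _ (π.offer t) (π.measurable_offer t)
          fun B => ENNReal.ofReal (N.choice t B i),
        ENNReal.toReal_sum fun B _ => ENNReal.mul_ne_top ENNReal.ofReal_ne_top (measure_ne_top _ _)]
      refine Finset.sum_congr rfl fun B _ => ?_
      rw [ENNReal.toReal_mul, ENNReal.toReal_ofReal (N.choice_nonneg t B i), mul_comm]
      rfl
    · exact π.available t ω i (N.mem_of_chosen hi)
  · intro i hc hd
    rw [mul_assoc, Finset.sum_mul]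
    refine mul_le_mul_of_nonneg_left (Finset.sum_le_sum fun t _ => ?_) (N.meanRew_nonneg i)
    refine le_trans (le_of_eq ?_) (hA.measureReal_ge (N.galgX_nonneg orc) i (fun t =>
      N.sum_surv_le_cap (N.galgFrac orc) t i (N.fluidAvail_galgFrac_nonneg orc t i)) hc hd t)
    ring

end ChoiceNetwork

/-! ### Upper bound on the competitive ratio of online algorithms -/

/-- Total fill when the first `L` ranks are bounded by the harmonic sum and the remaining `m - L` by
1. -/
theorem sum_range_harmonic (m L : ℕ) (hL : L ≤ m) :
    ∑ j ∈ Finset.range L, ∑ k ∈ Finset.range (j + 1), (1 : ℝ) / ((m : ℝ) - k) + ((m : ℝ) - L) =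
      m - ((m : ℝ) - L) * ∑ k ∈ Finset.range L, (1 : ℝ) / ((m : ℝ) - k) := by
  induction L with
  | zero => simp
  | succ L ih =>
    have ih := ih (by omega)
    have h : (m : ℝ) - L ≠ 0 := sub_ne_zero.2 (by exact_mod_cast (by omega : m ≠ L))
    rw [Finset.sum_range_succ]
    rw [Finset.sum_range_succ (fun k : ℕ => (1 : ℝ) / ((m : ℝ) - k)) L]
    push_cast
    have : ((m : ℝ) - L) * (1 / ((m : ℝ) - L)) = 1 := by field_simp
    linear_combination ih + this

theorem log_le_sum_range (m L : ℕ) (hL : L ≤ m) :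
    Real.log (((m : ℝ) + 1) / ((m : ℝ) - L + 1)) ≤
      ∑ k ∈ Finset.range L, (1 : ℝ) / ((m : ℝ) - k) := by
  induction L with
  | zero =>
    have : (m : ℝ) + 1 ≠ 0 := by positivity
    simp [this]
  | succ L ih =>
    have ih := ih (by omega)
    have h : (0 : ℝ) < (m : ℝ) - L := sub_pos.2 (by exact_mod_cast (by omega : L < m))
    have hm : (0 : ℝ) < (m : ℝ) + 1 := by positivity
    rw [Finset.sum_range_succ]
    have e : ((m : ℝ) + 1) / ((m : ℝ) - (L + 1 : ℕ) + 1) =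
        ((m : ℝ) + 1) / ((m : ℝ) - L + 1) * (1 + 1 / ((m : ℝ) - L)) := by
      have h' : (m : ℝ) - (L + 1 : ℕ) + 1 = (m : ℝ) - L := by
        push_cast
        ring
      rw [h', one_add_div h.ne', div_mul_div_cancel₀ (by linarith)]
    rw [e, Real.log_mul (by positivity) (by positivity)]
    have : Real.log (1 + 1 / ((m : ℝ) - L)) ≤ 1 / ((m : ℝ) - L) := by
      have := Real.log_le_sub_one_of_pos (x := 1 + 1 / ((m : ℝ) - L)) (by positivity)
      linarith
    linarith

/-- The cut leaves l = ⌊m/e⌋ ranks with bound 1: the harmonic sum reaches about log(m/l) = 1 there,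
and the average fill 1 - (l/m) log(m/l) tends to 1 - 1/e. -/
theorem tendsto_threshold_bound :
    Tendsto (fun m : ℕ => 1 - (⌊(1 / Real.exp 1) * (m : ℝ)⌋₊ : ℝ) / m *
      Real.log (((m : ℝ) + 1) / ((⌊(1 / Real.exp 1) * (m : ℝ)⌋₊ : ℝ) + 1))) atTop
      (𝓝 (1 - 1 / Real.exp 1)) := by
  have he : (0 : ℝ) < 1 / Real.exp 1 := by positivity
  have h1 : Tendsto (fun m : ℕ => (⌊(1 / Real.exp 1) * (m : ℝ)⌋₊ : ℝ) / m) atTop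
      (𝓝 (1 / Real.exp 1)) :=
    (tendsto_nat_floor_mul_div_atTop he.le).comp tendsto_natCast_atTop_atTop
  have h2 : Tendsto (fun m : ℕ => (1 : ℝ) / m) atTop (𝓝 0) := tendsto_one_div_atTop_nhds_zero_nat
  have h3 : Tendsto (fun m : ℕ => ((m : ℝ) + 1) / ((⌊(1 / Real.exp 1) * (m : ℝ)⌋₊ : ℝ) + 1)) atTop
      (𝓝 ((1 + 0) / (1 / Real.exp 1 + 0))) := by
    refine (((tendsto_const_nhds (x := (1 : ℝ))).add h2).div (h1.add h2) (by simp)).congr' ?_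
    filter_upwards [eventually_gt_atTop 0] with m hm
    have : (0 : ℝ) < m := by exact_mod_cast hm
    simp only [Pi.div_apply]
    rw [← add_div, one_add_div this.ne', div_div_div_cancel_right₀ this.ne']
  have h4 := h3.log (by simp)
  have h5 := (h1.mul h4).const_sub 1
  simpa using h5

theorem exists_harmonic_bound {ε : ℝ} (hε : 0 < ε) :
    ∃ n : ℕ, ∀ a : ℕ → ℝ,
      (∀ j < n + 1, a j ≤ 1 ∧ a j ≤ ∑ k ∈ Finset.range (j + 1), (1 : ℝ) / (((n + 1 : ℕ) : ℝ) - k)) →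
      ∑ j ∈ Finset.range (n + 1), a j ≤ (1 - 1 / Real.exp 1 + ε) * ((n + 1 : ℕ) : ℝ) := by
  have hev := tendsto_threshold_bound.eventually_le_const
    (show 1 - 1 / Real.exp 1 < 1 - 1 / Real.exp 1 + ε by linarith)
  obtain ⟨m, hm, hm0⟩ := (hev.and (eventually_gt_atTop 0)).exists
  obtain ⟨n, rfl⟩ : ∃ n, m = n + 1 := ⟨m - 1, by omega⟩
  refine ⟨n, fun a ha => ?_⟩
  have hmpos : (0 : ℝ) < ((n + 1 : ℕ) : ℝ) := by exact_mod_cast hm0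
  generalize hmm : n + 1 = m at *
  set l := ⌊(1 / Real.exp 1) * (m : ℝ)⌋₊ with hl
  have he1 : 1 / Real.exp 1 ≤ 1 := by
    rw [div_le_one (Real.exp_pos 1)]
    exact Real.one_le_exp zero_le_one
  have hlm : l ≤ m := by
    refine Nat.floor_le_of_le ?_
    nlinarith
  have hL : m - l ≤ m := Nat.sub_le _ _
  have hcast : (m : ℝ) - ((m - l : ℕ) : ℝ) = l := by
    rw [Nat.cast_sub hlm]
    ring
  have hsplit : ∑ j ∈ Finset.range m, a j ≤
      ∑ j ∈ Finset.range (m - l), ∑ k ∈ Finset.range (j + 1), (1 : ℝ) / ((m : ℝ) - k) +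
        ((m : ℝ) - (m - l : ℕ)) := by
    rw [← Finset.sum_range_add_sum_Ico _ hL]
    refine add_le_add (Finset.sum_le_sum fun j hj =>
      (ha j ((Finset.mem_range.1 hj).trans_le hL)).2) ?_
    refine (Finset.sum_le_card_nsmul _ _ 1 fun j hj => (ha j (Finset.mem_Ico.1 hj).2).1).trans ?_
    rw [Nat.card_Ico, nsmul_eq_mul, mul_one, Nat.cast_sub hL]
  refine hsplit.trans ?_
  rw [sum_range_harmonic m _ hL]
  have hlog := log_le_sum_range m _ hL
  rw [hcast] at hlog ⊢
  have h1 := mul_le_mul_of_nonneg_left hlog (Nat.cast_nonneg (α := ℝ) l)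
  have h2 := mul_le_mul_of_nonneg_right hm hmpos.le
  have e : (1 - (l : ℝ) / m * Real.log (((m : ℝ) + 1) / ((l : ℝ) + 1))) * m =
      m - l * Real.log (((m : ℝ) + 1) / ((l : ℝ) + 1)) := by
    field_simp
  rw [e] at h2
  linarith

/-! ### The hard instance -/

namespace Network

/-- The instance of the upper bound: `m` resources with `c + 1` units that never return, and one
unit of reward for each use. The edges are chosen later. -/
noncomputable def hardNetwork (m c : ℕ) : Network (Fin m) (m * (c + 1)) where
  cap _ := c + 1
  cap_pos _ := Nat.succ_pos c
  arr t := (t.val : ℝ)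
  arr_strictMono _ _ h := Nat.cast_lt.2 h
  nbr _ := ∅
  usage _ := Measure.dirac ⊤
  usage_prob _ := inferInstance
  rew _ _ := 1
  rew_nonneg _ _ := zero_le_one
  rew_integrable _ := integrable_const _

/-- The edges of the upper bound: arrivals of phase `k` are adjacent to the resources
`σ k, σ (k + 1), …`. -/
def hardEdges {m c : ℕ} (σ : Equiv.Perm (Fin m)) (t : Fin (m * (c + 1))) : Finset (Fin m) :=
  Finset.univ.filter fun i => t.divNat ≤ σ.symm i

variable {m c : ℕ}

theorem meanRew_hardNetwork (E : Fin (m * (c + 1)) → Finset (Fin m)) (i : Fin m) :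
    ((hardNetwork m c).withNbr E).meanRew i = 1 := by
  have h : ((hardNetwork m c).withNbr E).meanRew i = ∫ _, (1 : ℝ) ∂(Measure.dirac (⊤ : ℝ≥0∞)) := rfl
  rw [h]
  simp

theorem cdf_hardNetwork (E : Fin (m * (c + 1)) → Finset (Fin m)) (i : Fin m)
    (τ t : Fin (m * (c + 1))) :
    ((hardNetwork m c).withNbr E).cdf i (((hardNetwork m c).withNbr E).elapsed τ t) = 0 := by
  have h : ∀ x : ℝ≥0∞, ((hardNetwork m c).withNbr E).cdf i x =
    (Measure.dirac (⊤ : ℝ≥0∞)).real (Set.Iic x) := fun x => rfl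
  rw [h, measureReal_def, Measure.dirac_apply' _ measurableSet_Iic]
  simp [elapsed]

theorem sum_divNat (f : Fin m → ℝ) :
    ∑ t : Fin (m * (c + 1)), f t.divNat = (c + 1) * ∑ k, f k := by
  have : ∀ t : Fin (m * (c + 1)), t.divNat = (finProdFinEquiv.symm t).1 := fun t => rfl
  simp only [this]
  rw [Equiv.sum_comp finProdFinEquiv.symm (fun q : Fin m × Fin (c + 1) => f q.1),
    Fintype.sum_prod_type, Finset.mul_sum]
  refine Finset.sum_congr rfl fun k _ => ?_
  simp

/-- The policy that allocates `σ k` in phase `k`. -/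
def phasePolicy (σ : Equiv.Perm (Fin m)) : ((hardNetwork m c).withNbr (hardEdges σ)).Policy where
  assign t _ := some (σ t.divNat)
  measurable_assign _ _ := MeasurableSet.const _
  adjacent t _ i h := by
    obtain rfl := Option.some.inj h
    simp [withNbr, hardEdges]
  available t ω i h := by
    obtain rfl := Option.some.inj h
    -- Earlier uses of the same resource lie in the current phase, which has at most `c` arrivals
    -- before `t`.
    have hsub : (Finset.univ.filter (fun τ : Fin (m * (c + 1)) => τ < t ∧
        some (σ τ.divNat) = some (σ t.divNat) ∧
        ((hardNetwork m c).withNbr (hardEdges σ)).elapsed τ t < ω.2 τ (σ t.divNat))).map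
          Fin.valEmbedding ⊆ Finset.Ico ((c + 1) * (t.val / (c + 1))) t.val := by
      intro x hx
      obtain ⟨τ, hτ, rfl⟩ := Finset.mem_map.1 hx
      obtain ⟨h1, h2, _⟩ := (Finset.mem_filter.1 hτ).2
      have h3 : τ.val / (c + 1) = t.val / (c + 1) := by
        have := congrArg Fin.val (σ.injective (Option.some.inj h2))
        simpa using this
      refine Finset.mem_Ico.2 ⟨?_, h1⟩
      rw [← h3]
      exact Nat.mul_div_le _ _
    have hcard := Finset.card_le_card hsub
    rw [Finset.card_map, Nat.card_Ico] at hcard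
    refine hcard.trans_lt ?_
    have h1 := Nat.div_add_mod t.val (c + 1)
    have h2 : t.val % (c + 1) < c + 1 := Nat.mod_lt t.val (Nat.succ_pos c)
    change _ < c + 1
    omega
  nonanticipating _ _ _ _ _ := rfl

theorem value_phasePolicy (σ : Equiv.Perm (Fin m)) :
    (phasePolicy (c := c) σ).value = m * (c + 1) := by
  have h : ∀ ω : Sample (Fin m) (m * (c + 1)),
      ((hardNetwork m c).withNbr (hardEdges σ)).totalReward
        (fun t => (phasePolicy (c := c) σ).assign t ω) ω.2 = m * (c + 1) := by
    intro ω
    have : ∀ t i, (if (phasePolicy (c := c) σ).assign t ω = some i then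
        ((hardNetwork m c).withNbr (hardEdges σ)).rew i (ω.2 t i) else 0) =
        if σ t.divNat = i then (1 : ℝ) else 0 := by
      intro t i
      simp [phasePolicy, withNbr, hardNetwork]
    unfold totalReward
    simp only [this]
    simp
  unfold Policy.value
  simp only [h]
  simp

/-- Two ranks not below the current phase have been adjacent to every arrival so far, so exchanging
them is invisible up to `t`. This is the symmetry behind the averaging. -/
theorem hardEdges_mul_swap (σ : Equiv.Perm (Fin m)) {t : Fin (m * (c + 1))} {j j' : Fin m}
    (hj : t.divNat ≤ j) (hj' : t.divNat ≤ j') {s : Fin (m * (c + 1))} (hs : s ≤ t) :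
    hardEdges (σ * Equiv.swap j j') s = hardEdges (c := c) σ s := by
  have hst : s.divNat ≤ t.divNat := by
    rw [Fin.le_def, Fin.coe_divNat, Fin.coe_divNat]
    exact Nat.div_le_div_right hs
  refine Finset.filter_congr fun i _ => ?_
  have e : (σ * Equiv.swap j j').symm i = Equiv.swap j j' (σ.symm i) := by
    simp [Equiv.Perm.mul_def]
  rw [e]
  rw [Equiv.swap_apply_def]
  split_ifs with h h
  · rw [h]
    exact iff_of_true (hst.trans hj') (hst.trans hj)
  · rw [h]
    exact iff_of_true (hst.trans hj) (hst.trans hj')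
  · rfl

/-- Averaged over the edges, no online algorithm gets more than a fraction of about `1 - 1 / e`. -/
theorem exists_hardEdges (m c : ℕ) (hm : 0 < m)
    (π : (E : Fin (m * (c + 1)) → Finset (Fin m)) → ((hardNetwork m c).withNbr E).Policy)
    (hπ : ∀ E E' t, (∀ τ ≤ t, E τ = E' τ) → (π E).assign t = (π E').assign t) :
    ∃ (σ : Equiv.Perm (Fin m)) (a : ℕ → ℝ),
      (∀ j < m, a j ≤ 1 ∧ a j ≤ ∑ k ∈ Finset.range (j + 1), (1 : ℝ) / ((m : ℝ) - k)) ∧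
      (π (hardEdges σ)).value ≤ (c + 1) * ∑ j ∈ Finset.range m, a j := by
  set P := (hardNetwork m c).law with hP
  set q := fun (σ : Equiv.Perm (Fin m)) t j =>
    P.real {ω | (π (hardEdges σ)).assign t ω = some (σ j)} with hq
  set Q := fun t j => ∑ σ, q σ t j with hQ
  set M := (Fintype.card (Equiv.Perm (Fin m)) : ℝ) with hM
  have hM0 : 0 < M := by
    rw [hM]
    exact_mod_cast Fintype.card_pos
  have hrun := fun σ => (π (hardEdges σ)).onlineRun
  have hq0 : ∀ σ t j, 0 ≤ q σ t j := fun σ t j => measureReal_nonneg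
  have hoff : ∀ σ t j, ¬ t.divNat ≤ j → q σ t j = 0 := by
    intro σ t j hj
    have : {ω | (π (hardEdges σ)).assign t ω = some (σ j)} = ∅ := by
      refine Set.eq_empty_of_forall_notMem fun ω hω => hj ?_
      have := (π (hardEdges σ)).adjacent t ω (σ j) hω
      simpa [withNbr, hardEdges] using this
    simp [hq, this]
  have hone : ∀ σ t, ∑ j, q σ t j ≤ 1 := by
    intro σ t
    refine sum_measureReal_le_one P _ (fun j => (π (hardEdges σ)).measurable_assign t (σ j))
      fun i j hij => ?_
    refine Set.disjoint_left.2 fun ω hi hj => hij ?_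
    exact σ.injective (Option.some.inj ((Eq.symm hi).trans hj))
  -- Units never return, so the fluid constraint at the last arrival counts all uses.
  have hcap : ∀ σ j, ∑ t, q σ t j ≤ c + 1 := by
    intro σ j
    have hT : 0 < m * (c + 1) := Nat.mul_pos hm (Nat.succ_pos c)
    set t₀ : Fin (m * (c + 1)) := ⟨m * (c + 1) - 1, by omega⟩ with ht₀
    have h := (hrun σ).fluid_capacity (fun t i ω => (π (hardEdges σ)).available t ω i) t₀ (σ j)
    simp only [cdf_hardNetwork, sub_zero, mul_one] at h
    have hf : Finset.univ.filter (fun τ : Fin (m * (c + 1)) => τ < t₀) =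
        Finset.univ.erase t₀ := by
      ext τ
      simp only [Finset.mem_filter, Finset.mem_univ, true_and, Finset.mem_erase, and_true,
        Fin.lt_def, ne_eq, Fin.ext_iff, ht₀]
      omega
    rw [hf] at h
    refine ((Finset.add_sum_erase Finset.univ (fun t => q σ t j)
      (Finset.mem_univ t₀)).symm.trans_le h).trans (le_of_eq ?_)
    simp [withNbr, hardNetwork]
  -- Reindex the sum over permutations by the swap of `j` and `j'`; by the online property the
  -- policy acts identically at `t` on both sets of edges.
  have hsymm : ∀ t j j', t.divNat ≤ j → t.divNat ≤ j' → Q t j = Q t j' := by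
    intro t j j' hj hj'
    simp only [hQ]
    rw [← Equiv.sum_comp (Equiv.mulRight (Equiv.swap j j')) (fun σ => q σ t j')]
    refine Finset.sum_congr rfl fun σ _ => ?_
    simp only [hq, Equiv.coe_mulRight]
    rw [hπ (hardEdges (σ * Equiv.swap j j')) (hardEdges σ) t
      fun s hs => hardEdges_mul_swap σ hj hj' hs]
    simp
  have hQle : ∀ t j, Q t j ≤ if t.divNat ≤ j then M * (1 / ((m : ℝ) - t.divNat)) else 0 := by
    intro t j
    split_ifs with hj
    · have hlt : (0 : ℝ) < (m : ℝ) - t.divNat := sub_pos.2 (by exact_mod_cast t.divNat.isLt)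
      have h1 : ((m : ℝ) - t.divNat) * Q t j ≤ M := by
        calc ((m : ℝ) - t.divNat) * Q t j = ∑ j' ∈ Finset.Ici t.divNat, Q t j' := by
              rw [Finset.sum_congr rfl fun j' hj' => (hsymm t j j' hj (Finset.mem_Ici.1 hj')).symm,
                Finset.sum_const, Fin.card_Ici, nsmul_eq_mul, Nat.cast_sub t.divNat.isLt.le]
          _ ≤ ∑ j', Q t j' := Finset.sum_le_univ_sum_of_nonneg fun j' =>
              Finset.sum_nonneg fun σ _ => hq0 σ t j'
          _ = ∑ σ, ∑ j', q σ t j' := Finset.sum_comm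
          _ ≤ ∑ _σ : Equiv.Perm (Fin m), (1 : ℝ) := Finset.sum_le_sum fun σ _ => hone σ t
          _ = M := by simp [hM]
      rw [mul_one_div, le_div_iff₀ hlt]
      linarith
    · exact (Finset.sum_eq_zero fun σ _ => hoff σ t j hj).le
  have hval : ∀ σ, (π (hardEdges σ)).value = ∑ j, ∑ t, q σ t j := by
    intro σ
    have e : (π (hardEdges σ)).value = _ := (hrun σ).integral_totalReward
    rw [e, ← Equiv.sum_comp σ]
    simp only [meanRew_hardNetwork, one_mul]
    rfl
  -- Expected fill level of the resource of rank `j`, averaged over the permutations.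
  set a := fun j : ℕ => if h : j < m then (∑ t, Q t ⟨j, h⟩) / (M * (c + 1)) else 0 with ha
  have hc0 : (0 : ℝ) < c + 1 := by positivity
  have hcancel : ∀ x : ℝ, M * ((c + 1) * (x / (M * (c + 1)))) = x := fun x => by field_simp
  have havg : ∑ σ, (π (hardEdges σ)).value =
      ∑ _σ : Equiv.Perm (Fin m), (c + 1) * ∑ j ∈ Finset.range m, a j := by
    rw [Finset.sum_const, Finset.card_univ, nsmul_eq_mul, ← Fin.sum_univ_eq_sum_range]
    simp only [hval]
    rw [Finset.sum_comm, Finset.mul_sum, Finset.mul_sum]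
    refine Finset.sum_congr rfl fun j _ => ?_
    rw [Finset.sum_comm]
    simp only [ha, Fin.is_lt, dif_pos]
    exact (hcancel _).symm
  obtain ⟨σ, _, hσ⟩ := Finset.exists_le_of_sum_le Finset.univ_nonempty havg.le
  refine ⟨σ, a, fun j hj => ?_, hσ⟩
  simp only [ha, dif_pos hj]
  refine ⟨?_, ?_⟩
  · rw [div_le_one (mul_pos hM0 hc0)]
    calc ∑ t, Q t ⟨j, hj⟩ = ∑ σ, ∑ t, q σ t ⟨j, hj⟩ := Finset.sum_comm
      _ ≤ ∑ _σ : Equiv.Perm (Fin m), ((c : ℝ) + 1) := Finset.sum_le_sum fun σ _ => hcap σ _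
      _ = M * (c + 1) := by rw [Finset.sum_const, Finset.card_univ, nsmul_eq_mul]
  · rw [div_le_iff₀ (mul_pos hM0 hc0)]
    refine (Finset.sum_le_sum fun t _ => hQle t ⟨j, hj⟩).trans (le_of_eq ?_)
    rw [sum_divNat (c := c) fun k => if k ≤ (⟨j, hj⟩ : Fin m) then M * (1 / ((m : ℝ) - k)) else 0]
    have e : ∑ k : Fin m, (if k ≤ (⟨j, hj⟩ : Fin m) then M * (1 / ((m : ℝ) - k)) else 0) =
        M * ∑ k ∈ Finset.range (j + 1), (1 : ℝ) / ((m : ℝ) - k) := by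
      rw [Finset.mul_sum]
      simp only [Fin.le_def]
      rw [Fin.sum_univ_eq_sum_range (fun k : ℕ => if k ≤ j then M * (1 / ((m : ℝ) - k)) else 0) m,
        ← Finset.sum_filter]
      refine Finset.sum_congr ?_ fun _ _ => rfl
      ext k
      simp only [Finset.mem_filter, Finset.mem_range]
      omega
    rw [e]
    ring

end Network

end Reusable

theorem theorem1 :
    -- the guarantees for matching and for assortments, with the same rate
    (∃ δ : ℕ → ℝ,
      (δ =O[atTop] fun c : ℕ => Real.sqrt (Real.log (c : ℝ) / (c : ℝ))) ∧
      Tendsto (fun c : ℕ => 1 - 1 / Real.exp 1 - δ c) atTop (𝓝 (1 - 1 / Real.exp 1)) ∧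
      (∀ (I : Type) [Fintype I] [LinearOrder I] [Nonempty I] (T : ℕ) (N : Network I T)
        (sel : Fin T → ArgmaxRule I) (π : N.Policy),
        (1 - 1 / Real.exp 1 - δ N.cmin) * π.value ≤ N.algValue sel) ∧
      (∀ (I : Type) [Fintype I] [LinearOrder I] [Nonempty I] (T : ℕ) (N : ChoiceNetwork I T)
        (orc : N.Oracle) (sel : Fin T → ArgmaxRule I) (π : N.Policy),
        (1 - 1 / Real.exp 1 - δ N.cmin) * π.value ≤ N.algValue orc sel)) ∧
    -- no online algorithm has a better guarantee, however large the inventories are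
    (∀ ε : ℝ, 0 < ε → ∀ c₀ : ℕ, ∃ (n T : ℕ) (N : Network (Fin (n + 1)) T), c₀ ≤ N.cmin ∧
      ∀ π : (E : Fin T → Finset (Fin (n + 1))) → (N.withNbr E).Policy,
        (∀ E E' t, (∀ τ ≤ t, E τ = E' τ) → (π E).assign t = (π E').assign t) →
        ∃ (E : Fin T → Finset (Fin (n + 1))) (ρ : (N.withNbr E).Policy),
          0 < ρ.value ∧ (π E).value ≤ (1 - 1 / Real.exp 1 + ε) * ρ.value) := by
  refine ⟨⟨loss, isBigO_loss, by simpa using tendsto_loss.const_sub (1 - 1 / Real.exp 1),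
    fun I _ _ _ T N sel π => N.competitive_alg sel π,
    fun I _ _ _ T N orc sel π => N.competitive_alg orc sel π⟩, fun ε hε c₀ => ?_⟩
  obtain ⟨n, hn⟩ := exists_harmonic_bound hε
  refine ⟨n, (n + 1) * (c₀ + 1), Network.hardNetwork (n + 1) c₀, ?_, fun π hπ => ?_⟩
  · exact Finset.le_inf' _ _ fun i _ => Nat.le_succ c₀
  obtain ⟨σ, a, ha, hle⟩ := Network.exists_hardEdges (n + 1) c₀ (Nat.succ_pos n) π hπ
  refine ⟨Network.hardEdges σ, Network.phasePolicy σ, ?_, ?_⟩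
  · rw [Network.value_phasePolicy]
    positivity
  · rw [Network.value_phasePolicy]
    refine hle.trans ((mul_le_mul_of_nonneg_left (hn a ha) (by positivity)).trans (le_of_eq ?_))
    ring
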